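/- **Setting (direct incentives).** A principal and an agent interact for $T$ rounds. In round $t$ a set of actions $\mathcal A_t$ is available and is observed by the principal. The principal posts a payment rule $x_t:\mathcal A_t\to\mathbb R_{\ge 0}$, computed by a (possibly randomized) measurable policy from $\mathcal A_1,\dots,\mathcal A_t$ and from the actions and noisy rewards of the earlier rounds. The agent takes an action $a_t\in\arg\max_{a\in\mathcal A_t}\,[x_t(a)-c(a)]$, where $c$ is his cost function; the principal observes $a_t$ and the noisy reward $r(a_t)+\epsilon_t$ and pays $x_t(a_t)$. The functions $r,c$ and the law of the noise are unknown to the principal. The noise $\epsilon_1,\epsilon_2,\dots$ is i.i.d., centered and $\sigma$-sub-Gaussian ($\mathbf E e^{s\epsilon_t}\le e^{\sigma^2s^2/2}$ for all $s\in\mathbb R$) with a known $\sigma>0$. The regret is $$\mathrm{Reg}(T)=\sum_{t=1}^T\Big(\max_{a\in\mathcal A_t}[r(a)-c(a)]-[r(a_t)-x_t(a_t)]\Big).$$ * *Multi-armed bandits with $N$ arms:* $\mathcal A_t=\{1,\dots,N\}$ for all $t$, and $r,c:\{1,\dots,N\}\to[0,1]$ are arbitrary. * *Linear bandits in dimension $d$:*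 each $\mathcal A_t\subset\mathbb R^d$ is a nonempty compact (possibly infinite) set, the sequence $(\mathcal A_t)$ is arbitrary, $r(a)=a^\top\theta$ and $c(a)=a^\top\gamma$ with $\|\theta\|,\|\gamma\|\le1$, and $\|a\|\le\sqrt d$, $r(a),c(a)\in[0,1]$ for all $a\in\mathcal A_t$ and all $t$. **Theorem.** Multi-armed bandits and linear bandits under direct incentives have minimax expected regret $\tilde\Theta(\sqrt T)$. That is, there is a $k\in\mathbb N$ such that: 1. (Upper bounds.) For all $N\ge1$ and $\sigma>0$ there is a constant $C=C(N,\sigma)$ such that for every $T\ge1$ the principal has a policy which, in every $N$-armed bandit with $\sigma$-sub-Gaussian noise, satisfies $\mathbf E[\mathrm{Reg}(T)]\le C\sqrt T\,(1+\log T)^k$. Likewise, for all $d\ge1$ and $\sigma>0$ there is $C=C(d,\sigma)$ such that for every $T\ge1$ the principal has a policy which, in every $d$-dimensional linear bandit with $\sigma$-sub-Gaussian noise, satisfies $\mathbf E[\mathrm{Reg}(T)]\le C\sqrt T\,(1+\log T)^k$. 2. (Lower bounds.) For all $N\ge2$ and $\sigma>0$ there is a constant $c_0=c_0(N,\sigma)>0$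 such that for every $T\ge1$ and every policy there is an $N$-armed bandit with $\sigma$-sub-Gaussian noise in which $\mathbf E[\mathrm{Reg}(T)]\ge c_0\sqrt T$. Likewise, for all $d\ge1$ and $\sigma>0$ there is $c_0=c_0(d,\sigma)>0$ such that for every $T\ge1$ and every policy there is a $d$-dimensional linear bandit with $\sigma$-sub-Gaussian noise in which $\mathbf E[\mathrm{Reg}(T)]\ge c_0\sqrt T$. In these instances a best-responding agent who breaks ties in favor of the principal exists (in the upper bounds: for the given policy and every instance; in the lower bounds: for the given policy and the hard instance), and the bounds hold for every best-responding agent whose choice in each round depends only on the posted contract and the round, however he breaks ties (subject to the actions being measurable). -/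

import Mathlib

open MeasureTheory ProbabilityTheory
open scoped NNReal

noncomputable section

/-- A bandit problem under direct incentives with actions in `α`: in round `t` (rounds are numbered
from `0`) the agent picks an action from `actionSet t`; an action `a` has mean reward `reward a`
for the principal and costs the agent `cost a`; the reward noise of the rounds is i.i.d. with law
`noise`. -/
structure Environment (α : Type) where
  actionSet : ℕ → Set α
  reward : α → ℝ
  cost : α → ℝ
  noise : Measure ℝ

/-- A (possibly randomized) learning algorithm of the principal. The contract of round `t` is a
payment rule `α → ℝ≥0`, contingent on the agent's action. It is computed from the action sets of
the rounds `0, …, t`, a private random seed, and the actions and noisy rewards observed in the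
rounds `0, …, t - 1`. -/
structure Policy (α : Type) [MeasurableSpace α] where
  seedLaw : Measure ℝ
  isProbabilityMeasure_seedLaw : IsProbabilityMeasure seedLaw
  contract : (t : ℕ) → (Fin (t + 1) → Set α) → ℝ → (Fin t → α × ℝ) → α → ℝ≥0
  measurable_contract : ∀ (t : ℕ) (S : Fin (t + 1) → Set α),
    Measurable fun p : (ℝ × (Fin t → α × ℝ)) × α => contract t S p.1.1 p.1.2 p.2

/-- The actions in `S` that maximize the agent's utility, payment minus cost. -/
def bestResponses {α : Type} (S : Set α) (c : α → ℝ) (x : α → ℝ≥0) : Set α :=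
  {a | a ∈ S ∧ ∀ b ∈ S, (x b : ℝ) - c b ≤ (x a : ℝ) - c a}

/-- The agent of round `t` only reacts to the contract posted in round `t`. -/
abbrev Agent (α : Type) : Type := ℕ → (α → ℝ≥0) → α

namespace Policy

variable {α : Type} [MeasurableSpace α]

/-- Actions and noisy rewards of the first `t` rounds, when the principal's seed is `ω.1` and the
noise of round `s` is `ω.2 s`. -/
def history (π : Policy α) (E : Environment α) (ag : Agent α) (ω : ℝ × (ℕ → ℝ)) :
    (t : ℕ) → Fin t → α × ℝ
  | 0 => Fin.elim0
  | t + 1 =>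
    let h := history π E ag ω t
    let a := ag t (π.contract t (fun s => E.actionSet s) ω.1 h)
    Fin.snoc (α := fun _ => α × ℝ) h (a, E.reward a + ω.2 t)

/-- The contract posted in round `t`. -/
def posted (π : Policy α) (E : Environment α) (ag : Agent α) (t : ℕ) (ω : ℝ × (ℕ → ℝ)) :
    α → ℝ≥0 :=
  π.contract t (fun s => E.actionSet s) ω.1 (π.history E ag ω t)

/-- The agent's action in round `t`. -/
def action (π : Policy α) (E : Environment α) (ag : Agent α) (t : ℕ) (ω : ℝ × (ℕ → ℝ)) : α :=
  ag t (π.posted E ag t ω)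

/-- The joint law of the seed and the noise sequence: the seed is independent of the noise, and
the noise is i.i.d. -/
def law (π : Policy α) (E : Environment α) : Measure (ℝ × (ℕ → ℝ)) :=
  π.seedLaw.prod (Measure.infinitePi fun _ : ℕ => E.noise)

/-- The regret of the first `T` rounds: the benchmark in a round is the largest reward minus cost
over the available actions; the principal gets the reward minus the payment of the action taken. -/
def regret (π : Policy α) (E : Environment α) (ag : Agent α) (T : ℕ) (ω : ℝ × (ℕ → ℝ)) : ℝ :=
  ∑ t ∈ Finset.range T,
    ((⨆ a : E.actionSet t, (E.reward a - E.cost a)) -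
      (E.reward (π.action E ag t ω) - (π.posted E ag t ω (π.action E ag t ω) : ℝ)))

/-- In every round the agent takes an action that maximizes his utility under the posted contract
(ties may be broken in any way for which the actions are random variables). -/
structure IsBestResponding (π : Policy α) (E : Environment α) (ag : Agent α) : Prop where
  mem_bestResponses : ∀ (t : ℕ) (ω : ℝ × (ℕ → ℝ)),
    π.action E ag t ω ∈ bestResponses (E.actionSet t) E.cost (π.posted E ag t ω)
  measurable_action : ∀ t : ℕ, Measurable (π.action E ag t)

/-- Among his best responses the agent takes one that is best for the principal. -/
def TiesFavorPrincipal (π : Policy α) (E : Environment α) (ag : Agent α) : Prop :=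
  ∀ (t : ℕ) (ω : ℝ × (ℕ → ℝ)),
    ∀ b ∈ bestResponses (E.actionSet t) E.cost (π.posted E ag t ω),
      E.reward b - (π.posted E ag t ω b : ℝ) ≤
        E.reward (π.action E ag t ω) - (π.posted E ag t ω (π.action E ag t ω) : ℝ)

/-- The policy can be run against a best-responding agent who breaks ties in favor of the
principal, and against every best-responding agent, however he breaks ties, its expected regret
after `T` rounds is finite and at most `B`. -/
def ExpectedRegretLE (π : Policy α) (E : Environment α) (T : ℕ) (B : ℝ) : Prop :=
  (∃ ag : Agent α, π.IsBestResponding E ag ∧ π.TiesFavorPrincipal E ag) ∧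
  ∀ ag : Agent α, π.IsBestResponding E ag →
    Integrable (π.regret E ag T) (π.law E) ∧ ∫ ω, π.regret E ag T ω ∂(π.law E) ≤ B

/-- The policy can be run against a best-responding agent who breaks ties in favor of the
principal, and against every best-responding agent, however he breaks ties, its expected regret
after `T` rounds is at least `B`. With bounded mean rewards and costs the regret is bounded below,
so that a regret that is not integrable has expectation `+∞`. -/
def ExpectedRegretGE (π : Policy α) (E : Environment α) (T : ℕ) (B : ℝ) : Prop :=
  (∃ ag : Agent α, π.IsBestResponding E ag ∧ π.TiesFavorPrincipal E ag) ∧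
  ∀ ag : Agent α, π.IsBestResponding E ag →
    Integrable (π.regret E ag T) (π.law E) → B ≤ ∫ ω, π.regret E ag T ω ∂(π.law E)

end Policy

/-- `ν` is a centered `σ`-sub-Gaussian probability law: `E exp (s X) ≤ exp (σ² s² / 2)` for
all real `s`. -/
structure IsSubgaussianNoise (σ : ℝ≥0) (ν : Measure ℝ) : Prop where
  isProbabilityMeasure : IsProbabilityMeasure ν
  centered : ∫ z, z ∂ν = 0
  subgaussian : HasSubgaussianMGF (fun z : ℝ => z) (σ ^ 2) ν

/-- Multi-armed bandits under direct incentives: `N` arms, all of them available in each round. -/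
structure IsMultiArmedBandit (N : ℕ) (σ : ℝ≥0) (E : Environment (Fin N)) : Prop where
  actionSet_eq : ∀ t, E.actionSet t = Set.univ
  reward_mem : ∀ i, E.reward i ∈ Set.Icc (0 : ℝ) 1
  cost_mem : ∀ i, E.cost i ∈ Set.Icc (0 : ℝ) 1
  noise : IsSubgaussianNoise σ E.noise

/-- Linear bandits under direct incentives: mean reward and cost are linear in the action, and an
arbitrary, possibly infinite set of actions (contexts) is available in each round. -/
structure IsLinearBandit (d : ℕ) (σ : ℝ≥0) (E : Environment (EuclideanSpace ℝ (Fin d))) :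
    Prop where
  exists_parameters : ∃ θ γ : EuclideanSpace ℝ (Fin d), ‖θ‖ ≤ 1 ∧ ‖γ‖ ≤ 1 ∧
    (E.reward = fun a => inner ℝ a θ) ∧ (E.cost = fun a => inner ℝ a γ)
  nonempty : ∀ t, (E.actionSet t).Nonempty
  isCompact : ∀ t, IsCompact (E.actionSet t)
  norm_le : ∀ t, ∀ a ∈ E.actionSet t, ‖a‖ ≤ √(d : ℝ)
  reward_mem : ∀ t, ∀ a ∈ E.actionSet t, E.reward a ∈ Set.Icc (0 : ℝ) 1
  cost_mem : ∀ t, ∀ a ∈ E.actionSet t, E.cost a ∈ Set.Icc (0 : ℝ) 1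
  noise : IsSubgaussianNoise σ E.noise

end

/-!
For the upper bounds, both models are linear in features of the actions; the features of the arms
are the unit vectors. The reward parameter is estimated by ridge regression, with self-normalized
confidence ellipsoids from the method of mixtures, and the cost parameter is confined to a second
ellipsoid. In each round the principal pays for a single, optimistically chosen target action: its
estimated extra cost over the cheapest-looking action, plus a bonus of order `1 / √T`. If the agent
rejects the target, or accepts it while its extra cost is still uncertain by more than the accuracy
`1 / √T`, then his choice reveals a half-space, with the centre of the ellipsoid only slightly
inside, that contains the cost parameter, and the ellipsoid can be replaced by one whose volume is
smaller by a constant factor. Only directions in which its width is at least of order `1 / √T` are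
cut, so there are `O(log T)` such rounds. In all other rounds the regret is at most the width of the
confidence interval for the reward plus `O(1 / √T)`, and the elliptical potential lemma sums the
widths to `O(√T * log T)`. Infinite action sets are replaced by finite nets.

For the lower bounds, only one action of the hard instances is profitable. Its reward is either
`1 / 2` or `1 / 2 + δ` with `δ` of order `1 / √T`, and its cost lies in between, so the principal
should pay for it in one of the two instances only. By a Gaussian change of measure no policy can
tell them apart in `T` rounds. The costs are scaled by a factor outside the countable set of those
for which ties have positive probability, so all best-responding agents behave alike almost surely.
-/

section Choice

/-- An element of `S` that satisfies `p`; a junk value if there is none. That the choice depends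
only on the truth values of `p` on `S` makes it measurable in parameters, see
`measurable_chooseIn`. -/
noncomputable def chooseIn {α : Type*} [Nonempty α] (S : Finset α) (p : α → Prop) : α :=
  Classical.epsilon fun a => a ∈ S ∧ p a

theorem chooseIn_spec {α : Type*} [Nonempty α] {S : Finset α} {p : α → Prop}
    (h : ∃ a ∈ S, p a) : chooseIn S p ∈ S ∧ p (chooseIn S p) :=
  Classical.epsilon_spec (p := fun a => a ∈ S ∧ p a) h

theorem measurable_chooseIn {α Ω : Type*} [Nonempty α] [MeasurableSpace α] [MeasurableSpace Ω]
    (S : Finset α) {p : Ω → α → Prop} (hp : ∀ a ∈ S, MeasurableSet {ω | p ω a}) :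
    Measurable fun ω => chooseIn S (p ω) := by
  let choice : (S → Prop) → α := fun q => Classical.epsilon fun a => ∃ h : a ∈ S, q ⟨a, h⟩
  have factor : (fun ω => chooseIn S (p ω)) = choice ∘ fun ω (a : S) => p ω a := by
    funext ω
    simp only [choice, Function.comp_apply, chooseIn, exists_prop]
  rw [factor]
  refine (measurable_of_countable choice).comp (measurable_pi_lambda _ fun a => ?_)
  exact measurableSet_setOfPred.mp (hp a a.2)

end Choice

section Resampling

variable {ι : Type*} [DecidableEq ι] {X : ι → Type*} [∀ i, MeasurableSpace (X i)]

theorem measurePreserving_update_infinitePi (μ : ∀ i, Measure (X i))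
    [∀ i, IsProbabilityMeasure (μ i)] (t : ι) :
    MeasurePreserving (fun p : (∀ i, X i) × X t => Function.update p.1 t p.2)
      ((Measure.infinitePi μ).prod (μ t)) (Measure.infinitePi μ) := by
  refine ⟨measurable_update', Measure.eq_infinitePi _ fun s u hu => ?_⟩
  rw [Measure.map_apply measurable_update' (.pi s.countable_toSet fun i _ => hu i)]
  have preimage : (fun p : (∀ i, X i) × X t => Function.update p.1 t p.2) ⁻¹' Set.pi s u =
      Set.pi ↑(s.erase t) u ×ˢ {x | t ∈ s → x ∈ u t} := by
    ext ⟨x, z⟩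
    have mem_update : (∀ i, i ∈ s → Function.update x t z i ∈ u i) ↔
        (t ∈ s → z ∈ u t) ∧ ∀ i, i ≠ t → i ∈ s → x i ∈ u i :=
      Function.forall_update_iff x fun i y => i ∈ s → y ∈ u i
    simp only [Set.mem_preimage, Set.mem_pi, Finset.mem_coe, mem_update, Set.mem_prod,
      Set.mem_ofPred_eq, Finset.mem_erase, and_imp]
    exact and_comm
  rw [preimage, Measure.prod_prod, Measure.infinitePi_pi _ fun i _ => hu i]
  by_cases ht : t ∈ s
  · simp [ht, Finset.prod_erase_mul _ _ ht]
  · simp [ht]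

end Resampling

section ResampleNoise

/-- The outcome `ω`, a seed and a noise sequence, with the noise of round `t` replaced by `z`. -/
def resample (t : ℕ) (ω : ℝ × (ℕ → ℝ)) (z : ℝ) : ℝ × (ℕ → ℝ) := (ω.1, Function.update ω.2 t z)

theorem measurable_resample (t : ℕ) :
    Measurable fun p : (ℝ × (ℕ → ℝ)) × ℝ => resample t p.1 p.2 :=
  measurable_fst.fst.prodMk <|
    measurable_update'.comp (measurable_fst.snd.prodMk measurable_snd)

theorem lintegral_resample (μ : Measure ℝ) [SFinite μ] (ν : Measure ℝ) [IsProbabilityMeasure ν]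
    (t : ℕ) {G : ℝ × (ℕ → ℝ) → ENNReal} (hG : Measurable G) :
    ∫⁻ ω, G ω ∂(μ.prod (Measure.infinitePi fun _ : ℕ => ν)) =
      ∫⁻ ω, ∫⁻ z, G (resample t ω z) ∂ν ∂(μ.prod (Measure.infinitePi fun _ : ℕ => ν)) := by
  have measurable_inner : Measurable fun ω => ∫⁻ z, G (resample t ω z) ∂ν :=
    (hG.comp (measurable_resample t)).lintegral_prod_right'
  rw [lintegral_prod _ hG.aemeasurable, lintegral_prod _ measurable_inner.aemeasurable]
  refine lintegral_congr fun x => ?_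
  have hGx : Measurable fun y => G (x, y) := hG.comp measurable_prodMk_left
  rw [← (measurePreserving_update_infinitePi (fun _ : ℕ => ν) t).lintegral_comp hGx]
  exact lintegral_prod _ (hGx.comp measurable_update').aemeasurable

end ResampleNoise

section SubgaussianQuadratic

open Real

theorem lintegral_exp_mul_le {Ω : Type*} [MeasurableSpace Ω] {μ : Measure Ω} {X : Ω → ℝ}
    {c : ℝ≥0} (h : HasSubgaussianMGF X c μ) (s : ℝ) :
    ∫⁻ ω, ENNReal.ofReal (exp (s * X ω)) ∂μ ≤ ENNReal.ofReal (exp (c * s ^ 2 / 2)) := by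
  rw [← ofReal_integral_eq_lintegral_ofReal (h.integrable_exp_mul s)
    (.of_forall fun ω => (exp_pos _).le)]
  exact ENNReal.ofReal_le_ofReal (h.mgf_le s)

theorem lintegral_exp_mul_gaussianReal (v : ℝ≥0) (s : ℝ) :
    ∫⁻ g, ENNReal.ofReal (exp (s * g)) ∂(gaussianReal 0 v) =
      ENNReal.ofReal (exp (v * s ^ 2 / 2)) := by
  rw [← ofReal_integral_eq_lintegral_ofReal (integrable_exp_mul_gaussianReal s)
    (.of_forall fun g => (exp_pos _).le)]
  have mgf_eq := congrFun (mgf_id_gaussianReal (μ := 0) (v := v)) s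
  simp only [mgf, id, zero_mul, zero_add] at mgf_eq
  rw [mgf_eq]

variable {a b c v : ℝ}

theorem gaussianPDFReal_mul_exp_quadratic (hv : 0 < v) (hb : b ^ 2 * c = 1 - 1 / v) (g : ℝ) :
    gaussianPDFReal 0 1 g * exp (c * (a + b * g) ^ 2 / 2) =
      √v * exp (a ^ 2 * c * v / 2) * gaussianPDFReal (a * c * b * v) v.toNNReal g := by
  have complete_square : -g ^ 2 / 2 + c * (a + b * g) ^ 2 / 2 =
      a ^ 2 * c * v / 2 + -(g - a * c * b * v) ^ 2 / (2 * v) := by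
    field_simp
    field_simp at hb
    linear_combination (v * a ^ 2 * c + g ^ 2) * hb
  have sqrt_ne_zero : √v ≠ 0 := (sqrt_pos.2 hv).ne'
  simp only [gaussianPDFReal, NNReal.coe_one, coe_toNNReal v hv.le, mul_one, sub_zero]
  calc (√(2 * π))⁻¹ * exp (-g ^ 2 / 2) * exp (c * (a + b * g) ^ 2 / 2)
      = (√(2 * π))⁻¹ * exp (a ^ 2 * c * v / 2 + -(g - a * c * b * v) ^ 2 / (2 * v)) := by
        rw [mul_assoc, ← exp_add, complete_square]
    _ = √v * exp (a ^ 2 * c * v / 2) *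
          ((√(2 * π * v))⁻¹ * exp (-(g - a * c * b * v) ^ 2 / (2 * v))) := by
        rw [exp_add, sqrt_mul' _ hv.le]
        field_simp

theorem lintegral_exp_quadratic_gaussianReal (hv : 0 < v) (hb : b ^ 2 * c = 1 - 1 / v) :
    ∫⁻ g, ENNReal.ofReal (exp (c * (a + b * g) ^ 2 / 2)) ∂(gaussianReal 0 1) =
      ENNReal.ofReal (√v * exp (a ^ 2 * c * v / 2)) := by
  rw [gaussianReal_of_var_ne_zero _ one_ne_zero,
    lintegral_withDensity_eq_lintegral_mul _ (measurable_gaussianPDF _ _) (by fun_prop)]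
  calc ∫⁻ g, gaussianPDF 0 1 g * ENNReal.ofReal (exp (c * (a + b * g) ^ 2 / 2))
      = ∫⁻ g, ENNReal.ofReal (√v * exp (a ^ 2 * c * v / 2)) *
          gaussianPDF (a * c * b * v) v.toNNReal g := by
        refine lintegral_congr fun g => ?_
        rw [gaussianPDF, gaussianPDF, ← ENNReal.ofReal_mul (gaussianPDFReal_nonneg _ _ _),
          ← ENNReal.ofReal_mul (by positivity), gaussianPDFReal_mul_exp_quadratic hv hb]
    _ = ENNReal.ofReal (√v * exp (a ^ 2 * c * v / 2)) := by
        rw [lintegral_const_mul _ (measurable_gaussianPDF _ _),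
          lintegral_gaussianPDF_eq_one _ (by simpa using hv), mul_one]

/- Since `exp (y² / 2)` is the Gaussian average of `exp (y g)`, the quadratic exponent becomes
linear in `x` under the average over `g`, where the sub-Gaussian bound applies. -/
theorem lintegral_exp_quadratic_le {ν : Measure ℝ} [SFinite ν] {c : ℝ≥0}
    (h : HasSubgaussianMGF (fun x : ℝ => x) c ν) (hv : 0 < v) (hb : b ^ 2 * c = 1 - 1 / v) :
    ∫⁻ x, ENNReal.ofReal (exp (a * x + b ^ 2 * x ^ 2 / 2)) ∂ν ≤
      ENNReal.ofReal (√v * exp (a ^ 2 * c * v / 2)) := by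
  have linearize (x : ℝ) : ENNReal.ofReal (exp (a * x + b ^ 2 * x ^ 2 / 2)) =
      ∫⁻ g, ENNReal.ofReal (exp ((a + b * g) * x)) ∂(gaussianReal 0 1) := by
    have factor (g : ℝ) : ENNReal.ofReal (exp ((a + b * g) * x)) =
        ENNReal.ofReal (exp (a * x)) * ENNReal.ofReal (exp (b * x * g)) := by
      rw [← ENNReal.ofReal_mul (exp_pos _).le, ← exp_add]
      ring_nf
    simp_rw [factor]
    rw [lintegral_const_mul _ (by fun_prop), lintegral_exp_mul_gaussianReal,
      ← ENNReal.ofReal_mul (exp_pos _).le, ← exp_add, NNReal.coe_one, one_mul, mul_pow]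
  calc ∫⁻ x, ENNReal.ofReal (exp (a * x + b ^ 2 * x ^ 2 / 2)) ∂ν
      = ∫⁻ g, ∫⁻ x, ENNReal.ofReal (exp ((a + b * g) * x)) ∂ν ∂(gaussianReal 0 1) := by
        simp_rw [linearize]
        rw [lintegral_lintegral_swap (by fun_prop)]
    _ ≤ ∫⁻ g, ENNReal.ofReal (exp (c * (a + b * g) ^ 2 / 2)) ∂(gaussianReal 0 1) :=
        lintegral_mono fun g => lintegral_exp_mul_le h _
    _ = ENNReal.ofReal (√v * exp (a ^ 2 * c * v / 2)) :=
        lintegral_exp_quadratic_gaussianReal hv hb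

end SubgaussianQuadratic

/-! ### Rank-one updates and shallow-cut ellipsoids -/

section RankOne

open Matrix

variable {n : Type*}

/-- The rank-one perturbation `A + s w wᵀ` of `A`. -/
noncomputable def rankOneUpdate (A : Matrix n n ℝ) (s : ℝ) (w : n → ℝ) : Matrix n n ℝ :=
  A + s • vecMulVec w w

variable {A : Matrix n n ℝ} {s : ℝ}

theorem posDef_rankOneUpdate [Finite n] (hA : A.PosDef) (hs : 0 ≤ s) (w : n → ℝ) :
    (rankOneUpdate A s w).PosDef :=
  hA.add_posSemidef ((posSemidef_vecMulVec_self_star w).smul hs)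

variable [Fintype n]

theorem rankOneUpdate_mulVec (A : Matrix n n ℝ) (s : ℝ) (w x : n → ℝ) :
    rankOneUpdate A s w *ᵥ x = A *ᵥ x + (s * (w ⬝ᵥ x)) • w := by
  rw [rankOneUpdate, add_mulVec, smul_mulVec, vecMulVec_mulVec, op_smul_eq_smul, smul_smul]

theorem dotProduct_rankOneUpdate_mulVec (A : Matrix n n ℝ) (s : ℝ) (w x : n → ℝ) :
    x ⬝ᵥ rankOneUpdate A s w *ᵥ x = x ⬝ᵥ A *ᵥ x + s * (w ⬝ᵥ x) ^ 2 := by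
  rw [rankOneUpdate_mulVec, dotProduct_add, dotProduct_smul, dotProduct_comm x w, smul_eq_mul]
  ring

theorem dotProduct_le_dotProduct_rankOneUpdate_mulVec (hs : 0 ≤ s)
    (hA : ∀ x : n → ℝ, x ⬝ᵥ x ≤ x ⬝ᵥ A *ᵥ x) (w x : n → ℝ) :
    x ⬝ᵥ x ≤ x ⬝ᵥ rankOneUpdate A s w *ᵥ x := by
  rw [dotProduct_rankOneUpdate_mulVec]
  exact (hA x).trans (le_add_of_nonneg_right (by positivity))

theorem trace_rankOneUpdate (A : Matrix n n ℝ) (s : ℝ) (w : n → ℝ) :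
    (rankOneUpdate A s w).trace = A.trace + s * (w ⬝ᵥ w) := by
  rw [rankOneUpdate, trace_add, trace_smul, trace_vecMulVec, smul_eq_mul]

theorem posDef_dotProduct_mulVec_comm (hA : A.PosDef) (x y : n → ℝ) :
    x ⬝ᵥ A *ᵥ y = y ⬝ᵥ A *ᵥ x := by
  have transpose_eq : Aᵀ = A := by simpa using hA.isHermitian.eq
  rw [dotProduct_mulVec, ← mulVec_transpose, transpose_eq, dotProduct_comm]

variable [DecidableEq n]

theorem det_le_trace_pow_card (hA : A.PosSemidef) : A.det ≤ A.trace ^ Fintype.card n := by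
  rw [hA.isHermitian.det_eq_prod_eigenvalues, hA.isHermitian.trace_eq_sum_eigenvalues]
  simp only [RCLike.ofReal_real_eq_id, id]
  rw [← Finset.card_univ]
  calc ∏ i, hA.isHermitian.eigenvalues i
      ≤ ∏ _i : n, ∑ j, hA.isHermitian.eigenvalues j :=
        Finset.prod_le_prod (fun i _ => hA.eigenvalues_nonneg i) fun i _ =>
          Finset.single_le_sum (fun j _ => hA.eigenvalues_nonneg j) (Finset.mem_univ i)
    _ = (∑ j, hA.isHermitian.eigenvalues j) ^ Finset.card Finset.univ := Finset.prod_const _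

theorem posDef_mulVec_inv_mulVec (hA : A.PosDef) (x : n → ℝ) : A *ᵥ A⁻¹ *ᵥ x = x := by
  rw [mulVec_mulVec, mul_nonsing_inv _ hA.det_pos.ne'.isUnit, one_mulVec]

theorem posDef_inv_mulVec_mulVec (hA : A.PosDef) (x : n → ℝ) : A⁻¹ *ᵥ A *ᵥ x = x := by
  rw [mulVec_mulVec, nonsing_inv_mul _ hA.det_pos.ne'.isUnit, one_mulVec]

/-- The square of the norm dual to `x ↦ √(x ⬝ᵥ A *ᵥ x)`: the width of the ellipsoid
`{x | x ⬝ᵥ A *ᵥ x ≤ 1}` in the direction `w` is `2 * √(dualSq A w)`. -/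
noncomputable def dualSq (A : Matrix n n ℝ) (w : n → ℝ) : ℝ := w ⬝ᵥ A⁻¹ *ᵥ w

theorem dualSq_nonneg (hA : A.PosDef) (w : n → ℝ) : 0 ≤ dualSq A w := by
  simpa [dualSq] using hA.inv.posSemidef.dotProduct_mulVec_nonneg w

theorem det_rankOneUpdate (hA : A.PosDef) (s : ℝ) (w : n → ℝ) :
    (rankOneUpdate A s w).det = A.det * (1 + s * dualSq A w) := by
  have det_add := det_add_replicateCol_mul_replicateRow (ι := Unit) hA.det_pos.ne'.isUnit (s • w) w
  rw [← vecMulVec_eq, smul_vecMulVec, Matrix.mul_assoc, ← replicateCol_mulVec] at det_add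
  rw [rankOneUpdate, det_add, det_unique (n := Unit), Matrix.add_apply, one_apply_eq,
    replicateRow_mul_replicateCol_apply, mulVec_smul, dotProduct_smul, smul_eq_mul, dualSq]

theorem dotProduct_mulVec_sub_smul_inv (hA : A.PosDef) (w e : n → ℝ) (t : ℝ) :
    (e - t • A⁻¹ *ᵥ w) ⬝ᵥ A *ᵥ (e - t • A⁻¹ *ᵥ w) =
      e ⬝ᵥ A *ᵥ e - 2 * t * (w ⬝ᵥ e) + t ^ 2 * dualSq A w := by
  rw [mulVec_sub, mulVec_smul, posDef_mulVec_inv_mulVec hA, dotProduct_sub, sub_dotProduct,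
    sub_dotProduct, smul_dotProduct, smul_dotProduct, dotProduct_smul, dotProduct_smul,
    posDef_dotProduct_mulVec_comm hA (A⁻¹ *ᵥ w) e, posDef_mulVec_inv_mulVec hA,
    dotProduct_comm e w, dotProduct_comm (A⁻¹ *ᵥ w) w, ← dualSq]
  simp only [smul_eq_mul]
  ring

/- Cauchy–Schwarz for the form of `A⁻¹` applied to `w` and `A *ᵥ e`. -/
theorem dotProduct_sq_le_dualSq_mul (hA : A.PosDef) (w e : n → ℝ) :
    (w ⬝ᵥ e) ^ 2 ≤ dualSq A w * (e ⬝ᵥ A *ᵥ e) := by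
  have symm : LinearMap.IsSymm (toBilin' A⁻¹) := ⟨fun x y => by
    simpa only [toBilin'_apply', RingHom.id_apply] using posDef_dotProduct_mulVec_comm hA.inv x y⟩
  have nonneg (x : n → ℝ) : 0 ≤ toBilin' A⁻¹ x x := by
    simpa only [toBilin'_apply', dualSq] using dualSq_nonneg hA x
  have cauchy_schwarz := (toBilin' A⁻¹).apply_sq_le_of_symm nonneg symm w (A *ᵥ e)
  simpa only [toBilin'_apply', posDef_inv_mulVec_mulVec hA, dotProduct_comm (A *ᵥ e) e, dualSq]
    using cauchy_schwarz

theorem dualSq_le_dotProduct (hA : A.PosDef) (hle : ∀ x : n → ℝ, x ⬝ᵥ x ≤ x ⬝ᵥ A *ᵥ x)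
    (w : n → ℝ) : dualSq A w ≤ w ⬝ᵥ w := by
  have inv_norm_le : (A⁻¹ *ᵥ w) ⬝ᵥ (A⁻¹ *ᵥ w) ≤ dualSq A w := by
    have := hle (A⁻¹ *ᵥ w)
    rwa [posDef_mulVec_inv_mulVec hA, dotProduct_comm (A⁻¹ *ᵥ w) w] at this
  have cauchy_schwarz : dualSq A w ^ 2 ≤ (w ⬝ᵥ w) * ((A⁻¹ *ᵥ w) ⬝ᵥ (A⁻¹ *ᵥ w)) := by
    simpa [dualSq] using dotProduct_sq_le_dualSq_mul (A := (1 : Matrix n n ℝ)) .one w (A⁻¹ *ᵥ w)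
  have hw : 0 ≤ w ⬝ᵥ w := by simpa using dotProduct_star_self_nonneg w
  by_contra! hlt
  nlinarith

theorem inv_rankOneUpdate_mulVec (hA : A.PosDef) (hs : 0 ≤ s) (w x : n → ℝ) :
    (rankOneUpdate A s w)⁻¹ *ᵥ x =
      A⁻¹ *ᵥ x - (s * (w ⬝ᵥ A⁻¹ *ᵥ x) / (1 + s * dualSq A w)) • A⁻¹ *ᵥ w := by
  set coeff := s * (w ⬝ᵥ A⁻¹ *ᵥ x) / (1 + s * dualSq A w) with coeff_def
  have denominator_ne_zero : 1 + s * dualSq A w ≠ 0 := by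
    have := dualSq_nonneg hA w
    positivity
  have coeff_eq : s * (w ⬝ᵥ A⁻¹ *ᵥ x - coeff * dualSq A w) = coeff := by
    rw [coeff_def]
    field_simp
    ring
  have solves : rankOneUpdate A s w *ᵥ (A⁻¹ *ᵥ x - coeff • A⁻¹ *ᵥ w) = x := by
    rw [rankOneUpdate_mulVec, mulVec_sub, mulVec_smul, posDef_mulVec_inv_mulVec hA,
      posDef_mulVec_inv_mulVec hA, dotProduct_sub, dotProduct_smul, ← dualSq, smul_eq_mul,
      coeff_eq, sub_add_cancel]
  rw [← posDef_inv_mulVec_mulVec (posDef_rankOneUpdate hA hs w) (A⁻¹ *ᵥ x - coeff • A⁻¹ *ᵥ w),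
    solves]

theorem dualSq_rankOneUpdate_add_smul (hA : A.PosDef) (w x : n → ℝ) (η : ℝ) :
    dualSq (rankOneUpdate A 1 w) (x + η • w) =
      dualSq A x + (-(w ⬝ᵥ A⁻¹ *ᵥ x) ^ 2 + 2 * η * (w ⬝ᵥ A⁻¹ *ᵥ x) + η ^ 2 * dualSq A w) /
        (1 + dualSq A w) := by
  have denominator_ne_zero : 1 + dualSq A w ≠ 0 := by
    have := dualSq_nonneg hA w
    positivity
  have fold_dualSq (y : n → ℝ) : y ⬝ᵥ A⁻¹ *ᵥ y = dualSq A y := rfl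
  rw [dualSq, inv_rankOneUpdate_mulVec hA zero_le_one]
  simp only [mulVec_add, mulVec_smul, dotProduct_sub, dotProduct_add, add_dotProduct,
    smul_dotProduct, dotProduct_smul, smul_eq_mul, posDef_dotProduct_mulVec_comm hA.inv x w,
    fold_dualSq, one_mul]
  field_simp
  ring

/-- The matrix of the ellipsoid in the ellipsoid method with shallow cuts: a point of the ellipsoid
of `A` around `g` on the far side of a hyperplane with normal vector `w` that misses `g` by little
lies in the ellipsoid of `ellipsoidUpdate κ A w` around `centreUpdate κ A g w`, see
`mem_ellipsoidUpdate`. -/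
noncomputable def ellipsoidUpdate (κ : ℝ) (A : Matrix n n ℝ) (w : n → ℝ) : Matrix n n ℝ :=
  (1 + κ ^ 2 / 2)⁻¹ • rankOneUpdate A (κ / dualSq A w) w

/-- The centre of the ellipsoid that belongs to `ellipsoidUpdate κ A w`. -/
noncomputable def centreUpdate (κ : ℝ) (A : Matrix n n ℝ) (g w : n → ℝ) : n → ℝ :=
  g - (κ / (2 * (1 + κ)) / √(dualSq A w)) • A⁻¹ *ᵥ w

variable {κ : ℝ}

theorem posDef_ellipsoidUpdate (hA : A.PosDef) (hκ : 0 ≤ κ) (w : n → ℝ) :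
    (ellipsoidUpdate κ A w).PosDef :=
  (posDef_rankOneUpdate hA (div_nonneg hκ (dualSq_nonneg hA w)) w).smul (by positivity)

theorem dotProduct_ellipsoidUpdate_mulVec_sub_smul_inv (hA : A.PosDef) (κ : ℝ) (w e : n → ℝ)
    (t : ℝ) :
    (e - t • A⁻¹ *ᵥ w) ⬝ᵥ ellipsoidUpdate κ A w *ᵥ (e - t • A⁻¹ *ᵥ w) =
      (1 + κ ^ 2 / 2)⁻¹ * (e ⬝ᵥ A *ᵥ e - 2 * t * (w ⬝ᵥ e) + t ^ 2 * dualSq A w +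
        κ / dualSq A w * (w ⬝ᵥ e - t * dualSq A w) ^ 2) := by
  rw [ellipsoidUpdate, smul_mulVec, dotProduct_smul, dotProduct_rankOneUpdate_mulVec,
    dotProduct_mulVec_sub_smul_inv hA, dotProduct_sub, dotProduct_smul, ← dualSq, smul_eq_mul,
    smul_eq_mul]

/- `z` is the position of the point relative to the cut, in units of the dual norm of `w`. -/
theorem shallow_cut_scalar_bound {z : ℝ} (hκ : 0 < κ) (hκ_le : κ ≤ 1) (hz : -(κ / 8) ≤ z)
    (hz_le : z ≤ 1) :
    -(2 * (κ / (2 * (1 + κ))) * z) + (κ / (2 * (1 + κ))) ^ 2 +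
      κ * (z - κ / (2 * (1 + κ))) ^ 2 ≤ κ ^ 2 / 2 := by
  have expand : -(2 * (κ / (2 * (1 + κ))) * z) + (κ / (2 * (1 + κ))) ^ 2 +
      κ * (z - κ / (2 * (1 + κ))) ^ 2 = κ * (z * (z - 1)) + κ ^ 2 / (4 * (1 + κ)) := by
    field_simp
    ring
  have parabola_le : z * (z - 1) ≤ κ / 4 := by
    rcases le_or_gt 0 z with hz₀ | hz₀ <;> nlinarith
  have quotient_le : κ ^ 2 / (4 * (1 + κ)) ≤ κ ^ 2 / 4 := by
    gcongr
    linarith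
  nlinarith

theorem mem_ellipsoidUpdate (hA : A.PosDef) (hκ : 0 < κ) (hκ_le : κ ≤ 1) {g γ w : n → ℝ}
    (hmem : (g - γ) ⬝ᵥ A *ᵥ (g - γ) ≤ 1) (hw : 0 < dualSq A w)
    (hcut : -(κ / 8) * √(dualSq A w) ≤ w ⬝ᵥ (g - γ)) :
    (centreUpdate κ A g w - γ) ⬝ᵥ ellipsoidUpdate κ A w *ᵥ (centreUpdate κ A g w - γ) ≤ 1 := by
  set r := √(dualSq A w) with r_def
  have hr : 0 < r := Real.sqrt_pos.2 hw
  have r_sq : dualSq A w = r ^ 2 := (Real.sq_sqrt hw.le).symm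
  obtain ⟨z, hz⟩ : ∃ z, w ⬝ᵥ (g - γ) = z * r := ⟨_, (div_mul_cancel₀ _ hr.ne').symm⟩
  have neg_le_z : -(κ / 8) ≤ z := le_of_mul_le_mul_right (hz ▸ hcut) hr
  have z_le_one : z ≤ 1 := by
    have cauchy_schwarz := dotProduct_sq_le_dualSq_mul hA w (g - γ)
    rw [hz, r_sq, mul_pow, mul_comm] at cauchy_schwarz
    have z_sq_le : z ^ 2 ≤ 1 := (le_of_mul_le_mul_left cauchy_schwarz (by positivity)).trans hmem
    exact le_of_sq_le_sq (by simpa using z_sq_le) zero_le_one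
  have centre_sub : centreUpdate κ A g w - γ =
      (g - γ) - (κ / (2 * (1 + κ)) / r) • A⁻¹ *ᵥ w := by
    rw [centreUpdate, ← r_def, sub_right_comm]
  have normalize : (g - γ) ⬝ᵥ A *ᵥ (g - γ) - 2 * (κ / (2 * (1 + κ)) / r) * (z * r) +
        (κ / (2 * (1 + κ)) / r) ^ 2 * r ^ 2 +
        κ / r ^ 2 * (z * r - κ / (2 * (1 + κ)) / r * r ^ 2) ^ 2 =
      (g - γ) ⬝ᵥ A *ᵥ (g - γ) + (-(2 * (κ / (2 * (1 + κ))) * z) + (κ / (2 * (1 + κ))) ^ 2 +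
        κ * (z - κ / (2 * (1 + κ))) ^ 2) := by
    field_simp
    ring
  rw [centre_sub, dotProduct_ellipsoidUpdate_mulVec_sub_smul_inv hA, hz, r_sq, normalize,
    inv_mul_le_iff₀ (by positivity), mul_one]
  exact add_le_add hmem (shallow_cut_scalar_bound hκ hκ_le neg_le_z z_le_one)

theorem one_add_sq_div_two_pow_le_exp {m : ℕ} (hκ : 0 ≤ κ) (hm : m * κ ≤ 1 / 2) :
    (1 + κ ^ 2 / 2) ^ m ≤ Real.exp (κ / 4) :=
  calc (1 + κ ^ 2 / 2) ^ m ≤ Real.exp (κ ^ 2 / 2) ^ m := by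
        gcongr
        linarith [Real.add_one_le_exp (κ ^ 2 / 2)]
    _ = Real.exp (m * κ * (κ / 2)) := by
        rw [← Real.exp_nat_mul]
        ring_nf
    _ ≤ Real.exp (1 / 2 * (κ / 2)) := by gcongr
    _ = Real.exp (κ / 4) := by ring_nf

/- The volume of the ellipsoid of `A` is proportional to `A.det ^ (-1 / 2)`, so a cut shrinks it by
a constant factor. -/
theorem exp_mul_det_le_det_ellipsoidUpdate (hA : A.PosDef) (hκ : 0 ≤ κ) (hκ_le : κ ≤ 1)
    (hcard : Fintype.card n * κ ≤ 1 / 2) {w : n → ℝ} (hw : 0 < dualSq A w) :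
    Real.exp (κ / 4) * A.det ≤ (ellipsoidUpdate κ A w).det := by
  have exp_le : Real.exp (κ / 2) ≤ 1 + κ := by
    have := Real.abs_exp_sub_one_le (x := κ / 2) (by rw [abs_of_nonneg] <;> linarith)
    rw [abs_of_nonneg (by positivity : 0 ≤ κ / 2)] at this
    linarith [le_abs_self (Real.exp (κ / 2) - 1)]
  have det_pos := hA.det_pos
  rw [ellipsoidUpdate, det_smul, det_rankOneUpdate hA, div_mul_cancel₀ _ hw.ne', inv_pow,
    ← div_eq_inv_mul, le_div_iff₀ (by positivity)]
  calc Real.exp (κ / 4) * A.det * (1 + κ ^ 2 / 2) ^ Fintype.card n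
      ≤ Real.exp (κ / 4) * A.det * Real.exp (κ / 4) := by
        gcongr
        exact one_add_sq_div_two_pow_le_exp hκ hcard
    _ = A.det * Real.exp (κ / 2) := by
        rw [mul_right_comm, ← Real.exp_add, mul_comm]
        ring_nf
    _ ≤ A.det * (1 + κ) := by gcongr

theorem trace_ellipsoidUpdate_le (hA : A.PosDef) {δ : ℝ} (hκ : 0 ≤ κ) (hδ : 0 < δ)
    {w : n → ℝ} (hw : δ ≤ dualSq A w) :
    (ellipsoidUpdate κ A w).trace ≤ A.trace + κ * (w ⬝ᵥ w) / δ := by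
  have hww : 0 ≤ w ⬝ᵥ w := by simpa using dotProduct_star_self_nonneg w
  have trace_nonneg : 0 ≤ (rankOneUpdate A (κ / dualSq A w) w).trace :=
    (posDef_rankOneUpdate hA (div_nonneg hκ (dualSq_nonneg hA w)) w).posSemidef.trace_nonneg
  calc (ellipsoidUpdate κ A w).trace
      = (1 + κ ^ 2 / 2)⁻¹ * (rankOneUpdate A (κ / dualSq A w) w).trace := by
        rw [ellipsoidUpdate, trace_smul, smul_eq_mul]
    _ ≤ (rankOneUpdate A (κ / dualSq A w) w).trace :=
        mul_le_of_le_one_left trace_nonneg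
          (inv_le_one_of_one_le₀ (le_add_of_nonneg_right (by positivity)))
    _ = A.trace + κ * (w ⬝ᵥ w) / dualSq A w := by rw [trace_rankOneUpdate, div_mul_eq_mul_div]
    _ ≤ A.trace + κ * (w ⬝ᵥ w) / δ := by gcongr

end RankOne

section MatrixMeasurability

open Matrix

variable {m n : Type*}

instance : MeasurableSpace (Matrix m n ℝ) := MeasurableSpace.pi

instance [Countable m] [Countable n] : BorelSpace (Matrix m n ℝ) :=
  inferInstanceAs (BorelSpace (m → n → ℝ))

instance [Countable m] [Countable n] : SecondCountableTopology (Matrix m n ℝ) :=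
  inferInstanceAs (SecondCountableTopology (m → n → ℝ))

variable {Ω : Type*} [MeasurableSpace Ω]

@[fun_prop]
theorem measurable_rankOneUpdate [Countable n] {A : Ω → Matrix n n ℝ} {s : Ω → ℝ}
    {w : Ω → n → ℝ} (hA : Measurable A) (hs : Measurable s) (hw : Measurable w) :
    Measurable fun ω => rankOneUpdate (A ω) (s ω) (w ω) := by
  have measurable_vecMulVec : Measurable fun ω => vecMulVec (w ω) (w ω) :=
    (Continuous.matrix_vecMulVec continuous_id continuous_id).measurable.comp hw
  exact hA.add (hs.smul measurable_vecMulVec)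

variable [Fintype n] [DecidableEq n] {A : Ω → Matrix n n ℝ} {v w : Ω → n → ℝ}

@[fun_prop]
theorem measurable_matrix_det (hA : Measurable A) : Measurable fun ω => (A ω).det :=
  (Continuous.matrix_det continuous_id).measurable.comp hA

instance : MeasurableInv (Matrix n n ℝ) where
  measurable_inv := by
    have measurable_adjugate : Measurable fun A : Matrix n n ℝ => A.adjugate :=
      (Continuous.matrix_adjugate continuous_id).measurable
    have inv_eq : (Inv.inv : Matrix n n ℝ → Matrix n n ℝ) = fun A => A.det⁻¹ • A.adjugate := by
      funext A
      rw [Matrix.inv_def, Ring.inverse_eq_inv']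
    rw [inv_eq]
    exact (measurable_matrix_det measurable_id).inv.smul measurable_adjugate

@[fun_prop]
theorem measurable_dualSq (hA : Measurable A) (hw : Measurable w) :
    Measurable fun ω => dualSq (A ω) (w ω) := by
  unfold dualSq
  fun_prop

@[fun_prop]
theorem measurable_ellipsoidUpdate (κ : ℝ) (hA : Measurable A) (hw : Measurable w) :
    Measurable fun ω => ellipsoidUpdate κ (A ω) (w ω) := by
  unfold ellipsoidUpdate
  fun_prop

@[fun_prop]
theorem measurable_centreUpdate (κ : ℝ) (hA : Measurable A) (hv : Measurable v)
    (hw : Measurable w) : Measurable fun ω => centreUpdate κ (A ω) (v ω) (w ω) := by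
  unfold centreUpdate
  fun_prop

end MatrixMeasurability

/-! ### The learning algorithm -/

/-- The estimates of the principal. Ridge regression for the reward parameter keeps the design
matrix `1 + ∑ x xᵀ` and the response vector `∑ y x`; the cost parameter is confined to the
ellipsoid `{γ | (centre - γ) ⬝ᵥ shape *ᵥ (centre - γ) ≤ 1}`. -/
structure LearnerState (d : ℕ) where
  design : Matrix (Fin d) (Fin d) ℝ
  response : Fin d → ℝ
  shape : Matrix (Fin d) (Fin d) ℝ
  centre : Fin d → ℝ

namespace LearnerState

variable {d : ℕ}

instance : MeasurableSpace (LearnerState d) :=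
  .comap (fun s => (s.design, s.response, s.shape, s.centre)) inferInstance

theorem measurable_fields :
    Measurable fun s : LearnerState d => (s.design, s.response, s.shape, s.centre) :=
  comap_measurable _

@[fun_prop]
theorem measurable_design : Measurable (design (d := d)) := measurable_fields.fst

@[fun_prop]
theorem measurable_response : Measurable (response (d := d)) := measurable_fields.snd.fst

@[fun_prop]
theorem measurable_shape : Measurable (shape (d := d)) := measurable_fields.snd.snd.fst

@[fun_prop]
theorem measurable_centre : Measurable (centre (d := d)) := measurable_fields.snd.snd.snd

theorem measurable_of_fields {Ω : Type*} [MeasurableSpace Ω] {s : Ω → LearnerState d}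
    (h_design : Measurable fun ω => (s ω).design)
    (h_response : Measurable fun ω => (s ω).response)
    (h_shape : Measurable fun ω => (s ω).shape)
    (h_centre : Measurable fun ω => (s ω).centre) : Measurable s :=
  measurable_comap_iff.2 (h_design.prodMk (h_response.prodMk (h_shape.prodMk h_centre)))

/-- The ridge regression estimate of the reward parameter. -/
noncomputable def estimate (s : LearnerState d) : Fin d → ℝ := s.design⁻¹.mulVec s.response

@[fun_prop]
theorem measurable_estimate : Measurable (estimate (d := d)) := by
  unfold estimate
  fun_prop

end LearnerState

/-- The relative depth of the shallow cuts of an ellipsoid in dimension `d`. -/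
noncomputable def cutStep (d : ℕ) : ℝ := 1 / (2 * d)

/-- The parameters of the learning algorithm: a feature map, the radius of the confidence
ellipsoids for the reward parameter, the accuracy up to which costs are to be learned, and a bound
for the features and the parameters. -/
structure Learner (α : Type) [MeasurableSpace α] (d : ℕ) where
  feat : α → Fin d → ℝ
  measurable_feat : Measurable feat
  radius : ℝ
  acc : ℝ
  bound : ℝ

attribute [fun_prop] Learner.measurable_feat

namespace Learner

variable {α : Type} [MeasurableSpace α] {d : ℕ}

/-- The amount by which the payment for the target exceeds the estimated extra cost of the target.
It matches the depth of a shallow cut. -/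
noncomputable def bonus (ℓ : Learner α d) : ℝ := cutStep d * ℓ.acc / 8

/-- The features of `a` and `b` are so close that reward and cost differ by at most half of the
bonus. -/
def Near (ℓ : Learner α d) (a b : α) : Prop :=
  (ℓ.feat a - ℓ.feat b) ⬝ᵥ (ℓ.feat a - ℓ.feat b) ≤ (ℓ.bonus / (2 * ℓ.bound)) ^ 2

/-- `F` is a finite net of `S`. -/
structure IsNet (ℓ : Learner α d) (S : Set α) (F : Finset α) : Prop where
  nonempty : F.Nonempty
  subset : (F : Set α) ⊆ S
  exists_near : ∀ a ∈ S, ∃ b ∈ F, ℓ.Near a b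

open Classical in
/-- A finite net of `S`; the junk value `∅` if there is none. -/
noncomputable def net (ℓ : Learner α d) (S : Set α) : Finset α :=
  if h : ∃ F, ℓ.IsNet S F then h.choose else ∅

theorem isNet_net {ℓ : Learner α d} {S : Set α} (h : ∃ F, ℓ.IsNet S F) : ℓ.IsNet S (ℓ.net S) := by
  rw [net, dif_pos h]
  exact h.choose_spec

variable [Nonempty α]

/-- The action of the net with the smallest estimated cost. -/
noncomputable def cheapest (ℓ : Learner α d) (F : Finset α) (s : LearnerState d) : α :=
  chooseIn F fun b => ∀ b' ∈ F, s.centre ⬝ᵥ ℓ.feat b ≤ s.centre ⬝ᵥ ℓ.feat b'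

/-- The optimistic estimate of the profit from an action: upper confidence bound of the reward
minus lower confidence bound of the cost in excess of the cost of the cheapest action. The
estimated cost of the cheapest action, which is the same for all `b`, is left out. -/
noncomputable def index (ℓ : Learner α d) (F : Finset α) (s : LearnerState d) (b : α) : ℝ :=
  s.estimate ⬝ᵥ ℓ.feat b + ℓ.radius * √(dualSq s.design (ℓ.feat b)) - s.centre ⬝ᵥ ℓ.feat b +
    √(dualSq s.shape (ℓ.feat b - ℓ.feat (ℓ.cheapest F s)))

/-- The action that the principal wants the agent to take. -/
noncomputable def target (ℓ : Learner α d) (F : Finset α) (s : LearnerState d) : α :=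
  chooseIn F fun b => ∀ b' ∈ F, ℓ.index F s b' ≤ ℓ.index F s b

/-- The difference of the features of the target and of the cheapest action. -/
noncomputable def gap (ℓ : Learner α d) (F : Finset α) (s : LearnerState d) : Fin d → ℝ :=
  ℓ.feat (ℓ.target F s) - ℓ.feat (ℓ.cheapest F s)

/-- The payment for the target: its estimated extra cost, which need not exceed `1`, plus the
bonus. -/
noncomputable def price (ℓ : Learner α d) (F : Finset α) (s : LearnerState d) : ℝ :=
  min (s.centre ⬝ᵥ ℓ.gap F s) 1 + ℓ.bonus

open Classical in
/-- The contract that only pays for the target. -/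
noncomputable def offer (ℓ : Learner α d) (F : Finset α) (s : LearnerState d) (a : α) : ℝ≥0 :=
  if a = ℓ.target F s then (ℓ.price F s).toNNReal else 0

/-- An action of the net near `a`. -/
noncomputable def round (ℓ : Learner α d) (F : Finset α) (a : α) : α :=
  chooseIn F fun b => ℓ.Near a b

open Classical in
/-- The normal vector of the half-space that the action `a` of the agent reveals to contain the
cost parameter. -/
noncomputable def cut (ℓ : Learner α d) (F : Finset α) (s : LearnerState d) (a : α) : Fin d → ℝ :=
  if a = ℓ.target F s then ℓ.gap F s
  else ℓ.feat (ℓ.round F a) - ℓ.feat (ℓ.target F s)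

/-- The action `a` of the agent leads to an update of the ellipsoid: either the agent rejected the
target, or the extra cost of the target is still uncertain. -/
def Cuts (ℓ : Learner α d) (F : Finset α) (s : LearnerState d) (a : α) : Prop :=
  a ≠ ℓ.target F s ∨ ℓ.acc ^ 2 ≤ dualSq s.shape (ℓ.gap F s)

open Classical in
/-- The state after the action `a` and the noisy reward `y`. -/
noncomputable def next (ℓ : Learner α d) (F : Finset α) (s : LearnerState d) (a : α) (y : ℝ) :
    LearnerState d where
  design := rankOneUpdate s.design 1 (ℓ.feat a)
  response := s.response + y • ℓ.feat a
  shape := if ℓ.Cuts F s a then ellipsoidUpdate (cutStep d) s.shape (ℓ.cut F s a) else s.shape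
  centre :=
    if ℓ.Cuts F s a then centreUpdate (cutStep d) s.shape s.centre (ℓ.cut F s a) else s.centre

/-- The state before the first round: the ellipsoid is the ball of radius `ℓ.bound`. -/
noncomputable def init (ℓ : Learner α d) : LearnerState d := ⟨1, 0, (ℓ.bound ^ 2)⁻¹ • 1, 0⟩

/-- The state after `t` rounds. -/
noncomputable def state (ℓ : Learner α d) :
    (t : ℕ) → (Fin t → Set α) → (Fin t → α × ℝ) → LearnerState d
  | 0, _, _ => ℓ.init
  | t + 1, S, h =>
    ℓ.next (ℓ.net (S (Fin.last t))) (state ℓ t (Fin.init S) (Fin.init h))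
      (h (Fin.last t)).1 (h (Fin.last t)).2

section Measurability

variable {Ω : Type*} [MeasurableSpace Ω] {s : Ω → LearnerState d} {a : Ω → α}

@[fun_prop]
theorem measurable_cheapest (ℓ : Learner α d) (hs : Measurable s) (F : Finset α) :
    Measurable fun ω => ℓ.cheapest F (s ω) := by
  refine measurable_chooseIn F fun b _ => ?_
  simp only [Set.ofPred_forall]
  exact Finset.measurableSet_biInter _ fun b' _ => measurableSet_le (by fun_prop) (by fun_prop)

@[fun_prop]
theorem measurable_index (ℓ : Learner α d) (hs : Measurable s) (F : Finset α) (b : α) :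
    Measurable fun ω => ℓ.index F (s ω) b := by
  unfold index
  fun_prop

@[fun_prop]
theorem measurable_target (ℓ : Learner α d) (hs : Measurable s) (F : Finset α) :
    Measurable fun ω => ℓ.target F (s ω) := by
  refine measurable_chooseIn F fun b _ => ?_
  simp only [Set.ofPred_forall]
  exact Finset.measurableSet_biInter _ fun b' _ => measurableSet_le (by fun_prop) (by fun_prop)

@[fun_prop]
theorem measurable_gap (ℓ : Learner α d) (hs : Measurable s) (F : Finset α) :
    Measurable fun ω => ℓ.gap F (s ω) := by
  unfold gap
  fun_prop

@[fun_prop]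
theorem measurable_price (ℓ : Learner α d) (hs : Measurable s) (F : Finset α) :
    Measurable fun ω => ℓ.price F (s ω) := by
  unfold price
  fun_prop

@[fun_prop]
theorem measurable_round (ℓ : Learner α d) (ha : Measurable a) (F : Finset α) :
    Measurable fun ω => ℓ.round F (a ω) :=
  measurable_chooseIn F fun b _ => measurableSet_le (by fun_prop) measurable_const

variable [MeasurableEq α]

@[fun_prop]
theorem measurable_offer (ℓ : Learner α d) (hs : Measurable s) (ha : Measurable a)
    (F : Finset α) : Measurable fun ω => ℓ.offer F (s ω) (a ω) :=
  Measurable.ite (measurableSet_eq_fun ha (by fun_prop)) (by fun_prop) measurable_const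

@[fun_prop]
theorem measurable_cut (ℓ : Learner α d) (hs : Measurable s) (ha : Measurable a)
    (F : Finset α) : Measurable fun ω => ℓ.cut F (s ω) (a ω) :=
  Measurable.ite (measurableSet_eq_fun ha (by fun_prop)) (by fun_prop) (by fun_prop)

theorem measurableSet_cuts (ℓ : Learner α d) (hs : Measurable s) (ha : Measurable a)
    (F : Finset α) : MeasurableSet {ω | ℓ.Cuts F (s ω) (a ω)} :=
  (measurableSet_eq_fun ha (ℓ.measurable_target hs F)).compl.union
    (measurableSet_le measurable_const
      (measurable_dualSq (LearnerState.measurable_shape.comp hs) (ℓ.measurable_gap hs F)))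

theorem measurable_next (ℓ : Learner α d) (hs : Measurable s) (ha : Measurable a)
    {y : Ω → ℝ} (hy : Measurable y) (F : Finset α) :
    Measurable fun ω => ℓ.next F (s ω) (a ω) (y ω) := by
  have measurableSet_cut := ℓ.measurableSet_cuts hs ha F
  refine LearnerState.measurable_of_fields ?_ ?_ ?_ ?_
  · unfold next
    fun_prop
  · unfold next
    fun_prop
  · exact Measurable.ite measurableSet_cut (by fun_prop) (by fun_prop)
  · exact Measurable.ite measurableSet_cut (by fun_prop) (by fun_prop)

theorem measurable_state (ℓ : Learner α d) (t : ℕ) (S : Fin t → Set α) :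
    Measurable fun h : Fin t → α × ℝ => ℓ.state t S h := by
  induction t with
  | zero => exact measurable_const
  | succ t ih =>
    have measurable_init : Measurable fun h : Fin (t + 1) → α × ℝ => Fin.init h :=
      measurable_pi_lambda _ fun i => measurable_pi_apply _
    exact ℓ.measurable_next ((ih _).comp measurable_init) (measurable_pi_apply _).fst
      (measurable_pi_apply _).snd _

end Measurability

variable [MeasurableEq α]

/-- The deterministic policy of the learner. -/
noncomputable def policy (ℓ : Learner α d) : Policy α where
  seedLaw := Measure.dirac 0
  isProbabilityMeasure_seedLaw := inferInstance
  contract t S _ h a := ℓ.offer (ℓ.net (S (Fin.last t))) (ℓ.state t (Fin.init S) h) a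
  measurable_contract t _ :=
    ℓ.measurable_offer ((ℓ.measurable_state t _).comp measurable_fst.snd) measurable_snd _

/-- The state after `t` rounds against the agent `ag`. -/
noncomputable def stateAt (ℓ : Learner α d) (E : Environment α) (ag : Agent α) (t : ℕ)
    (ω : ℝ × (ℕ → ℝ)) : LearnerState d :=
  ℓ.state t (fun s => E.actionSet s) (ℓ.policy.history E ag ω t)

variable {ℓ : Learner α d} {E : Environment α} {ag : Agent α}

theorem stateAt_zero (ω : ℝ × (ℕ → ℝ)) : ℓ.stateAt E ag 0 ω = ℓ.init := rfl

theorem stateAt_succ (t : ℕ) (ω : ℝ × (ℕ → ℝ)) :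
    ℓ.stateAt E ag (t + 1) ω = ℓ.next (ℓ.net (E.actionSet t)) (ℓ.stateAt E ag t ω)
      (ℓ.policy.action E ag t ω) (E.reward (ℓ.policy.action E ag t ω) + ω.2 t) := by
  rw [stateAt, state, Policy.history, Fin.snoc_last, Fin.init_snoc]
  rfl

end Learner

section History

variable {α : Type} [MeasurableSpace α] {π : Policy α} {E : Environment α} {ag : Agent α}

theorem Policy.history_succ (t : ℕ) (ω : ℝ × (ℕ → ℝ)) :
    π.history E ag ω (t + 1) = Fin.snoc (α := fun _ => α × ℝ) (π.history E ag ω t)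
      (π.action E ag t ω, E.reward (π.action E ag t ω) + ω.2 t) := rfl

theorem Policy.measurable_history (hE : Measurable E.reward) (t : ℕ)
    (h_action : ∀ s < t, Measurable (π.action E ag s)) :
    Measurable fun ω => π.history E ag ω t := by
  induction t with
  | zero => exact measurable_pi_lambda _ fun i => i.elim0
  | succ t ih =>
    have measurable_past := ih fun s hs => h_action s (hs.trans t.lt_succ_self)
    have measurable_last := h_action t t.lt_succ_self
    refine measurable_pi_lambda _ fun i => Fin.lastCases ?_ (fun i => ?_) i
    · simp only [Policy.history_succ, Fin.snoc_last]
      fun_prop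
    · simp only [Policy.history_succ, Fin.snoc_castSucc]
      exact (measurable_pi_apply i).comp measurable_past

theorem Policy.history_resample {s t : ℕ} (hst : s ≤ t) (ω : ℝ × (ℕ → ℝ)) (z : ℝ) :
    π.history E ag (resample t ω z) s = π.history E ag ω s := by
  induction s with
  | zero => rfl
  | succ s ih =>
    simp only [Policy.history, ih (by omega)]
    simp [resample, Function.update_of_ne (show s ≠ t by omega)]

theorem Policy.action_resample (t : ℕ) (ω : ℝ × (ℕ → ℝ)) (z : ℝ) :
    π.action E ag t (resample t ω z) = π.action E ag t ω := by
  rw [Policy.action, Policy.posted, Policy.history_resample le_rfl]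
  rfl

end History

/-! ### Analysis of a single round -/

section DotProduct

variable {n : Type*} [Fintype n]

theorem dotProduct_sub_self_le_four_mul {u v : n → ℝ} {r : ℝ} (hu : u ⬝ᵥ u ≤ r)
    (hv : v ⬝ᵥ v ≤ r) : (u - v) ⬝ᵥ (u - v) ≤ 4 * r := by
  have add_nonneg := dotProduct_star_self_nonneg (u + v)
  simp only [star_trivial, add_dotProduct, dotProduct_add] at add_nonneg
  simp only [sub_dotProduct, dotProduct_sub]
  linarith

theorem abs_dotProduct_le_mul {u v : n → ℝ} {x y : ℝ} (hx : 0 ≤ x) (hy : 0 ≤ y)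
    (hu : u ⬝ᵥ u ≤ x ^ 2) (hv : v ⬝ᵥ v ≤ y ^ 2) : |u ⬝ᵥ v| ≤ x * y := by
  refine abs_le_of_sq_le_sq ?_ (by positivity)
  calc (u ⬝ᵥ v) ^ 2 ≤ (u ⬝ᵥ u) * (v ⬝ᵥ v) := by
        simpa only [dotProduct, sq] using Finset.sum_mul_sq_le_sq_mul_sq Finset.univ u v
    _ ≤ x ^ 2 * y ^ 2 :=
        mul_le_mul hu hv (by simpa using dotProduct_star_self_nonneg v) (by positivity)
    _ = (x * y) ^ 2 := by ring

end DotProduct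

/-- The cost parameter `γ` belongs to the ellipsoid of the state, and the matrices are
nondegenerate. -/
structure LearnerState.Valid {d : ℕ} (s : LearnerState d) (γ : Fin d → ℝ) : Prop where
  design_posDef : s.design.PosDef
  le_design : ∀ x : Fin d → ℝ, x ⬝ᵥ x ≤ x ⬝ᵥ s.design.mulVec x
  shape_posDef : s.shape.PosDef
  mem_ellipsoid : (s.centre - γ) ⬝ᵥ s.shape.mulVec (s.centre - γ) ≤ 1

theorem LearnerState.Valid.dotProduct_le_sqrt_dualSq {d : ℕ} {s : LearnerState d}
    {γ : Fin d → ℝ} (hs : s.Valid γ) (w : Fin d → ℝ) :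
    w ⬝ᵥ (s.centre - γ) ≤ √(dualSq s.shape w) :=
  Real.le_sqrt_of_sq_le <| (dotProduct_sq_le_dualSq_mul hs.shape_posDef _ _).trans <|
    mul_le_of_le_one_right (dualSq_nonneg hs.shape_posDef w) hs.mem_ellipsoid

namespace Learner

variable {α : Type} [MeasurableSpace α] {d : ℕ}

/-- The environment `E` is linear in the features, with parameters `θ` for the reward and `γ` for
the cost, and the parameters of the learner are admissible for it. -/
structure Fits (ℓ : Learner α d) (E : Environment α) (θ γ : Fin d → ℝ) : Prop where
  one_le_dim : 1 ≤ d
  acc_pos : 0 < ℓ.acc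
  acc_le_one : ℓ.acc ≤ 1
  one_le_bound : 1 ≤ ℓ.bound
  radius_nonneg : 0 ≤ ℓ.radius
  reward_sq_le : θ ⬝ᵥ θ ≤ ℓ.bound ^ 2
  cost_sq_le : γ ⬝ᵥ γ ≤ ℓ.bound ^ 2
  exists_net : ∀ t, ∃ F, ℓ.IsNet (E.actionSet t) F
  feat_sq_le : ∀ t, ∀ a ∈ E.actionSet t, ℓ.feat a ⬝ᵥ ℓ.feat a ≤ ℓ.bound ^ 2
  reward_eq : ∀ a, E.reward a = ℓ.feat a ⬝ᵥ θ
  cost_eq : ∀ a, E.cost a = ℓ.feat a ⬝ᵥ γ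
  reward_mem : ∀ t, ∀ a ∈ E.actionSet t, E.reward a ∈ Set.Icc (0 : ℝ) 1
  cost_mem : ∀ t, ∀ a ∈ E.actionSet t, E.cost a ∈ Set.Icc (0 : ℝ) 1

/-- The estimate of the reward of every action is within its confidence interval. -/
def Confident (ℓ : Learner α d) (s : LearnerState d) (θ : Fin d → ℝ) : Prop :=
  ∀ b, |ℓ.feat b ⬝ᵥ (s.estimate - θ)| ≤ ℓ.radius * √(dualSq s.design (ℓ.feat b))

variable {ℓ : Learner α d} {E : Environment α} {θ γ : Fin d → ℝ}

theorem Fits.cutStep_pos (h : ℓ.Fits E θ γ) : 0 < cutStep d := by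
  have := h.one_le_dim
  rw [cutStep]
  positivity

theorem Fits.cutStep_le_one (h : ℓ.Fits E θ γ) : cutStep d ≤ 1 := by
  have one_le_cast_dim : (1 : ℝ) ≤ d := by exact_mod_cast h.one_le_dim
  rw [cutStep, div_le_one (by positivity)]
  linarith

theorem Fits.bonus_pos (h : ℓ.Fits E θ γ) : 0 < ℓ.bonus := by
  have := h.cutStep_pos
  have := h.acc_pos
  rw [bonus]
  positivity

theorem Fits.bonus_le (h : ℓ.Fits E θ γ) : ℓ.bonus ≤ ℓ.acc / 8 := by
  rw [bonus]
  linarith [mul_le_of_le_one_left h.acc_pos.le h.cutStep_le_one]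

theorem Fits.isNet (h : ℓ.Fits E θ γ) (t : ℕ) :
    ℓ.IsNet (E.actionSet t) (ℓ.net (E.actionSet t)) := isNet_net (h.exists_net t)

theorem Fits.abs_dotProduct_sub_le (h : ℓ.Fits E θ γ) {a b : α} (hab : ℓ.Near a b)
    {v : Fin d → ℝ} (hv : v ⬝ᵥ v ≤ ℓ.bound ^ 2) :
    |ℓ.feat a ⬝ᵥ v - ℓ.feat b ⬝ᵥ v| ≤ ℓ.bonus / 2 := by
  have bound_pos : 0 < ℓ.bound := zero_lt_one.trans_le h.one_le_bound
  have bonus_pos := h.bonus_pos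
  rw [← sub_dotProduct]
  refine (abs_dotProduct_le_mul (by positivity) bound_pos.le hab hv).trans_eq ?_
  field_simp

theorem Fits.valid_init (h : ℓ.Fits E θ γ) : ℓ.init.Valid γ where
  design_posDef := Matrix.PosDef.one
  le_design x := by simp [init]
  shape_posDef := by
    have := h.one_le_bound
    exact Matrix.PosDef.one.smul (by positivity)
  mem_ellipsoid := by
    have := h.one_le_bound
    simp only [init, zero_sub, Matrix.smul_mulVec, Matrix.one_mulVec, dotProduct_smul,
      neg_dotProduct, dotProduct_neg, neg_neg, smul_eq_mul]
    rw [inv_mul_le_iff₀ (by positivity), mul_one]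
    exact h.cost_sq_le

variable [Nonempty α] {F : Finset α} {s : LearnerState d} {t : ℕ} {a : α}

theorem cheapest_spec (ℓ : Learner α d) (hF : F.Nonempty) (s : LearnerState d) :
    ℓ.cheapest F s ∈ F ∧ ∀ b ∈ F, s.centre ⬝ᵥ ℓ.feat (ℓ.cheapest F s) ≤ s.centre ⬝ᵥ ℓ.feat b :=
  chooseIn_spec (F.exists_min_image (fun b => s.centre ⬝ᵥ ℓ.feat b) hF)

theorem target_spec (ℓ : Learner α d) (hF : F.Nonempty) (s : LearnerState d) :
    ℓ.target F s ∈ F ∧ ∀ b ∈ F, ℓ.index F s b ≤ ℓ.index F s (ℓ.target F s) :=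
  chooseIn_spec (F.exists_max_image (ℓ.index F s) hF)

theorem round_spec {S : Set α} (hF : ℓ.IsNet S F) (ha : a ∈ S) :
    ℓ.round F a ∈ F ∧ ℓ.Near a (ℓ.round F a) :=
  chooseIn_spec (hF.exists_near a ha)

theorem dotProduct_gap_nonneg (ℓ : Learner α d) (hF : F.Nonempty) (s : LearnerState d) :
    0 ≤ s.centre ⬝ᵥ ℓ.gap F s := by
  rw [gap, dotProduct_sub, sub_nonneg]
  exact (ℓ.cheapest_spec hF s).2 _ (ℓ.target_spec hF s).1

theorem bonus_le_price (ℓ : Learner α d) (hF : F.Nonempty) (s : LearnerState d) :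
    ℓ.bonus ≤ ℓ.price F s :=
  le_add_of_nonneg_left (le_min (ℓ.dotProduct_gap_nonneg hF s) zero_le_one)

theorem price_le_dotProduct_gap_add (ℓ : Learner α d) (F : Finset α) (s : LearnerState d) :
    ℓ.price F s ≤ s.centre ⬝ᵥ ℓ.gap F s + ℓ.bonus :=
  add_le_add_left (min_le_left _ _) _

theorem price_le_one_add (ℓ : Learner α d) (F : Finset α) (s : LearnerState d) :
    ℓ.price F s ≤ 1 + ℓ.bonus :=
  add_le_add_left (min_le_right _ _) _

theorem Fits.offer_target (h : ℓ.Fits E θ γ) (hF : F.Nonempty) (s : LearnerState d) :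
    (ℓ.offer F s (ℓ.target F s) : ℝ) = ℓ.price F s := by
  rw [offer, if_pos rfl, Real.coe_toNNReal _ (h.bonus_pos.le.trans (ℓ.bonus_le_price hF s))]

theorem offer_of_ne (h : a ≠ ℓ.target F s) : ℓ.offer F s a = 0 := by
  rw [offer, if_neg h]

theorem Fits.offer_le_two (h : ℓ.Fits E θ γ) (hF : F.Nonempty) (s : LearnerState d) (a : α) :
    (ℓ.offer F s a : ℝ) ≤ 2 := by
  by_cases hat : a = ℓ.target F s
  · rw [hat, h.offer_target hF]
    linarith [ℓ.price_le_one_add F s, h.bonus_le, h.acc_le_one]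
  · rw [offer_of_ne hat]
    norm_num

/- An agent who takes the target weakly prefers it to the cheapest action of the net, for which he
would not be paid: the payment covers the true extra cost. -/
theorem Fits.neg_bonus_le_gap_dotProduct (h : ℓ.Fits E θ γ) (hF : ℓ.IsNet (E.actionSet t) F)
    (ha : a ∈ bestResponses (E.actionSet t) E.cost (ℓ.offer F s)) (hat : a = ℓ.target F s) :
    -ℓ.bonus ≤ ℓ.gap F s ⬝ᵥ (s.centre - γ) := by
  by_cases cheapest_eq : ℓ.cheapest F s = ℓ.target F s
  · rw [gap, cheapest_eq, sub_self, zero_dotProduct]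
    linarith [h.bonus_pos]
  · have weakly_prefers := ha.2 _ (hF.subset (ℓ.cheapest_spec hF.nonempty s).1)
    rw [hat, h.offer_target hF.nonempty, offer_of_ne cheapest_eq, h.cost_eq, h.cost_eq,
      NNReal.coe_zero] at weakly_prefers
    have extra_cost : ℓ.gap F s ⬝ᵥ γ =
        ℓ.feat (ℓ.target F s) ⬝ᵥ γ - ℓ.feat (ℓ.cheapest F s) ⬝ᵥ γ := by
      rw [gap, sub_dotProduct]
    rw [dotProduct_sub, dotProduct_comm _ s.centre]
    linarith [ℓ.price_le_dotProduct_gap_add F s]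

/- An agent who rejects the target would not do so for a payment of `1 + ℓ.bonus`, so the payment is
the estimated extra cost plus the bonus, and it falls short of the true extra cost over `a`. -/
theorem Fits.half_bonus_le_cut_dotProduct (h : ℓ.Fits E θ γ) (hF : ℓ.IsNet (E.actionSet t) F)
    (ha : a ∈ bestResponses (E.actionSet t) E.cost (ℓ.offer F s)) (hat : a ≠ ℓ.target F s) :
    ℓ.bonus / 2 ≤ ℓ.cut F s a ⬝ᵥ (s.centre - γ) := by
  have target_mem := hF.subset (ℓ.target_spec hF.nonempty s).1
  have weakly_prefers := ha.2 _ target_mem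
  rw [h.offer_target hF.nonempty, offer_of_ne hat, NNReal.coe_zero, price] at weakly_prefers
  rcases le_total (s.centre ⬝ᵥ ℓ.gap F s) 1 with gap_le | one_le_gap
  · obtain ⟨round_mem, near_round⟩ := round_spec hF ha.1
    have cost_round := (abs_le.1 (h.abs_dotProduct_sub_le near_round h.cost_sq_le)).1
    have cheapest_le := (ℓ.cheapest_spec hF.nonempty s).2 _ round_mem
    rw [min_eq_left gap_le, h.cost_eq, h.cost_eq, gap, dotProduct_sub] at weakly_prefers
    rw [cut, if_neg hat, dotProduct_sub, sub_dotProduct, sub_dotProduct,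
      dotProduct_comm _ s.centre, dotProduct_comm _ s.centre]
    linarith
  · rw [min_eq_right one_le_gap] at weakly_prefers
    linarith [(h.cost_mem t _ target_mem).2, (h.cost_mem t _ ha.1).1, h.bonus_pos]

theorem Fits.sq_half_bonus_le_dualSq_cut (h : ℓ.Fits E θ γ) (hs : s.Valid γ)
    (hF : ℓ.IsNet (E.actionSet t) F)
    (ha : a ∈ bestResponses (E.actionSet t) E.cost (ℓ.offer F s)) (hcut : ℓ.Cuts F s a) :
    (ℓ.bonus / 2) ^ 2 ≤ dualSq s.shape (ℓ.cut F s a) := by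
  have bonus_pos := h.bonus_pos
  by_cases hat : a = ℓ.target F s
  · rw [cut, if_pos hat]
    refine le_trans ?_ (hcut.resolve_left (not_not.2 hat))
    gcongr
    linarith [h.bonus_le, h.acc_pos]
  · exact (Real.le_sqrt' (half_pos bonus_pos)).1
      ((h.half_bonus_le_cut_dotProduct hF ha hat).trans (hs.dotProduct_le_sqrt_dualSq _))

theorem Fits.neg_mul_sqrt_dualSq_le_cut_dotProduct (h : ℓ.Fits E θ γ)
    (hF : ℓ.IsNet (E.actionSet t) F)
    (ha : a ∈ bestResponses (E.actionSet t) E.cost (ℓ.offer F s)) (hcut : ℓ.Cuts F s a) :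
    -(cutStep d / 8) * √(dualSq s.shape (ℓ.cut F s a)) ≤ ℓ.cut F s a ⬝ᵥ (s.centre - γ) := by
  have step_pos := h.cutStep_pos
  by_cases hat : a = ℓ.target F s
  · have acc_le : ℓ.acc ≤ √(dualSq s.shape (ℓ.gap F s)) :=
      Real.le_sqrt_of_sq_le (hcut.resolve_left (not_not.2 hat))
    rw [cut, if_pos hat]
    calc -(cutStep d / 8) * √(dualSq s.shape (ℓ.gap F s))
        ≤ -(cutStep d / 8) * ℓ.acc := mul_le_mul_of_nonpos_left acc_le (by linarith)
      _ = -ℓ.bonus := by rw [bonus]; ring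
      _ ≤ _ := h.neg_bonus_le_gap_dotProduct hF ha hat
  · calc -(cutStep d / 8) * √(dualSq s.shape (ℓ.cut F s a))
        ≤ 0 := mul_nonpos_of_nonpos_of_nonneg (by linarith) (Real.sqrt_nonneg _)
      _ ≤ ℓ.bonus / 2 := (half_pos h.bonus_pos).le
      _ ≤ _ := h.half_bonus_le_cut_dotProduct hF ha hat

theorem Fits.valid_next (h : ℓ.Fits E θ γ) (hs : s.Valid γ) (hF : ℓ.IsNet (E.actionSet t) F)
    (ha : a ∈ bestResponses (E.actionSet t) E.cost (ℓ.offer F s)) (y : ℝ) :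
    (ℓ.next F s a y).Valid γ where
  design_posDef := posDef_rankOneUpdate hs.design_posDef zero_le_one _
  le_design := dotProduct_le_dotProduct_rankOneUpdate_mulVec zero_le_one hs.le_design _
  shape_posDef := by
    simp only [next]
    split_ifs
    · exact posDef_ellipsoidUpdate hs.shape_posDef h.cutStep_pos.le _
    · exact hs.shape_posDef
  mem_ellipsoid := by
    simp only [next]
    split_ifs with hcut
    · exact mem_ellipsoidUpdate hs.shape_posDef h.cutStep_pos h.cutStep_le_one hs.mem_ellipsoid
        ((sq_pos_of_pos (half_pos h.bonus_pos)).trans_le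
          (h.sq_half_bonus_le_dualSq_cut hs hF ha hcut))
        (h.neg_mul_sqrt_dualSq_le_cut_dotProduct hF ha hcut)
    · exact hs.mem_ellipsoid

theorem Fits.cut_dotProduct_self_le (h : ℓ.Fits E θ γ) (hF : ℓ.IsNet (E.actionSet t) F)
    (ha : a ∈ E.actionSet t) : ℓ.cut F s a ⬝ᵥ ℓ.cut F s a ≤ 4 * ℓ.bound ^ 2 := by
  have feat_sq_le {b : α} (hb : b ∈ F) := h.feat_sq_le t b (hF.subset hb)
  have target_sq_le := feat_sq_le (ℓ.target_spec hF.nonempty s).1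
  rw [cut]
  split_ifs
  · exact dotProduct_sub_self_le_four_mul target_sq_le
      (feat_sq_le (ℓ.cheapest_spec hF.nonempty s).1)
  · exact dotProduct_sub_self_le_four_mul (feat_sq_le (round_spec hF ha).1) target_sq_le

/- The common offset of all indices is the estimated cost of the cheapest action, which the index
leaves out, minus its true cost. -/
theorem Fits.profit_le_index (h : ℓ.Fits E θ γ) (hs : s.Valid γ) (hconf : ℓ.Confident s θ)
    (b : α) :
    E.reward b - E.cost b ≤ ℓ.index F s b +
      (s.centre ⬝ᵥ ℓ.feat (ℓ.cheapest F s) - E.cost (ℓ.cheapest F s)) := by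
  have reward_le := (abs_le.1 (hconf b)).1
  have cost_ge := hs.dotProduct_le_sqrt_dualSq (ℓ.feat b - ℓ.feat (ℓ.cheapest F s))
  rw [dotProduct_sub, dotProduct_comm _ s.estimate] at reward_le
  rw [dotProduct_sub, sub_dotProduct, sub_dotProduct, dotProduct_comm _ s.centre,
    dotProduct_comm _ s.centre] at cost_ge
  rw [index, h.reward_eq, h.cost_eq, h.cost_eq]
  linarith

theorem Fits.index_target_le (h : ℓ.Fits E θ γ) (hF : F.Nonempty) (hconf : ℓ.Confident s θ)
    (hgap : dualSq s.shape (ℓ.gap F s) < ℓ.acc ^ 2) :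
    ℓ.index F s (ℓ.target F s) + s.centre ⬝ᵥ ℓ.feat (ℓ.cheapest F s) ≤
      E.reward (ℓ.target F s) - ℓ.offer F s (ℓ.target F s) +
        2 * ℓ.radius * √(dualSq s.design (ℓ.feat (ℓ.target F s))) + ℓ.acc + ℓ.bonus := by
  have reward_ge := (abs_le.1 (hconf (ℓ.target F s))).2
  have sqrt_gap_le : √(dualSq s.shape (ℓ.feat (ℓ.target F s) - ℓ.feat (ℓ.cheapest F s))) ≤ ℓ.acc :=
    (Real.sqrt_le_left h.acc_pos.le).2 hgap.le
  have price_le := ℓ.price_le_dotProduct_gap_add F s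
  rw [dotProduct_sub, dotProduct_comm _ s.estimate] at reward_ge
  rw [gap, dotProduct_sub] at price_le
  rw [index, h.offer_target hF, h.reward_eq]
  linarith

theorem Fits.profit_sub_profit_le (h : ℓ.Fits E θ γ) (hs : s.Valid γ)
    (hF : ℓ.IsNet (E.actionSet t) F) (hcut : ¬ ℓ.Cuts F s a) (hconf : ℓ.Confident s θ) {b : α}
    (hb : b ∈ E.actionSet t) :
    E.reward b - E.cost b - (E.reward a - (ℓ.offer F s a : ℝ)) ≤
      2 * ℓ.radius * √(dualSq s.design (ℓ.feat a)) + 2 * ℓ.acc := by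
  obtain ⟨rfl, gap_lt⟩ : a = ℓ.target F s ∧ dualSq s.shape (ℓ.gap F s) < ℓ.acc ^ 2 := by
    simpa [Cuts] using hcut
  obtain ⟨c, hc, near_c⟩ := hF.exists_near b hb
  have reward_le := (abs_le.1 (h.abs_dotProduct_sub_le near_c h.reward_sq_le)).2
  have cost_ge := (abs_le.1 (h.abs_dotProduct_sub_le near_c h.cost_sq_le)).1
  rw [← h.reward_eq, ← h.reward_eq] at reward_le
  rw [← h.cost_eq, ← h.cost_eq] at cost_ge
  have cost_cheapest_nonneg :=
    (h.cost_mem t _ (hF.subset (ℓ.cheapest_spec hF.nonempty s).1)).1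
  linarith [h.profit_le_index (F := F) hs hconf c, (ℓ.target_spec hF.nonempty s).2 c hc,
    h.index_target_le hF.nonempty hconf gap_lt, h.bonus_le, h.acc_pos]

end Learner

/-! ### The regret on a path -/

theorem le_one_add_mul_log_one_add {x c : ℝ} (hx : 0 ≤ x) (hxc : x ≤ c) :
    x ≤ (1 + c) * Real.log (1 + x) :=
  have one_add_pos : 0 < 1 + x := by positivity
  calc x = (1 + x) * (1 - (1 + x)⁻¹) := by field_simp; ring
    _ ≤ (1 + x) * Real.log (1 + x) := by
        gcongr
        exact Real.one_sub_inv_le_log_of_pos one_add_pos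
    _ ≤ (1 + c) * Real.log (1 + x) := by
        gcongr
        exact Real.log_nonneg (by linarith)

namespace Learner

variable {α : Type} [MeasurableSpace α] {d : ℕ}

/-- A bound for the logarithm of the determinant of the design matrix after at most `T` rounds. -/
noncomputable def logDesignBound (ℓ : Learner α d) (T : ℕ) : ℝ :=
  d * Real.log (d + T * ℓ.bound ^ 2)

/-- A bound for the number of cuts in the first `T` rounds. -/
noncomputable def cutBound (ℓ : Learner α d) (T : ℕ) : ℝ :=
  8 * d ^ 2 * Real.log (ℓ.bound ^ 2 * (d + T * (4 * ℓ.bound ^ 2 / (ℓ.bonus / 2) ^ 2)))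

variable [Nonempty α] {ℓ : Learner α d} {E : Environment α} {θ γ : Fin d → ℝ}

section SingleRound

variable {F : Finset α} {s : LearnerState d} {t : ℕ} {a : α}

theorem shape_next_of_not_cuts (hcut : ¬ℓ.Cuts F s a) (y : ℝ) :
    (ℓ.next F s a y).shape = s.shape := if_neg hcut

theorem shape_next_of_cuts (hcut : ℓ.Cuts F s a) (y : ℝ) :
    (ℓ.next F s a y).shape = ellipsoidUpdate (cutStep d) s.shape (ℓ.cut F s a) := if_pos hcut

theorem Fits.exp_mul_det_shape_le (h : ℓ.Fits E θ γ) (hs : s.Valid γ)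
    (hF : ℓ.IsNet (E.actionSet t) F)
    (ha : a ∈ bestResponses (E.actionSet t) E.cost (ℓ.offer F s)) (hcut : ℓ.Cuts F s a) (y : ℝ) :
    Real.exp (cutStep d / 4) * s.shape.det ≤ (ℓ.next F s a y).shape.det := by
  have dim_mul_step : (d : ℝ) * cutStep d ≤ 1 / 2 := by
    have := h.one_le_dim
    rw [cutStep]
    field_simp
    rfl
  have dualSq_pos := (sq_pos_of_pos (half_pos h.bonus_pos)).trans_le
    (h.sq_half_bonus_le_dualSq_cut hs hF ha hcut)
  rw [shape_next_of_cuts hcut]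
  exact exp_mul_det_le_det_ellipsoidUpdate hs.shape_posDef h.cutStep_pos.le h.cutStep_le_one
    (by rwa [Fintype.card_fin]) dualSq_pos

theorem Fits.trace_shape_next_le (h : ℓ.Fits E θ γ) (hs : s.Valid γ)
    (hF : ℓ.IsNet (E.actionSet t) F)
    (ha : a ∈ bestResponses (E.actionSet t) E.cost (ℓ.offer F s)) (hcut : ℓ.Cuts F s a) (y : ℝ) :
    (ℓ.next F s a y).shape.trace ≤ s.shape.trace + 4 * ℓ.bound ^ 2 / (ℓ.bonus / 2) ^ 2 := by
  have sq_pos := sq_pos_of_pos (half_pos h.bonus_pos)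
  have step_mul_le : cutStep d * (ℓ.cut F s a ⬝ᵥ ℓ.cut F s a) ≤ 1 * (4 * ℓ.bound ^ 2) :=
    mul_le_mul h.cutStep_le_one (h.cut_dotProduct_self_le hF ha.1)
      (by simpa using dotProduct_star_self_nonneg (ℓ.cut F s a)) zero_le_one
  rw [shape_next_of_cuts hcut, ← one_mul (4 * ℓ.bound ^ 2)]
  refine (trace_ellipsoidUpdate_le hs.shape_posDef h.cutStep_pos.le sq_pos
    (h.sq_half_bonus_le_dualSq_cut hs hF ha hcut)).trans ?_
  exact (add_le_add_iff_left _).2 (div_le_div_of_nonneg_right step_mul_le sq_pos.le)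

end SingleRound

variable [MeasurableEq α] {ag : Agent α} {ω : ℝ × (ℕ → ℝ)}

/-- The action of round `t` yields a cut. -/
def CutsAt (ℓ : Learner α d) (E : Environment α) (ag : Agent α) (ω : ℝ × (ℕ → ℝ)) (t : ℕ) :
    Prop :=
  ℓ.Cuts (ℓ.net (E.actionSet t)) (ℓ.stateAt E ag t ω) (ℓ.policy.action E ag t ω)

open Classical in
/-- The number of cuts before round `t`. -/
noncomputable def cutCount (ℓ : Learner α d) (E : Environment α) (ag : Agent α) (t : ℕ)
    (ω : ℝ × (ℕ → ℝ)) : ℕ :=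
  Nat.count (ℓ.CutsAt E ag ω) t

/-- The squared width of the confidence interval for the reward of the action of round `t`. -/
noncomputable def width (ℓ : Learner α d) (E : Environment α) (ag : Agent α) (t : ℕ)
    (ω : ℝ × (ℕ → ℝ)) : ℝ :=
  dualSq (ℓ.stateAt E ag t ω).design (ℓ.feat (ℓ.policy.action E ag t ω))

/-- The event that the estimates of round `t` are not accurate. -/
def badEvent (ℓ : Learner α d) (E : Environment α) (ag : Agent α) (θ : Fin d → ℝ) (t : ℕ) :
    Set (ℝ × (ℕ → ℝ)) :=
  {ω | ¬ℓ.Confident (ℓ.stateAt E ag t ω) θ}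

/-- The regret of round `t`. -/
noncomputable def roundRegret (ℓ : Learner α d) (E : Environment α) (ag : Agent α) (t : ℕ)
    (ω : ℝ × (ℕ → ℝ)) : ℝ :=
  (⨆ a : E.actionSet t, (E.reward a - E.cost a)) -
    (E.reward (ℓ.policy.action E ag t ω) -
      (ℓ.policy.posted E ag t ω (ℓ.policy.action E ag t ω) : ℝ))

theorem Fits.valid_stateAt (hf : ℓ.Fits E θ γ) (h : ℓ.policy.IsBestResponding E ag) (t : ℕ)
    (ω : ℝ × (ℕ → ℝ)) : (ℓ.stateAt E ag t ω).Valid γ := by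
  induction t with
  | zero => exact hf.valid_init
  | succ t ih =>
    rw [stateAt_succ]
    exact hf.valid_next ih (hf.isNet t) (h.mem_bestResponses t ω) _

theorem Fits.exp_mul_le_det_shape (hf : ℓ.Fits E θ γ) (h : ℓ.policy.IsBestResponding E ag) (t : ℕ)
    (ω : ℝ × (ℕ → ℝ)) :
    Real.exp (ℓ.cutCount E ag t ω * (cutStep d / 4)) * (ℓ.bound ^ 2)⁻¹ ^ d ≤
      (ℓ.stateAt E ag t ω).shape.det := by
  induction t with
  | zero => simp [cutCount, stateAt_zero, init]
  | succ t ih =>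
    rw [cutCount, Nat.count_succ, ← cutCount, stateAt_succ]
    split_ifs with hcut
    · refine le_trans ?_ (hf.exp_mul_det_shape_le (hf.valid_stateAt h t ω) (hf.isNet t)
        (h.mem_bestResponses t ω) hcut _)
      rw [Nat.cast_succ, add_mul, one_mul, add_comm, Real.exp_add, mul_assoc]
      gcongr
    · rwa [shape_next_of_not_cuts hcut, add_zero]

theorem Fits.trace_shape_le (hf : ℓ.Fits E θ γ) (h : ℓ.policy.IsBestResponding E ag) (t : ℕ)
    (ω : ℝ × (ℕ → ℝ)) :
    (ℓ.stateAt E ag t ω).shape.trace ≤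
      d + ℓ.cutCount E ag t ω * (4 * ℓ.bound ^ 2 / (ℓ.bonus / 2) ^ 2) := by
  induction t with
  | zero =>
    have inv_le_one : (ℓ.bound ^ 2)⁻¹ ≤ 1 :=
      inv_le_one_of_one_le₀ (one_le_pow₀ hf.one_le_bound)
    simpa [stateAt_zero, init, cutCount] using
      mul_le_of_le_one_left (Nat.cast_nonneg (α := ℝ) d) inv_le_one
  | succ t ih =>
    rw [cutCount, Nat.count_succ, ← cutCount, stateAt_succ]
    split_ifs with hcut
    · rw [Nat.cast_succ]
      linarith [hf.trace_shape_next_le (hf.valid_stateAt h t ω) (hf.isNet t)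
        (h.mem_bestResponses t ω) hcut
        (E.reward (ℓ.policy.action E ag t ω) + ω.2 t)]
    · rwa [shape_next_of_not_cuts hcut, add_zero]

/- Every cut multiplies the determinant of the shape by a constant factor, while the trace grows
only linearly in the number of cuts. -/
theorem Fits.cutCount_le_cutBound (hf : ℓ.Fits E θ γ) (h : ℓ.policy.IsBestResponding E ag) (T : ℕ)
    (ω : ℝ × (ℕ → ℝ)) : ℓ.cutCount E ag T ω ≤ ℓ.cutBound T := by
  have dim_pos : (0 : ℝ) < d := by exact_mod_cast hf.one_le_dim
  have one_le_bound := hf.one_le_bound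
  have bonus_pos := hf.bonus_pos
  have posDef := (hf.valid_stateAt h T ω).shape_posDef
  set M := d + T * (4 * ℓ.bound ^ 2 / (ℓ.bonus / 2) ^ 2) with M_def
  have trace_le : (ℓ.stateAt E ag T ω).shape.trace ≤ M := by
    refine (hf.trace_shape_le h T ω).trans ?_
    rw [M_def]
    gcongr
    classical exact Nat.count_le _
  have det_le : (ℓ.stateAt E ag T ω).shape.det ≤ M ^ d :=
    (det_le_trace_pow_card posDef.posSemidef).trans <| by
      rw [Fintype.card_fin]
      exact pow_le_pow_left₀ posDef.posSemidef.trace_nonneg trace_le d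
  have exp_le : Real.exp (ℓ.cutCount E ag T ω * (cutStep d / 4)) ≤ (ℓ.bound ^ 2 * M) ^ d := by
    have := (hf.exp_mul_le_det_shape h T ω).trans det_le
    rwa [inv_pow, ← div_eq_mul_inv, div_le_iff₀ (by positivity), ← mul_pow,
      mul_comm M] at this
  have count_le := Real.log_le_log (Real.exp_pos _) exp_le
  rw [Real.log_exp, Real.log_pow, cutStep] at count_le
  rw [cutBound, ← M_def]
  calc (ℓ.cutCount E ag T ω : ℝ)
      = 8 * d * (ℓ.cutCount E ag T ω * (1 / (2 * d) / 4)) := by field_simp; ring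
    _ ≤ 8 * d * (d * Real.log (ℓ.bound ^ 2 * M)) := by gcongr
    _ = 8 * d ^ 2 * Real.log (ℓ.bound ^ 2 * M) := by ring

theorem Fits.trace_design_le (hf : ℓ.Fits E θ γ) (h : ℓ.policy.IsBestResponding E ag)
    (t : ℕ) (ω : ℝ × (ℕ → ℝ)) :
    (ℓ.stateAt E ag t ω).design.trace ≤ d + t * ℓ.bound ^ 2 := by
  induction t with
  | zero => simp [stateAt_zero, init]
  | succ t ih =>
    rw [stateAt_succ, next, trace_rankOneUpdate, Nat.cast_succ]
    linarith [hf.feat_sq_le t _ (h.mem_bestResponses t ω).1]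

theorem Fits.log_det_design_le (hf : ℓ.Fits E θ γ) (h : ℓ.policy.IsBestResponding E ag)
    {t T : ℕ} (ht : t ≤ T) (ω : ℝ × (ℕ → ℝ)) :
    Real.log (ℓ.stateAt E ag t ω).design.det ≤ ℓ.logDesignBound T := by
  have posDef := (hf.valid_stateAt h t ω).design_posDef
  rw [logDesignBound, ← Real.log_pow]
  refine Real.log_le_log posDef.det_pos ((det_le_trace_pow_card posDef.posSemidef).trans ?_)
  rw [Fintype.card_fin]
  refine pow_le_pow_left₀ posDef.posSemidef.trace_nonneg ((hf.trace_design_le h t ω).trans ?_) d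
  gcongr

theorem Fits.width_nonneg (hf : ℓ.Fits E θ γ) (h : ℓ.policy.IsBestResponding E ag)
    (t : ℕ) (ω : ℝ × (ℕ → ℝ)) : 0 ≤ ℓ.width E ag t ω :=
  dualSq_nonneg (hf.valid_stateAt h t ω).design_posDef _

theorem Fits.width_le (hf : ℓ.Fits E θ γ) (h : ℓ.policy.IsBestResponding E ag)
    (t : ℕ) (ω : ℝ × (ℕ → ℝ)) : ℓ.width E ag t ω ≤ ℓ.bound ^ 2 :=
  have valid := hf.valid_stateAt h t ω
  (dualSq_le_dotProduct valid.design_posDef valid.le_design _).trans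
    (hf.feat_sq_le t _ (h.mem_bestResponses t ω).1)

theorem Fits.det_design_succ (hf : ℓ.Fits E θ γ) (h : ℓ.policy.IsBestResponding E ag)
    (t : ℕ) (ω : ℝ × (ℕ → ℝ)) :
    (ℓ.stateAt E ag (t + 1) ω).design.det =
      (ℓ.stateAt E ag t ω).design.det * (1 + ℓ.width E ag t ω) := by
  rw [stateAt_succ, next, det_rankOneUpdate (hf.valid_stateAt h t ω).design_posDef, one_mul, width]

/- The elliptical potential argument: `log (1 + width)` telescopes. -/
theorem Fits.sum_width_le_log_det (hf : ℓ.Fits E θ γ)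
    (h : ℓ.policy.IsBestResponding E ag) (t : ℕ) (ω : ℝ × (ℕ → ℝ)) :
    ∑ s ∈ Finset.range t, ℓ.width E ag s ω ≤
      (1 + ℓ.bound ^ 2) * Real.log (ℓ.stateAt E ag t ω).design.det := by
  induction t with
  | zero => simp [stateAt_zero, init]
  | succ t ih =>
    have width_nonneg := hf.width_nonneg h t ω
    have det_pos := (hf.valid_stateAt h t ω).design_posDef.det_pos
    rw [hf.det_design_succ h, Real.log_mul det_pos.ne' (by positivity), Finset.sum_range_succ,
      mul_add]
    exact add_le_add ih (le_one_add_mul_log_one_add width_nonneg (hf.width_le h t ω))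

theorem Fits.sum_sqrt_width_le (hf : ℓ.Fits E θ γ) (h : ℓ.policy.IsBestResponding E ag) (T : ℕ)
    (ω : ℝ × (ℕ → ℝ)) :
    ∑ t ∈ Finset.range T, √(ℓ.width E ag t ω) ≤
      √T * √((1 + ℓ.bound ^ 2) * ℓ.logDesignBound T) := by
  have sum_width_le : ∑ s ∈ Finset.range T, ℓ.width E ag s ω ≤
      (1 + ℓ.bound ^ 2) * ℓ.logDesignBound T := by
    refine (hf.sum_width_le_log_det h T ω).trans ?_
    gcongr
    exact hf.log_det_design_le h le_rfl ω
  rw [← Real.sqrt_mul (Nat.cast_nonneg T)]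
  refine Real.le_sqrt_of_sq_le (sq_sum_le_card_mul_sum_sq.trans ?_)
  simp_rw [Real.sq_sqrt (hf.width_nonneg h _ ω), Finset.card_range]
  gcongr

theorem Fits.abs_roundRegret_le (hf : ℓ.Fits E θ γ) (h : ℓ.policy.IsBestResponding E ag) (t : ℕ)
    (ω : ℝ × (ℕ → ℝ)) : |ℓ.roundRegret E ag t ω| ≤ 3 := by
  have action_mem := (h.mem_bestResponses t ω).1
  have : Nonempty (E.actionSet t) := ⟨⟨_, action_mem⟩⟩
  have profit_le (a : E.actionSet t) : E.reward a - E.cost a ≤ 1 := by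
    linarith [(hf.reward_mem t a a.2).2, (hf.cost_mem t a a.2).1]
  have benchmark_le : (⨆ a : E.actionSet t, (E.reward a - E.cost a)) ≤ 1 := ciSup_le profit_le
  have le_benchmark : _ ≤ ⨆ a : E.actionSet t, (E.reward a - E.cost a) :=
    le_ciSup ⟨1, Set.forall_mem_range.2 profit_le⟩ ⟨_, action_mem⟩
  have reward_nonneg := (hf.reward_mem t _ action_mem).1
  have cost_le := (hf.cost_mem t _ action_mem).2
  have payment_nonneg := (ℓ.policy.posted E ag t ω (ℓ.policy.action E ag t ω)).coe_nonneg
  have payment_le : (ℓ.policy.posted E ag t ω (ℓ.policy.action E ag t ω) : ℝ) ≤ 2 :=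
    hf.offer_le_two (hf.isNet t).nonempty (ℓ.stateAt E ag t ω) _
  rw [roundRegret, abs_le]
  constructor
  · linarith [le_benchmark, cost_le, payment_nonneg]
  · linarith [benchmark_le, reward_nonneg, payment_le]

theorem Fits.roundRegret_le_of_not_cutsAt (hf : ℓ.Fits E θ γ) (h : ℓ.policy.IsBestResponding E ag)
    {t : ℕ} (hcut : ¬ℓ.CutsAt E ag ω t) (hω : ω ∉ ℓ.badEvent E ag θ t) :
    ℓ.roundRegret E ag t ω ≤ 2 * ℓ.radius * √(ℓ.width E ag t ω) + 2 * ℓ.acc := by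
  have : Nonempty (E.actionSet t) := ⟨⟨_, (h.mem_bestResponses t ω).1⟩⟩
  rw [roundRegret, sub_le_iff_le_add]
  refine ciSup_le fun b => sub_le_iff_le_add.1 ?_
  exact hf.profit_sub_profit_le (hf.valid_stateAt h t ω) (hf.isNet t) hcut (not_not.1 hω) b.2

open Classical in
theorem Fits.roundRegret_le (hf : ℓ.Fits E θ γ) (h : ℓ.policy.IsBestResponding E ag) (t : ℕ)
    (ω : ℝ × (ℕ → ℝ)) :
    ℓ.roundRegret E ag t ω ≤ 3 * (if ℓ.CutsAt E ag ω t then 1 else 0) +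
      2 * ℓ.radius * √(ℓ.width E ag t ω) + 2 * ℓ.acc +
      3 * (ℓ.badEvent E ag θ t).indicator (1 : ℝ × (ℕ → ℝ) → ℝ) ω := by
  have regret_le := (abs_le.1 (hf.abs_roundRegret_le h t ω)).2
  have width_term_nonneg : 0 ≤ 2 * ℓ.radius * √(ℓ.width E ag t ω) :=
    mul_nonneg (mul_nonneg zero_le_two hf.radius_nonneg) (Real.sqrt_nonneg _)
  have acc_pos := hf.acc_pos
  by_cases hcut : ℓ.CutsAt E ag ω t
  · have indicator_nonneg : 0 ≤ (ℓ.badEvent E ag θ t).indicator (1 : ℝ × (ℕ → ℝ) → ℝ) ω :=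
      Set.indicator_nonneg (fun _ _ => zero_le_one) _
    rw [if_pos hcut]
    linarith
  · rw [if_neg hcut]
    by_cases hω : ω ∈ ℓ.badEvent E ag θ t
    · rw [Set.indicator_of_mem hω, Pi.one_apply]
      linarith
    · rw [Set.indicator_of_notMem hω]
      linarith [hf.roundRegret_le_of_not_cutsAt h hcut hω]

theorem Fits.regret_le (hf : ℓ.Fits E θ γ) (h : ℓ.policy.IsBestResponding E ag) (T : ℕ)
    (ω : ℝ × (ℕ → ℝ)) :
    ℓ.policy.regret E ag T ω ≤
      3 * ℓ.cutBound T + 2 * ℓ.radius * (√T * √((1 + ℓ.bound ^ 2) * ℓ.logDesignBound T)) +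
      2 * ℓ.acc * T +
          ∑ t ∈ Finset.range T, 3 * (ℓ.badEvent E ag θ t).indicator (1 : ℝ × (ℕ → ℝ) → ℝ) ω := by
  classical
  have radius_nonneg := hf.radius_nonneg
  calc ℓ.policy.regret E ag T ω
      = ∑ t ∈ Finset.range T, ℓ.roundRegret E ag t ω := rfl
    _ ≤ ∑ t ∈ Finset.range T, (3 * (if ℓ.CutsAt E ag ω t then 1 else 0) +
          2 * ℓ.radius * √(ℓ.width E ag t ω) + 2 * ℓ.acc +
          3 * (ℓ.badEvent E ag θ t).indicator (1 : ℝ × (ℕ → ℝ) → ℝ) ω) :=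
        Finset.sum_le_sum fun t _ => hf.roundRegret_le h t ω
    _ = 3 * ℓ.cutCount E ag T ω + 2 * ℓ.radius * ∑ t ∈ Finset.range T, √(ℓ.width E ag t ω) +
          2 * ℓ.acc * T +
          ∑ t ∈ Finset.range T, 3 * (ℓ.badEvent E ag θ t).indicator (1 : ℝ × (ℕ → ℝ) → ℝ) ω := by
        rw [cutCount, Nat.count_eq_card_filter_range, Finset.sum_add_distrib,
          Finset.sum_add_distrib, Finset.sum_add_distrib, ← Finset.mul_sum, ← Finset.mul_sum,
          Finset.sum_boole, Finset.sum_const, Finset.card_range, nsmul_eq_mul, mul_comm (T : ℝ)]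
    _ ≤ _ := by
        gcongr
        · exact hf.cutCount_le_cutBound h T ω
        · exact hf.sum_sqrt_width_le h T ω

end Learner

/-! ### Concentration of the reward estimates -/

section Potential

open Matrix

variable {n : Type*} [Fintype n] [DecidableEq n]

/-- The supermartingale of the method of mixtures, in terms of the design matrix `A` and the noise
sum `x`: the average of `exp (w ⬝ᵥ x - σ ^ 2 * (w ⬝ᵥ (A - 1) *ᵥ w) / 2)` over vectors `w` with
independent Gaussian entries of variance `1 / σ ^ 2`. -/
noncomputable def potential (σ : ℝ) (A : Matrix n n ℝ) (x : n → ℝ) : ℝ :=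
  Real.exp (dualSq A x / (2 * σ ^ 2)) / √A.det

theorem measurable_potential {Ω : Type*} [MeasurableSpace Ω] (σ : ℝ) {A : Ω → Matrix n n ℝ}
    {x : Ω → n → ℝ} (hA : Measurable A) (hx : Measurable x) :
    Measurable fun ω => potential σ (A ω) (x ω) := by
  unfold potential
  fun_prop

variable {A : Matrix n n ℝ} {σ : ℝ≥0}

theorem potential_rankOneUpdate_add_smul (hσ : 0 < σ) (hA : A.PosDef) (x w : n → ℝ) (z : ℝ) :
    potential σ (rankOneUpdate A 1 w) (x + z • w) =
      potential σ A x *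
        (Real.exp (-((w ⬝ᵥ A⁻¹ *ᵥ x) ^ 2 / (2 * σ ^ 2 * (1 + dualSq A w)))) /
          √(1 + dualSq A w)) *
        Real.exp ((w ⬝ᵥ A⁻¹ *ᵥ x) / (σ ^ 2 * (1 + dualSq A w)) * z +
          dualSq A w / (σ ^ 2 * (1 + dualSq A w)) * z ^ 2 / 2) := by
  have : (0 : ℝ) < σ := hσ
  have one_add_pos : 0 < 1 + dualSq A w := by
    have := dualSq_nonneg hA w
    positivity
  rw [potential, potential, dualSq_rankOneUpdate_add_smul hA, det_rankOneUpdate hA, one_mul,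
    Real.sqrt_mul hA.det_pos.le, div_mul_div_comm, ← Real.exp_add, div_mul_eq_mul_div,
    ← Real.exp_add]
  congr 2
  field_simp
  ring

theorem lintegral_potential_rankOneUpdate_le (hσ : 0 < σ) {ν : Measure ℝ} [SFinite ν]
    (h : HasSubgaussianMGF (fun z : ℝ => z) (σ ^ 2) ν) (hA : A.PosDef) (x w : n → ℝ) :
    ∫⁻ z, ENNReal.ofReal (potential σ (rankOneUpdate A 1 w) (x + z • w)) ∂ν ≤
      ENNReal.ofReal (potential σ A x) := by
  have : (0 : ℝ) < σ := hσ
  have dualSq_nonneg := dualSq_nonneg hA w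
  set q := dualSq A w
  set m := w ⬝ᵥ A⁻¹ *ᵥ x
  set b := √(q / (σ ^ 2 * (1 + q)))
  have b_sq : b ^ 2 = q / (σ ^ 2 * (1 + q)) := Real.sq_sqrt (by positivity)
  have b_sq_mul : b ^ 2 * ((σ ^ 2 : ℝ≥0) : ℝ) = 1 - 1 / (1 + q) := by
    rw [b_sq, NNReal.coe_pow]
    field_simp
    ring
  set K := potential σ A x * (Real.exp (-(m ^ 2 / (2 * σ ^ 2 * (1 + q)))) / √(1 + q)) with K_def
  have K_nonneg : 0 ≤ K := by
    rw [K_def, potential]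
    positivity
  have K_mul : K * (√(1 + q) *
      Real.exp ((m / (σ ^ 2 * (1 + q))) ^ 2 * ((σ ^ 2 : ℝ≥0) : ℝ) * (1 + q) / 2)) =
      potential σ A x := by
    have exponent_eq : (m / (σ ^ 2 * (1 + q))) ^ 2 * ((σ ^ 2 : ℝ≥0) : ℝ) * (1 + q) / 2 =
        m ^ 2 / (2 * σ ^ 2 * (1 + q)) := by
      rw [NNReal.coe_pow]
      field_simp
    rw [K_def, exponent_eq, Real.exp_neg]
    field_simp
  calc ∫⁻ z, ENNReal.ofReal (potential σ (rankOneUpdate A 1 w) (x + z • w)) ∂ν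
      = ENNReal.ofReal K *
          ∫⁻ z, ENNReal.ofReal (Real.exp (m / (σ ^ 2 * (1 + q)) * z + b ^ 2 * z ^ 2 / 2)) ∂ν := by
        rw [← lintegral_const_mul _ (by fun_prop)]
        refine lintegral_congr fun z => ?_
        rw [← ENNReal.ofReal_mul K_nonneg, potential_rankOneUpdate_add_smul hσ hA, b_sq]
    _ ≤ ENNReal.ofReal K * ENNReal.ofReal (√(1 + q) *
          Real.exp ((m / (σ ^ 2 * (1 + q))) ^ 2 * ((σ ^ 2 : ℝ≥0) : ℝ) * (1 + q) / 2)) := by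
        gcongr
        exact lintegral_exp_quadratic_le h (by positivity) b_sq_mul
    _ = ENNReal.ofReal (potential σ A x) := by rw [← ENNReal.ofReal_mul K_nonneg, K_mul]

theorem dualSq_sub_le (hA : A.PosDef) (x y : n → ℝ) :
    dualSq A (x - y) ≤ 2 * dualSq A x + 2 * dualSq A y := by
  have parallelogram : dualSq A (x + y) + dualSq A (x - y) = 2 * dualSq A x + 2 * dualSq A y := by
    simp only [dualSq, mulVec_sub, mulVec_add, dotProduct_sub, sub_dotProduct, dotProduct_add,
      add_dotProduct]
    ring
  linarith [dualSq_nonneg hA (x + y)]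

end Potential

section Law

variable {α : Type} [MeasurableSpace α] (π : Policy α) (E : Environment α)
  [IsProbabilityMeasure E.noise]

instance Policy.isProbabilityMeasure_law : IsProbabilityMeasure (π.law E) := by
  have := π.isProbabilityMeasure_seedLaw
  rw [Policy.law]
  infer_instance

theorem Policy.lintegral_law_resample (t : ℕ) {G : ℝ × (ℕ → ℝ) → ENNReal} (hG : Measurable G) :
    ∫⁻ ω, G ω ∂(π.law E) = ∫⁻ ω, ∫⁻ z, G (resample t ω z) ∂E.noise ∂(π.law E) := by
  have := π.isProbabilityMeasure_seedLaw
  exact lintegral_resample _ _ t hG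

end Law

/-- The noise of the responses in the regression: the features of the actions taken so far, each
multiplied by its noise, add up to this vector if the reward parameter is `θ`. -/
noncomputable def LearnerState.noiseSum {d : ℕ} (s : LearnerState d) (θ : Fin d → ℝ) :
    Fin d → ℝ :=
  s.response - s.design.mulVec θ + θ

namespace Learner

variable {α : Type} [MeasurableSpace α] {d : ℕ} {ℓ : Learner α d} {E : Environment α}
  {θ γ : Fin d → ℝ} {s : LearnerState d}

theorem Fits.confident_of_dualSq_le (hf : ℓ.Fits E θ γ) (hs : s.Valid γ) {q : ℝ}
    (hq : dualSq s.design (s.noiseSum θ) ≤ q) (h_radius : 2 * q + 2 * ℓ.bound ^ 2 ≤ ℓ.radius ^ 2) :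
    ℓ.Confident s θ := by
  intro b
  have posDef := hs.design_posDef
  have error_eq : s.design.mulVec (s.estimate - θ) = s.noiseSum θ - θ := by
    rw [LearnerState.noiseSum, add_sub_cancel_right, LearnerState.estimate, Matrix.mulVec_sub,
      posDef_mulVec_inv_mulVec posDef]
  have error_le : (s.estimate - θ) ⬝ᵥ s.design.mulVec (s.estimate - θ) ≤ ℓ.radius ^ 2 :=
    calc (s.estimate - θ) ⬝ᵥ s.design.mulVec (s.estimate - θ)
        = dualSq s.design (s.noiseSum θ - θ) := by
          rw [dualSq, ← error_eq, posDef_inv_mulVec_mulVec posDef, dotProduct_comm]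
      _ ≤ 2 * dualSq s.design (s.noiseSum θ) + 2 * dualSq s.design θ := dualSq_sub_le posDef _ _
      _ ≤ 2 * q + 2 * ℓ.bound ^ 2 := by
          gcongr
          exact (dualSq_le_dotProduct posDef hs.le_design θ).trans hf.reward_sq_le
      _ ≤ ℓ.radius ^ 2 := h_radius
  refine abs_le_of_sq_le_sq ?_ (mul_nonneg hf.radius_nonneg (Real.sqrt_nonneg _))
  rw [mul_pow, Real.sq_sqrt (dualSq_nonneg posDef _), mul_comm]
  exact (dotProduct_sq_le_dualSq_mul posDef _ _).trans
    (mul_le_mul_of_nonneg_left error_le (dualSq_nonneg posDef _))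

theorem Fits.measurable_reward (hf : ℓ.Fits E θ γ) : Measurable E.reward := by
  rw [funext hf.reward_eq]
  fun_prop

theorem Fits.measurable_cost (hf : ℓ.Fits E θ γ) : Measurable E.cost := by
  rw [funext hf.cost_eq]
  fun_prop

variable [Nonempty α]

theorem Fits.noiseSum_next (hf : ℓ.Fits E θ γ) (F : Finset α) (s : LearnerState d) (a : α)
    (z : ℝ) : (ℓ.next F s a (E.reward a + z)).noiseSum θ = s.noiseSum θ + z • ℓ.feat a := by
  simp only [LearnerState.noiseSum, next, rankOneUpdate_mulVec, hf.reward_eq, one_mul, add_smul]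
  abel

variable [MeasurableEq α] {ag : Agent α} {t : ℕ} {σ : ℝ≥0}

theorem Fits.measurable_stateAt (hf : ℓ.Fits E θ γ)
    (h_action : ∀ s < t, Measurable (ℓ.policy.action E ag s)) : Measurable (ℓ.stateAt E ag t) :=
  (ℓ.measurable_state t _).comp (Policy.measurable_history hf.measurable_reward t h_action)

theorem stateAt_resample (ω : ℝ × (ℕ → ℝ)) (z : ℝ) :
    ℓ.stateAt E ag t (resample t ω z) = ℓ.stateAt E ag t ω := by
  rw [stateAt, Policy.history_resample le_rfl, ← stateAt]

theorem Fits.measurable_potential_stateAt (hf : ℓ.Fits E θ γ)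
    (h : ℓ.policy.IsBestResponding E ag) (σ : ℝ) (t : ℕ) :
    Measurable fun ω =>
      potential σ (ℓ.stateAt E ag t ω).design ((ℓ.stateAt E ag t ω).noiseSum θ) := by
  have measurable_stateAt := hf.measurable_stateAt (t := t) fun s _ => h.measurable_action s
  unfold LearnerState.noiseSum
  exact measurable_potential σ (by fun_prop) (by fun_prop)

theorem Fits.lintegral_potential_le (hf : ℓ.Fits E θ γ) (hσ : 0 < σ)
    (h_noise : IsSubgaussianNoise σ E.noise) (h : ℓ.policy.IsBestResponding E ag) (t : ℕ) :
    ∫⁻ ω, ENNReal.ofReal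
      (potential σ (ℓ.stateAt E ag t ω).design ((ℓ.stateAt E ag t ω).noiseSum θ))
      ∂(ℓ.policy.law E) ≤ 1 := by
  have := h_noise.isProbabilityMeasure
  induction t with
  | zero => simp [stateAt_zero, init, potential, LearnerState.noiseSum, dualSq]
  | succ t ih =>
    rw [ℓ.policy.lintegral_law_resample E t
      (hf.measurable_potential_stateAt h σ (t + 1)).ennreal_ofReal]
    refine (lintegral_mono fun ω => ?_).trans ih
    have noise_resample (z : ℝ) : (resample t ω z).2 t = z := Function.update_self _ _ _
    simp only [stateAt_succ, stateAt_resample, Policy.action_resample, noise_resample,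
      hf.noiseSum_next]
    exact lintegral_potential_rankOneUpdate_le hσ h_noise.subgaussian
      (hf.valid_stateAt h t ω).design_posDef _ _

theorem Fits.le_potential_of_mem_badEvent (hf : ℓ.Fits E θ γ) (hσ : 0 < σ)
    (h : ℓ.policy.IsBestResponding E ag) {T : ℕ} (hT : 1 ≤ T) (ht : t ≤ T)
    (h_radius : 2 * (2 * σ ^ 2 * (Real.log T + ℓ.logDesignBound T / 2)) + 2 * ℓ.bound ^ 2 ≤
      ℓ.radius ^ 2) {ω : ℝ × (ℕ → ℝ)} (hω : ω ∈ ℓ.badEvent E ag θ t) :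
    T ≤ potential σ (ℓ.stateAt E ag t ω).design ((ℓ.stateAt E ag t ω).noiseSum θ) := by
  have : (0 : ℝ) < σ := hσ
  have horizon_pos : (0 : ℝ) < T := by exact_mod_cast hT
  have valid := hf.valid_stateAt h t ω
  have det_pos := valid.design_posDef.det_pos
  set s := ℓ.stateAt E ag t ω
  have lt_dualSq : 2 * σ ^ 2 * (Real.log T + ℓ.logDesignBound T / 2) <
      dualSq s.design (s.noiseSum θ) :=
    not_le.1 fun hle => hω (hf.confident_of_dualSq_le valid hle h_radius)
  rw [potential, le_div_iff₀ (Real.sqrt_pos.2 det_pos)]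
  calc T * √s.design.det
      = Real.exp (Real.log T + Real.log s.design.det / 2) := by
        rw [Real.exp_add, Real.exp_log horizon_pos, ← Real.log_sqrt det_pos.le,
          Real.exp_log (Real.sqrt_pos.2 det_pos)]
    _ ≤ Real.exp (dualSq s.design (s.noiseSum θ) / (2 * σ ^ 2)) := by
        rw [Real.exp_le_exp, le_div_iff₀ (by positivity), mul_comm]
        refine le_trans ?_ lt_dualSq.le
        gcongr
        exact hf.log_det_design_le h ht ω

theorem Fits.measure_badEvent_le (hf : ℓ.Fits E θ γ) (hσ : 0 < σ)
    (h_noise : IsSubgaussianNoise σ E.noise) (h : ℓ.policy.IsBestResponding E ag) {T : ℕ}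
    (hT : 1 ≤ T) (ht : t ≤ T)
    (h_radius : 2 * (2 * σ ^ 2 * (Real.log T + ℓ.logDesignBound T / 2)) + 2 * ℓ.bound ^ 2 ≤
      ℓ.radius ^ 2) :
    (ℓ.policy.law E).real (ℓ.badEvent E ag θ t) ≤ 1 / T := by
  have horizon_ne_zero : (T : ENNReal) ≠ 0 := by exact_mod_cast (zero_lt_one.trans_le hT).ne'
  have measurable_potential := (hf.measurable_potential_stateAt h σ t).ennreal_ofReal
  refine ENNReal.toReal_le_of_le_ofReal (by positivity) ?_
  rw [one_div, ENNReal.ofReal_inv_of_pos (by positivity), ENNReal.ofReal_natCast, ← one_div]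
  calc ℓ.policy.law E (ℓ.badEvent E ag θ t)
      ≤ ℓ.policy.law E {ω | (T : ENNReal) ≤ ENNReal.ofReal
          (potential σ (ℓ.stateAt E ag t ω).design ((ℓ.stateAt E ag t ω).noiseSum θ))} :=
        measure_mono fun ω hω => by
          rw [Set.mem_ofPred_eq, ← ENNReal.ofReal_natCast]
          exact ENNReal.ofReal_le_ofReal
            (hf.le_potential_of_mem_badEvent hσ h hT ht h_radius hω)
    _ ≤ (∫⁻ ω, ENNReal.ofReal
          (potential σ (ℓ.stateAt E ag t ω).design ((ℓ.stateAt E ag t ω).noiseSum θ))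
          ∂(ℓ.policy.law E)) / T :=
        meas_ge_le_lintegral_div measurable_potential.aemeasurable horizon_ne_zero
          (ENNReal.natCast_ne_top T)
    _ ≤ 1 / T := by
        gcongr
        exact hf.lintegral_potential_le hσ h_noise h t

end Learner

/-! ### Agents that break ties in favor of the principal -/

section LexUtility

variable {α : Type}

/-- The agent's utility, refined lexicographically by the principal's profit: a maximizer is a best
response that, among the best responses, is best for the principal. -/
noncomputable def lexUtility (r c : α → ℝ) (x : α → ℝ≥0) (a : α) : ℝ ×ₗ ℝ :=
  toLex ((x a : ℝ) - c a, r a - x a)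

variable {S : Set α} {r c : α → ℝ} {x : α → ℝ≥0} {a b : α}

theorem lexUtility_le_lexUtility_iff :
    lexUtility r c x b ≤ lexUtility r c x a ↔ (x b : ℝ) - c b ≤ x a - c a ∧
      ((x b : ℝ) - c b = x a - c a → r b - x b ≤ r a - x a) :=
  Prod.Lex.toLex_le_toLex'

theorem mem_bestResponses_of_isMaxOn (ha : a ∈ S) (h_max : IsMaxOn (lexUtility r c x) S a) :
    a ∈ bestResponses S c x :=
  ⟨ha, fun _ hb => (lexUtility_le_lexUtility_iff.1 (h_max hb)).1⟩

theorem profit_le_of_isMaxOn (ha : a ∈ S) (h_max : IsMaxOn (lexUtility r c x) S a)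
    (hb : b ∈ bestResponses S c x) : r b - x b ≤ r a - x a :=
  have h_le := lexUtility_le_lexUtility_iff.1 (h_max hb.1)
  h_le.2 (h_le.1.antisymm (hb.2 a ha))

theorem measurableSet_toLex_le_toLex {Ω : Type*} [MeasurableSpace Ω] {f₁ f₂ g₁ g₂ : Ω → ℝ}
    (hf₁ : Measurable f₁) (hf₂ : Measurable f₂) (hg₁ : Measurable g₁) (hg₂ : Measurable g₂) :
    MeasurableSet {ω | toLex (f₁ ω, f₂ ω) ≤ toLex (g₁ ω, g₂ ω)} := by
  simp only [Prod.Lex.toLex_le_toLex]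
  exact (measurableSet_lt hf₁ hg₁).union
    ((measurableSet_eq_fun hf₁ hg₁).inter (measurableSet_le hf₂ hg₂))

theorem Policy.isBestResponding_and_tiesFavorPrincipal [MeasurableSpace α] {π : Policy α}
    {E : Environment α} {ag : Agent α} (h_action : ∀ t, Measurable (π.action E ag t))
    (h_mem : ∀ t ω, π.action E ag t ω ∈ E.actionSet t)
    (h_max : ∀ t ω, IsMaxOn (lexUtility E.reward E.cost (π.posted E ag t ω)) (E.actionSet t)
      (π.action E ag t ω)) :
    π.IsBestResponding E ag ∧ π.TiesFavorPrincipal E ag :=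
  ⟨⟨fun t ω => mem_bestResponses_of_isMaxOn (h_mem t ω) (h_max t ω), h_action⟩,
    fun t ω _ => profit_le_of_isMaxOn (h_mem t ω) (h_max t ω)⟩

variable [Nonempty α]

open Classical in
/-- An agent for contracts that pay for a single action: he takes that action if it is at least as
good as `b t` without payment, and otherwise `b t`. With `b t` a best unpaid action of round `t`,
this maximizes `lexUtility`. -/
noncomputable def singlePayAgent (r c : α → ℝ) (b : ℕ → α) : Agent α := fun t x =>
  let a := Classical.epsilon fun a => x a ≠ 0
  if lexUtility r c 0 (b t) ≤ lexUtility r c x a then a else b t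

open Classical in
theorem singlePayAgent_eq_ite (hxa : x a ≠ 0) (hx : ∀ a' ≠ a, x a' = 0) (b : ℕ → α) (t : ℕ) :
    singlePayAgent r c b t x =
      if lexUtility r c 0 (b t) ≤ lexUtility r c x a then a else b t := by
  have epsilon_eq : (Classical.epsilon fun a => x a ≠ 0) = a :=
    not_imp_comm.1 (hx _) (Classical.epsilon_spec (p := fun a => x a ≠ 0) ⟨a, hxa⟩)
  rw [singlePayAgent, epsilon_eq]

theorem isMaxOn_singlePayAgent (hxa : x a ≠ 0) (hx : ∀ a' ≠ a, x a' = 0) {b : ℕ → α} {t : ℕ}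
    (h_max : IsMaxOn (lexUtility r c 0) S (b t)) :
    IsMaxOn (lexUtility r c x) S (singlePayAgent r c b t x) := by
  have unpaid {a' : α} (h : a' ≠ a) : lexUtility r c x a' = lexUtility r c 0 a' := by
    simp only [lexUtility, hx a' h, Pi.zero_apply]
  have le_unpaid {a' : α} (ha' : a' ∈ S) (h : a' ≠ a) :
      lexUtility r c x a' ≤ lexUtility r c 0 (b t) :=
    (unpaid h).trans_le (h_max ha')
  have lt_paid : lexUtility r c 0 a < lexUtility r c x a :=
    Prod.Lex.toLex_lt_toLex.2 (Or.inl (by simpa using pos_iff_ne_zero.2 hxa))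
  intro a' ha'
  rw [Set.mem_ofPred_eq, singlePayAgent_eq_ite hxa hx]
  split_ifs with h_accept
  · rcases eq_or_ne a' a with rfl | h
    · exact le_rfl
    · exact (le_unpaid ha' h).trans h_accept
  · rw [not_le] at h_accept
    have ne_paid : b t ≠ a := fun h => (lt_paid.trans h_accept).ne (by rw [h])
    rw [unpaid ne_paid]
    rcases eq_or_ne a' a with rfl | h
    · exact h_accept.le
    · exact le_unpaid ha' h

end LexUtility

namespace Learner

variable {α : Type} [MeasurableSpace α] [Nonempty α] {d : ℕ} {ℓ : Learner α d}
  {E : Environment α} {θ γ : Fin d → ℝ}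

theorem Fits.offer_target_ne_zero (hf : ℓ.Fits E θ γ) {F : Finset α} (hF : F.Nonempty)
    (s : LearnerState d) : ℓ.offer F s (ℓ.target F s) ≠ 0 := by
  rw [← NNReal.coe_ne_zero, hf.offer_target hF]
  exact (hf.bonus_pos.trans_le (ℓ.bonus_le_price hF s)).ne'

theorem Fits.exists_agent [MeasurableEq α] (hf : ℓ.Fits E θ γ)
    (h_best : ∀ t, ∃ b ∈ E.actionSet t,
      IsMaxOn (lexUtility E.reward E.cost 0) (E.actionSet t) b) :
    ∃ ag, ℓ.policy.IsBestResponding E ag ∧ ℓ.policy.TiesFavorPrincipal E ag := by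
  classical
  choose b b_mem b_max using h_best
  set ag := singlePayAgent E.reward E.cost b
  have action_eq (t : ℕ) (ω : ℝ × (ℕ → ℝ)) : ℓ.policy.action E ag t ω = _ :=
    singlePayAgent_eq_ite (hf.offer_target_ne_zero (hf.isNet t).nonempty (ℓ.stateAt E ag t ω))
      (fun _ => offer_of_ne) b t
  refine ⟨ag, Policy.isBestResponding_and_tiesFavorPrincipal (fun t => ?_) (fun t ω => ?_)
    fun t ω => ?_⟩
  · induction t using Nat.strong_induction_on with
    | _ t ih =>
      have := hf.measurable_reward
      have := hf.measurable_cost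
      have := hf.measurable_stateAt ih
      rw [funext (action_eq t)]
      exact Measurable.ite
        (measurableSet_toLex_le_toLex measurable_const measurable_const (by fun_prop)
          (by fun_prop)) (by fun_prop) measurable_const
  · rw [action_eq]
    split_ifs
    · exact (hf.isNet t).subset (ℓ.target_spec (hf.isNet t).nonempty _).1
    · exact b_mem t
  · exact isMaxOn_singlePayAgent (hf.offer_target_ne_zero (hf.isNet t).nonempty _)
      (fun _ => offer_of_ne) (b_max t)

end Learner

/-! ### The expected regret of the learner -/

theorem integral_le_add_sum_measureReal {Ω ι : Type*} [MeasurableSpace Ω] {μ : Measure Ω}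
    [IsProbabilityMeasure μ] {f : Ω → ℝ} (hf : Integrable f μ) {I : Finset ι} {A : ι → Set Ω}
    {c k : ℝ} (hk : 0 ≤ k) (h_le : ∀ ω, f ω ≤ c + ∑ i ∈ I, k * (A i).indicator (1 : Ω → ℝ) ω) :
    ∫ ω, f ω ∂μ ≤ c + ∑ i ∈ I, k * μ.real (A i) := by
  let B (i : ι) : Set Ω := toMeasurable μ (A i)
  have measurableSet_B (i : ι) : MeasurableSet (B i) := measurableSet_toMeasurable μ (A i)
  have integrable_term (i : ι) : Integrable (fun ω => k * (B i).indicator (1 : Ω → ℝ) ω) μ :=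
    ((integrable_const 1).indicator (measurableSet_B i)).const_mul k
  have indicator_le (i : ι) (ω : Ω) :
      (A i).indicator (1 : Ω → ℝ) ω ≤ (B i).indicator (1 : Ω → ℝ) ω :=
    Set.indicator_le_indicator_of_subset (subset_toMeasurable μ (A i)) (fun _ => zero_le_one) ω
  calc ∫ ω, f ω ∂μ
      ≤ ∫ ω, (c + ∑ i ∈ I, k * (B i).indicator (1 : Ω → ℝ) ω) ∂μ := by
        refine integral_mono hf ((integrable_const c).add
          (integrable_finsetSum I fun i _ => integrable_term i)) fun ω => (h_le ω).trans ?_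
        exact add_le_add le_rfl
          (Finset.sum_le_sum fun i _ => mul_le_mul_of_nonneg_left (indicator_le i ω) hk)
    _ = c + ∑ i ∈ I, k * μ.real (B i) := by
        rw [integral_add (integrable_const c) (integrable_finsetSum I fun i _ => integrable_term i),
          integral_finsetSum I fun i _ => integrable_term i]
        simp only [integral_const, probReal_univ, one_smul, integral_const_mul,
          integral_indicator_one (measurableSet_B _)]
    _ = c + ∑ i ∈ I, k * μ.real (A i) := by
        simp only [B, Measure.real, measure_toMeasurable]

namespace Learner

section ExpectedRegret

variable {α : Type} [MeasurableSpace α] {d : ℕ}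

/-- A bound for the expected regret of `T` rounds. -/
noncomputable def regretBound (ℓ : Learner α d) (T : ℕ) : ℝ :=
  3 * ℓ.cutBound T + 2 * ℓ.radius * (√T * √((1 + ℓ.bound ^ 2) * ℓ.logDesignBound T)) +
    2 * ℓ.acc * T + 3

variable [MeasurableEq α] [Nonempty α] {ℓ : Learner α d} {E : Environment α} {θ γ : Fin d → ℝ}
  {ag : Agent α} {σ : ℝ≥0}

theorem Fits.measurable_regret (hf : ℓ.Fits E θ γ) (h : ℓ.policy.IsBestResponding E ag) (T : ℕ) :
    Measurable (ℓ.policy.regret E ag T) := by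
  refine Finset.measurable_fun_sum _ fun t _ => ?_
  have measurable_action := h.measurable_action t
  have := hf.measurable_stateAt (t := t) fun s _ => h.measurable_action s
  have measurable_payment := ℓ.measurable_offer this measurable_action (ℓ.net (E.actionSet t))
  exact measurable_const.sub
    ((hf.measurable_reward.comp measurable_action).sub measurable_payment.coe_nnreal_real)

theorem Fits.integrable_regret (hf : ℓ.Fits E θ γ) [IsProbabilityMeasure E.noise]
    (h : ℓ.policy.IsBestResponding E ag) (T : ℕ) :
    Integrable (ℓ.policy.regret E ag T) (ℓ.policy.law E) := by
  refine Integrable.of_bound (hf.measurable_regret h T).aestronglyMeasurable (T * 3)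
    (Filter.Eventually.of_forall fun ω => ?_)
  calc |ℓ.policy.regret E ag T ω|
      ≤ ∑ t ∈ Finset.range T, |ℓ.roundRegret E ag t ω| := Finset.abs_sum_le_sum_abs _ _
    _ ≤ ∑ t ∈ Finset.range T, 3 := Finset.sum_le_sum fun t _ => hf.abs_roundRegret_le h t ω
    _ = T * 3 := by rw [Finset.sum_const, Finset.card_range, nsmul_eq_mul]

theorem Fits.integral_regret_le (hf : ℓ.Fits E θ γ) (hσ : 0 < σ)
    (h_noise : IsSubgaussianNoise σ E.noise) (h : ℓ.policy.IsBestResponding E ag) {T : ℕ}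
    (hT : 1 ≤ T)
    (h_radius : 2 * (2 * σ ^ 2 * (Real.log T + ℓ.logDesignBound T / 2)) + 2 * ℓ.bound ^ 2 ≤
      ℓ.radius ^ 2) :
    ∫ ω, ℓ.policy.regret E ag T ω ∂(ℓ.policy.law E) ≤ ℓ.regretBound T := by
  have := h_noise.isProbabilityMeasure
  have : (0 : ℝ) < T := by exact_mod_cast hT
  refine (integral_le_add_sum_measureReal (hf.integrable_regret h T) zero_le_three
    (hf.regret_le h T)).trans ?_
  rw [regretBound]
  gcongr
  calc ∑ t ∈ Finset.range T, 3 * (ℓ.policy.law E).real (ℓ.badEvent E ag θ t)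
      ≤ ∑ t ∈ Finset.range T, 3 * (1 / (T : ℝ)) := by
        gcongr with t ht
        exact hf.measure_badEvent_le hσ h_noise h hT (Finset.mem_range.1 ht).le h_radius
    _ = 3 := by
        rw [Finset.sum_const, Finset.card_range, nsmul_eq_mul]
        field_simp

end ExpectedRegret

section Tuning

/-- The rate of `logDesignBound` per unit of `1 + log T`. -/
noncomputable def designRate (d : ℕ) (R : ℝ) : ℝ := d * (Real.log (d + R ^ 2) + 1)

/-- The rate of `cutBound` per unit of `1 + log T`, for a learner of accuracy `1 / √T`. -/
noncomputable def cutRate (d : ℕ) (R : ℝ) : ℝ :=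
  8 * d ^ 2 * (Real.log (R ^ 2 * (d + 4096 * R ^ 2 * d ^ 2)) + 2)

/-- The squared radius, per unit of `1 + log T`, that makes the confidence ellipsoids valid. -/
noncomputable def radiusRate (σ : ℝ≥0) (d : ℕ) (R : ℝ) : ℝ :=
  4 * σ ^ 2 * (1 + designRate d R / 2) + 2 * R ^ 2

/-- The rate of the expected regret of the tuned learner per unit of `√T * (1 + log T)`. -/
noncomputable def regretRate (σ : ℝ≥0) (d : ℕ) (R : ℝ) : ℝ :=
  3 * cutRate d R + 2 * √(radiusRate σ d R * ((1 + R ^ 2) * designRate d R)) + 5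

variable {α : Type} [MeasurableSpace α] {d : ℕ} {R : ℝ} {σ : ℝ≥0} {φ : α → Fin d → ℝ}
  {hφ : Measurable φ} {T : ℕ}

/-- The learner whose parameters are tuned to the horizon `T`. -/
noncomputable def tuned (φ : α → Fin d → ℝ) (hφ : Measurable φ) (σ : ℝ≥0) (R : ℝ) (T : ℕ) :
    Learner α d where
  feat := φ
  measurable_feat := hφ
  radius := √(radiusRate σ d R * (1 + Real.log T))
  acc := 1 / √T
  bound := R

theorem designRate_nonneg (hd : 1 ≤ d) : 0 ≤ designRate d R := by
  have : (1 : ℝ) ≤ d := by exact_mod_cast hd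
  have := Real.log_nonneg (show (1 : ℝ) ≤ d + R ^ 2 by nlinarith)
  unfold designRate
  positivity

theorem radiusRate_nonneg (hd : 1 ≤ d) : 0 ≤ radiusRate σ d R := by
  have := designRate_nonneg (R := R) hd
  unfold radiusRate
  positivity

theorem logDesignBound_le (ℓ : Learner α d) (hd : 1 ≤ d) (hT : 1 ≤ T) :
    ℓ.logDesignBound T ≤ designRate d ℓ.bound * (1 + Real.log T) := by
  have : (1 : ℝ) ≤ d := by exact_mod_cast hd
  have : (1 : ℝ) ≤ T := by exact_mod_cast hT
  have log_horizon_nonneg : 0 ≤ Real.log T := Real.log_nonneg this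
  have log_rate_nonneg : 0 ≤ Real.log (d + ℓ.bound ^ 2) := Real.log_nonneg (by nlinarith)
  rw [logDesignBound, designRate, mul_assoc]
  gcongr
  calc Real.log (d + T * ℓ.bound ^ 2)
      ≤ Real.log ((d + ℓ.bound ^ 2) * T) := Real.log_le_log (by positivity) (by nlinarith)
    _ = Real.log (d + ℓ.bound ^ 2) + Real.log T := Real.log_mul (by positivity) (by positivity)
    _ ≤ (Real.log (d + ℓ.bound ^ 2) + 1) * (1 + Real.log T) := by nlinarith

theorem one_le_cutRate_arg (hd : 1 ≤ d) (hR : 1 ≤ R) :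
    1 ≤ R ^ 2 * (d + 4096 * R ^ 2 * d ^ 2) := by
  have : (1 : ℝ) ≤ d := by exact_mod_cast hd
  exact one_le_mul_of_one_le_of_one_le (one_le_pow₀ hR)
    (this.trans (le_add_of_nonneg_right (by positivity)))

theorem cutRate_nonneg (hd : 1 ≤ d) (hR : 1 ≤ R) : 0 ≤ cutRate d R := by
  have := Real.log_nonneg (one_le_cutRate_arg hd hR)
  unfold cutRate
  positivity

theorem cutBound_tuned_le (hd : 1 ≤ d) (hR : 1 ≤ R) (hT : 1 ≤ T) :
    (tuned φ hφ σ R T).cutBound T ≤ cutRate d R * (1 + Real.log T) := by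
  have : (1 : ℝ) ≤ d := by exact_mod_cast hd
  have one_le_horizon : (1 : ℝ) ≤ T := by exact_mod_cast hT
  have log_horizon_nonneg : 0 ≤ Real.log T := Real.log_nonneg one_le_horizon
  set K : ℝ := R ^ 2 * (d + 4096 * R ^ 2 * d ^ 2) with K_def
  have one_le_K : 1 ≤ K := one_le_cutRate_arg hd hR
  have log_K_nonneg : 0 ≤ Real.log K := Real.log_nonneg one_le_K
  have cut_depth : T * (4 * R ^ 2 / ((tuned φ hφ σ R T).bonus / 2) ^ 2) =
      4096 * R ^ 2 * d ^ 2 * T ^ 2 := by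
    have sq_sqrt : √(T : ℝ) ^ 2 = T := Real.sq_sqrt T.cast_nonneg
    simp only [bonus, cutStep, tuned]
    field_simp
    rw [sq_sqrt]
    ring
  have arg_le : R ^ 2 * (d + T * (4 * R ^ 2 / ((tuned φ hφ σ R T).bonus / 2) ^ 2)) ≤
      K * T ^ 2 := by
    have : R ^ 2 * d * 1 ≤ R ^ 2 * d * T ^ 2 := by
      gcongr
      exact one_le_pow₀ one_le_horizon
    rw [cut_depth, K_def]
    linarith
  rw [cutBound, cutRate, mul_assoc (8 * (d : ℝ) ^ 2)]
  refine mul_le_mul_of_nonneg_left ?_ (by positivity)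
  calc Real.log (R ^ 2 * (d + T * (4 * R ^ 2 / ((tuned φ hφ σ R T).bonus / 2) ^ 2)))
      ≤ Real.log (K * T ^ 2) := Real.log_le_log (by positivity) arg_le
    _ = Real.log K + 2 * Real.log T := by
        rw [Real.log_mul (by positivity) (by positivity), Real.log_pow, Nat.cast_two]
    _ ≤ (Real.log K + 2) * (1 + Real.log T) := by nlinarith

theorem sq_radius_tuned (hd : 1 ≤ d) (T : ℕ) :
    (tuned φ hφ σ R T).radius ^ 2 = radiusRate σ d R * (1 + Real.log T) :=
  Real.sq_sqrt (mul_nonneg (radiusRate_nonneg hd)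
    (add_nonneg zero_le_one (Real.log_natCast_nonneg T)))

theorem le_sq_radius_tuned (hd : 1 ≤ d) (hT : 1 ≤ T) :
    2 * (2 * σ ^ 2 * (Real.log T + (tuned φ hφ σ R T).logDesignBound T / 2)) + 2 * R ^ 2 ≤
      (tuned φ hφ σ R T).radius ^ 2 := by
  rw [sq_radius_tuned hd]
  have bound_le : 2 * R ^ 2 ≤ 2 * R ^ 2 * (1 + Real.log T) :=
    le_mul_of_one_le_right (by positivity) (le_add_of_nonneg_right (Real.log_natCast_nonneg T))
  calc 2 * (2 * σ ^ 2 * (Real.log T + (tuned φ hφ σ R T).logDesignBound T / 2)) + 2 * R ^ 2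
      ≤ 2 * (2 * σ ^ 2 * ((1 + Real.log T) + designRate d R * (1 + Real.log T) / 2)) +
          2 * R ^ 2 * (1 + Real.log T) := by
        refine add_le_add ?_ bound_le
        gcongr
        · exact le_add_of_nonneg_left zero_le_one
        · exact logDesignBound_le _ hd hT
    _ = radiusRate σ d R * (1 + Real.log T) := by
        rw [radiusRate]
        ring

theorem radius_mul_sqrt_tuned_le (hd : 1 ≤ d) (hT : 1 ≤ T) :
    (tuned φ hφ σ R T).radius * √((1 + R ^ 2) * (tuned φ hφ σ R T).logDesignBound T) ≤
      √(radiusRate σ d R * ((1 + R ^ 2) * designRate d R)) * (1 + Real.log T) := by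
  have : 0 ≤ Real.log T := Real.log_natCast_nonneg T
  have := radiusRate_nonneg (σ := σ) (R := R) hd
  set L := 1 + Real.log T
  calc (tuned φ hφ σ R T).radius * √((1 + R ^ 2) * (tuned φ hφ σ R T).logDesignBound T)
      ≤ √(radiusRate σ d R * L) * √((1 + R ^ 2) * (designRate d R * L)) := by
        rw [tuned]
        gcongr
        exact logDesignBound_le _ hd hT
    _ = √(radiusRate σ d R * ((1 + R ^ 2) * designRate d R) * L ^ 2) := by
        rw [← Real.sqrt_mul (by positivity)]
        ring_nf
    _ = √(radiusRate σ d R * ((1 + R ^ 2) * designRate d R)) * L := by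
        rw [Real.sqrt_mul' _ (sq_nonneg L), Real.sqrt_sq (by positivity)]

theorem regretBound_tuned_le (hd : 1 ≤ d) (hR : 1 ≤ R) (hT : 1 ≤ T) :
    (tuned φ hφ σ R T).regretBound T ≤ regretRate σ d R * √T * (1 + Real.log T) := by
  have one_le_sqrt : 1 ≤ √(T : ℝ) := Real.one_le_sqrt.2 (by exact_mod_cast hT)
  have log_horizon_nonneg : 0 ≤ Real.log T := Real.log_natCast_nonneg T
  have cut_le := cutBound_tuned_le (φ := φ) (hφ := hφ) (σ := σ) hd hR hT
  have cut_le_sqrt_mul :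
      (tuned φ hφ σ R T).cutBound T ≤ √T * (cutRate d R * (1 + Real.log T)) :=
    cut_le.trans (le_mul_of_one_le_left
      (mul_nonneg (cutRate_nonneg hd hR) (add_nonneg zero_le_one log_horizon_nonneg)) one_le_sqrt)
  have explore_le := radius_mul_sqrt_tuned_le (φ := φ) (hφ := hφ) (σ := σ) (R := R) hd hT
  have acc_mul : (tuned φ hφ σ R T).acc * T = √T := by
    rw [tuned, one_div_mul_eq_div, Real.div_sqrt]
  have sqrt_le : √(T : ℝ) ≤ √T * (1 + Real.log T) := by nlinarith
  calc (tuned φ hφ σ R T).regretBound T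
      = 3 * (tuned φ hφ σ R T).cutBound T +
          2 * √T * ((tuned φ hφ σ R T).radius *
            √((1 + R ^ 2) * (tuned φ hφ σ R T).logDesignBound T)) +
          2 * ((tuned φ hφ σ R T).acc * T) + 3 := by
        rw [regretBound, show (tuned φ hφ σ R T).bound = R from rfl]
        ring
    _ ≤ 3 * (√T * (cutRate d R * (1 + Real.log T))) +
          2 * √T * (√(radiusRate σ d R * ((1 + R ^ 2) * designRate d R)) * (1 + Real.log T)) +
          2 * (√T * (1 + Real.log T)) + 3 * (√T * (1 + Real.log T)) := by
        rw [acc_mul]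
        gcongr
        linarith
    _ = regretRate σ d R * √T * (1 + Real.log T) := by
        rw [regretRate]
        ring

end Tuning

end Learner

/-! ### Upper bounds -/

section Upper

variable {α : Type} {d : ℕ}

/-- A bandit problem whose mean rewards and costs are linear in the features `φ`; both
multi-armed and linear bandits are of this kind. -/
structure IsFeatureBandit (φ : α → Fin d → ℝ) (R : ℝ) (σ : ℝ≥0) (E : Environment α) : Prop where
  exists_parameters : ∃ θ γ : Fin d → ℝ, θ ⬝ᵥ θ ≤ R ^ 2 ∧ γ ⬝ᵥ γ ≤ R ^ 2 ∧
    (∀ a, E.reward a = φ a ⬝ᵥ θ) ∧ ∀ a, E.cost a = φ a ⬝ᵥ γ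
  nonempty : ∀ t, (E.actionSet t).Nonempty
  isCompact : ∀ t, IsCompact (φ '' E.actionSet t)
  feat_sq_le : ∀ t, ∀ a ∈ E.actionSet t, φ a ⬝ᵥ φ a ≤ R ^ 2
  reward_mem : ∀ t, ∀ a ∈ E.actionSet t, E.reward a ∈ Set.Icc (0 : ℝ) 1
  cost_mem : ∀ t, ∀ a ∈ E.actionSet t, E.cost a ∈ Set.Icc (0 : ℝ) 1
  noise : IsSubgaussianNoise σ E.noise

theorem Learner.exists_isNet [MeasurableSpace α] {ℓ : Learner α d} {S : Set α} (hS : S.Nonempty)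
    (hc : IsCompact (ℓ.feat '' S)) (h : ℓ.bonus / (2 * ℓ.bound) ≠ 0) : ∃ F, ℓ.IsNet S F := by
  let U (b : α) : Set (Fin d → ℝ) :=
    {y | (y - ℓ.feat b) ⬝ᵥ (y - ℓ.feat b) < (ℓ.bonus / (2 * ℓ.bound)) ^ 2}
  have isOpen_U (b : α) : IsOpen (U b) :=
    isOpen_lt ((continuous_id.sub continuous_const).dotProduct (continuous_id.sub continuous_const))
      continuous_const
  have subset_iUnion : ℓ.feat '' S ⊆ ⋃ b ∈ S, U b := by
    rintro - ⟨b, hb, rfl⟩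
    refine Set.mem_biUnion hb ?_
    simp only [U, Set.mem_ofPred_eq, sub_self, dotProduct_zero]
    positivity
  obtain ⟨F, F_subset, F_finite, subset_F⟩ :=
    hc.elim_finite_subcover_image (fun b _ => isOpen_U b) subset_iUnion
  have exists_near (a : α) (ha : a ∈ S) : ∃ b ∈ F, ℓ.Near a b := by
    obtain ⟨b, hb, hab⟩ := Set.mem_iUnion₂.1 (subset_F (Set.mem_image_of_mem _ ha))
    exact ⟨b, hb, le_of_lt hab⟩
  obtain ⟨a, ha⟩ := hS
  obtain ⟨b, hb, -⟩ := exists_near a ha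
  exact ⟨F_finite.toFinset, ⟨b, F_finite.mem_toFinset.2 hb⟩, by rwa [F_finite.coe_toFinset],
    by simpa only [F_finite.mem_toFinset] using exists_near⟩

theorem IsFeatureBandit.exists_isMaxOn_lexUtility {φ : α → Fin d → ℝ} {R : ℝ} {σ : ℝ≥0}
    {E : Environment α} (hE : IsFeatureBandit φ R σ E) (t : ℕ) :
    ∃ b ∈ E.actionSet t, IsMaxOn (lexUtility E.reward E.cost 0) (E.actionSet t) b := by
  obtain ⟨θ, γ, -, -, reward_eq, cost_eq⟩ := hE.exists_parameters
  have continuous_dotProduct (v : Fin d → ℝ) : Continuous fun y : Fin d → ℝ => y ⬝ᵥ v :=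
    continuous_id.dotProduct continuous_const
  obtain ⟨x, hx, x_min⟩ := (hE.isCompact t).exists_isMinOn ((hE.nonempty t).image _)
    (continuous_dotProduct γ).continuousOn
  have isCompact_cheapest : IsCompact (φ '' E.actionSet t ∩ {y | y ⬝ᵥ γ = x ⬝ᵥ γ}) :=
    (hE.isCompact t).inter_right (isClosed_eq (continuous_dotProduct γ) continuous_const)
  obtain ⟨_, ⟨⟨b, hb, rfl⟩, b_cheapest⟩, b_max⟩ := isCompact_cheapest.exists_isMaxOn ⟨x, hx, rfl⟩
    (continuous_dotProduct θ).continuousOn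
  have cost_eq_min : E.cost b = x ⬝ᵥ γ := (cost_eq b).trans b_cheapest
  refine ⟨b, hb, fun a ha => lexUtility_le_lexUtility_iff.2 ?_⟩
  simp only [Pi.zero_apply, NNReal.coe_zero, zero_sub, sub_zero, neg_le_neg_iff, neg_inj]
  refine ⟨?_, fun a_cheapest => ?_⟩
  · rw [cost_eq_min, cost_eq]
    exact x_min (Set.mem_image_of_mem φ ha)
  · rw [reward_eq, reward_eq]
    exact b_max ⟨Set.mem_image_of_mem φ ha, by
      rw [Set.mem_ofPred_eq, ← cost_eq, a_cheapest, cost_eq_min]⟩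

theorem IsFeatureBandit.exists_fits_tuned [MeasurableSpace α] {φ : α → Fin d → ℝ}
    (hφ : Measurable φ) {R : ℝ} {σ : ℝ≥0} {E : Environment α} (hE : IsFeatureBandit φ R σ E)
    (hd : 1 ≤ d) (hR : 1 ≤ R) {T : ℕ} (hT : 1 ≤ T) :
    ∃ θ γ, (Learner.tuned φ hφ σ R T).Fits E θ γ := by
  obtain ⟨θ, γ, hθ, hγ, reward_eq, cost_eq⟩ := hE.exists_parameters
  have : (1 : ℝ) ≤ d := by exact_mod_cast hd
  have one_le_sqrt : 1 ≤ √(T : ℝ) := Real.one_le_sqrt.2 (by exact_mod_cast hT)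
  have mesh_pos : 0 < (Learner.tuned φ hφ σ R T).bonus / (2 * R) := by
    simp only [Learner.bonus, cutStep, Learner.tuned]
    positivity
  exact ⟨θ, γ,
    { one_le_dim := hd
      acc_pos := one_div_pos.2 (by positivity)
      acc_le_one := (div_le_one (by positivity)).2 one_le_sqrt
      one_le_bound := hR
      radius_nonneg := Real.sqrt_nonneg _
      reward_sq_le := hθ
      cost_sq_le := hγ
      exists_net := fun t => Learner.exists_isNet (hE.nonempty t) (hE.isCompact t) mesh_pos.ne'
      feat_sq_le := hE.feat_sq_le
      reward_eq := reward_eq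
      cost_eq := cost_eq
      reward_mem := hE.reward_mem
      cost_mem := hE.cost_mem }⟩

theorem exists_policy_expectedRegretLE [MeasurableSpace α] [MeasurableEq α] [Nonempty α]
    {φ : α → Fin d → ℝ} (hφ : Measurable φ) (hd : 1 ≤ d) {σ : ℝ≥0} (hσ : 0 < σ) {R : ℝ}
    (hR : 1 ≤ R) :
    ∃ C : ℝ, ∀ T : ℕ, 1 ≤ T → ∃ π : Policy α, ∀ E : Environment α, IsFeatureBandit φ R σ E →
      π.ExpectedRegretLE E T (C * √(T : ℝ) * (1 + Real.log T) ^ 1) := by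
  refine ⟨Learner.regretRate σ d R, fun T hT => ⟨(Learner.tuned φ hφ σ R T).policy, fun E hE => ?_⟩⟩
  obtain ⟨θ, γ, hf⟩ := hE.exists_fits_tuned hφ hd hR hT
  have := hE.noise.isProbabilityMeasure
  refine ⟨hf.exists_agent hE.exists_isMaxOn_lexUtility, fun ag h => ⟨hf.integrable_regret h T, ?_⟩⟩
  rw [pow_one]
  exact (hf.integral_regret_le hσ hE.noise h hT (Learner.le_sq_radius_tuned hd hT)).trans
    (Learner.regretBound_tuned_le hd hR hT)

theorem IsMultiArmedBandit.isFeatureBandit {N : ℕ} {σ : ℝ≥0} {E : Environment (Fin N)}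
    (hE : IsMultiArmedBandit N σ E) (hN : 1 ≤ N) :
    IsFeatureBandit (fun i => Pi.single i 1) N σ E := by
  have one_le_card : (1 : ℝ) ≤ N := by exact_mod_cast hN
  have dotProduct_self_le {v : Fin N → ℝ} (hv : ∀ i, v i ∈ Set.Icc (0 : ℝ) 1) :
      v ⬝ᵥ v ≤ (N : ℝ) ^ 2 :=
    calc v ⬝ᵥ v ≤ ∑ _i : Fin N, (1 : ℝ) :=
          Finset.sum_le_sum fun i _ => mul_le_one₀ (hv i).2 (hv i).1 (hv i).2
      _ = N := by rw [Finset.sum_const, Finset.card_fin, nsmul_one]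
      _ ≤ (N : ℝ) ^ 2 := le_self_pow₀ one_le_card two_ne_zero
  exact
    { exists_parameters := ⟨E.reward, E.cost, dotProduct_self_le hE.reward_mem,
        dotProduct_self_le hE.cost_mem, fun a => (single_one_dotProduct a _).symm,
        fun a => (single_one_dotProduct a _).symm⟩
      nonempty := fun t => ⟨⟨0, hN⟩, hE.actionSet_eq t ▸ Set.mem_univ _⟩
      isCompact := fun t => (Set.toFinite _).isCompact
      feat_sq_le := fun t a _ => by
        rw [single_one_dotProduct, Pi.single_eq_same]
        exact one_le_pow₀ one_le_card
      reward_mem := fun t a _ => hE.reward_mem a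
      cost_mem := fun t a _ => hE.cost_mem a
      noise := hE.noise }

theorem IsLinearBandit.isFeatureBandit {d : ℕ} {σ : ℝ≥0}
    {E : Environment (EuclideanSpace ℝ (Fin d))} (hE : IsLinearBandit d σ E) (hd : 1 ≤ d) :
    IsFeatureBandit WithLp.ofLp d σ E := by
  have one_le_dim : (1 : ℝ) ≤ d := by exact_mod_cast hd
  have inner_eq (x y : EuclideanSpace ℝ (Fin d)) : inner ℝ x y = x.ofLp ⬝ᵥ y.ofLp := by
    rw [EuclideanSpace.inner_eq_star_dotProduct, dotProduct_comm, star_trivial]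
  have dotProduct_self_le {x : EuclideanSpace ℝ (Fin d)} (hx : ‖x‖ ≤ √(d : ℝ)) :
      x.ofLp ⬝ᵥ x.ofLp ≤ (d : ℝ) ^ 2 := by
    rw [← inner_eq, real_inner_self_eq_norm_sq]
    gcongr
    exact hx.trans ((Real.sqrt_le_left (by positivity)).2 (le_self_pow₀ one_le_dim two_ne_zero))
  have one_le_sqrt : 1 ≤ √(d : ℝ) := Real.one_le_sqrt.2 one_le_dim
  obtain ⟨θ, γ, hθ, hγ, reward_eq, cost_eq⟩ := hE.exists_parameters
  exact
    { exists_parameters := ⟨θ.ofLp, γ.ofLp, dotProduct_self_le (hθ.trans one_le_sqrt),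
        dotProduct_self_le (hγ.trans one_le_sqrt),
        fun a => (congrFun reward_eq a).trans (inner_eq a θ),
        fun a => (congrFun cost_eq a).trans (inner_eq a γ)⟩
      nonempty := hE.nonempty
      isCompact := fun t => (hE.isCompact t).image (PiLp.continuous_ofLp 2 _)
      feat_sq_le := fun t a ha => dotProduct_self_le (hE.norm_le t a ha)
      reward_mem := hE.reward_mem
      cost_mem := hE.cost_mem
      noise := hE.noise }

theorem multiArmedBandit_upper (N : ℕ) (σ : ℝ≥0) (hN : 1 ≤ N) (hσ : 0 < σ) :
    ∃ C : ℝ, ∀ T : ℕ, 1 ≤ T → ∃ π : Policy (Fin N),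
      ∀ E : Environment (Fin N), IsMultiArmedBandit N σ E →
        π.ExpectedRegretLE E T (C * √(T : ℝ) * (1 + Real.log T) ^ 1) := by
  have : Nonempty (Fin N) := ⟨⟨0, hN⟩⟩
  obtain ⟨C, hC⟩ := exists_policy_expectedRegretLE
    (measurable_of_finite fun i : Fin N => (Pi.single i 1 : Fin N → ℝ)) hN hσ
    (R := N) (by exact_mod_cast hN)
  exact ⟨C, fun T hT => (hC T hT).imp fun π hπ E hE => hπ E (hE.isFeatureBandit hN)⟩

theorem linearBandit_upper (d : ℕ) (σ : ℝ≥0) (hd : 1 ≤ d) (hσ : 0 < σ) :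
    ∃ C : ℝ, ∀ T : ℕ, 1 ≤ T → ∃ π : Policy (EuclideanSpace ℝ (Fin d)),
      ∀ E : Environment (EuclideanSpace ℝ (Fin d)), IsLinearBandit d σ E →
        π.ExpectedRegretLE E T (C * √(T : ℝ) * (1 + Real.log T) ^ 1) := by
  obtain ⟨C, hC⟩ := exists_policy_expectedRegretLE (PiLp.continuous_ofLp 2 _).measurable hd hσ
    (R := d) (by exact_mod_cast hd)
  exact ⟨C, fun T hT => (hC T hT).imp fun π hπ E hE => hπ E (hE.isFeatureBandit hd)⟩

end Upper

/-! ### Change of measure for Gaussian noise -/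

theorem isSubgaussianNoise_gaussianReal (σ : ℝ≥0) :
    IsSubgaussianNoise σ (gaussianReal 0 (σ ^ 2)) where
  isProbabilityMeasure := inferInstance
  centered := integral_id_gaussianReal
  subgaussian :=
    ⟨fun t => integrable_exp_mul_gaussianReal t, fun t => by
      rw [mgf_fun_id_gaussianReal]
      simp⟩

theorem lintegral_mul_sq_le {Ω : Type*} [MeasurableSpace Ω] {μ : Measure Ω} {f g : Ω → ENNReal}
    (hf : AEMeasurable f μ) (hg : AEMeasurable g μ) :
    (∫⁻ ω, f ω * g ω ∂μ) ^ 2 ≤ (∫⁻ ω, f ω ^ 2 ∂μ) * ∫⁻ ω, g ω ^ 2 ∂μ := by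
  have holder := ENNReal.lintegral_mul_le_Lp_mul_Lq μ Real.HolderConjugate.two_two hf hg
  simp only [ENNReal.rpow_two, Pi.mul_apply] at holder
  have sqrt_sq (x : ENNReal) : (x ^ (1 / 2 : ℝ)) ^ 2 = x := by
    rw [← ENNReal.rpow_natCast, ← ENNReal.rpow_mul]
    norm_num
  calc (∫⁻ ω, f ω * g ω ∂μ) ^ 2
      ≤ ((∫⁻ ω, f ω ^ 2 ∂μ) ^ (1 / 2 : ℝ) * (∫⁻ ω, g ω ^ 2 ∂μ) ^ (1 / 2 : ℝ)) ^ 2 :=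
        pow_le_pow_left₀ zero_le holder 2
    _ = (∫⁻ ω, f ω ^ 2 ∂μ) * ∫⁻ ω, g ω ^ 2 ∂μ := by rw [mul_pow, sqrt_sq, sqrt_sq]

section GaussianShift

/-- The density at `z` of `gaussianReal Δ v` with respect to `gaussianReal 0 v`. -/
noncomputable def shiftDensity (v : ℝ≥0) (Δ z : ℝ) : ENNReal :=
  ENNReal.ofReal (Real.exp (Δ * z / v - Δ ^ 2 / (2 * v)))

variable {v : ℝ≥0}

theorem measurable_shiftDensity (v : ℝ≥0) (Δ : ℝ) : Measurable (shiftDensity v Δ) := by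
  unfold shiftDensity
  fun_prop

theorem gaussianPDF_mul_shiftDensity (hv : v ≠ 0) (Δ z : ℝ) :
    gaussianPDF 0 v z * shiftDensity v Δ z = gaussianPDF Δ v z := by
  have : (v : ℝ) ≠ 0 := NNReal.coe_ne_zero.2 hv
  rw [gaussianPDF, shiftDensity, ← ENNReal.ofReal_mul (gaussianPDFReal_nonneg _ _ _), gaussianPDF,
    gaussianPDFReal, gaussianPDFReal, mul_assoc (√(2 * Real.pi * v))⁻¹, ← Real.exp_add]
  congr 3
  field_simp
  ring

theorem lintegral_const_add_gaussianReal (hv : v ≠ 0) (Δ : ℝ) {f : ℝ → ENNReal}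
    (hf : Measurable f) :
    ∫⁻ z, f (Δ + z) ∂(gaussianReal 0 v) = ∫⁻ z, shiftDensity v Δ z * f z ∂(gaussianReal 0 v) := by
  calc ∫⁻ z, f (Δ + z) ∂(gaussianReal 0 v)
      = ∫⁻ z, f z ∂(gaussianReal Δ v) := by
        rw [← lintegral_map hf (by fun_prop), gaussianReal_map_const_add, zero_add]
    _ = ∫⁻ z, gaussianPDF Δ v z * f z := by
        rw [gaussianReal_of_var_ne_zero _ hv,
          lintegral_withDensity_eq_lintegral_mul _ (measurable_gaussianPDF _ _) hf]
        rfl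
    _ = ∫⁻ z, gaussianPDF 0 v z * (shiftDensity v Δ z * f z) := by
        simp only [← mul_assoc, gaussianPDF_mul_shiftDensity hv]
    _ = ∫⁻ z, shiftDensity v Δ z * f z ∂(gaussianReal 0 v) := by
        rw [gaussianReal_of_var_ne_zero _ hv,
          lintegral_withDensity_eq_lintegral_mul _ (measurable_gaussianPDF _ _)
            (g := fun z => shiftDensity v Δ z * f z) ((measurable_shiftDensity v Δ).mul hf)]
        rfl

theorem lintegral_shiftDensity_sq (hv : v ≠ 0) (Δ : ℝ) :
    ∫⁻ z, shiftDensity v Δ z ^ 2 ∂(gaussianReal 0 v) = ENNReal.ofReal (Real.exp (Δ ^ 2 / v)) := by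
  have : (v : ℝ) ≠ 0 := NNReal.coe_ne_zero.2 hv
  have sq_eq (z : ℝ) : shiftDensity v Δ z ^ 2 =
      ENNReal.ofReal (Real.exp (-(Δ ^ 2 / v))) * ENNReal.ofReal (Real.exp (2 * Δ / v * z)) := by
    rw [shiftDensity, ← ENNReal.ofReal_pow (Real.exp_pos _).le,
      ← ENNReal.ofReal_mul (Real.exp_pos _).le, ← Real.exp_add, ← Real.exp_nat_mul]
    congr 2
    field_simp
    push_cast
    ring
  simp_rw [sq_eq]
  rw [lintegral_const_mul _ (by fun_prop), lintegral_exp_mul_gaussianReal,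
    ← ENNReal.ofReal_mul (Real.exp_pos _).le, ← Real.exp_add]
  congr 2
  field_simp
  ring

theorem lintegral_const_add_gaussianReal_sq_le (hv : v ≠ 0) {Δ δ : ℝ} (hΔ : |Δ| ≤ δ)
    {f : ℝ → ENNReal} (hf : Measurable f) :
    (∫⁻ z, f (Δ + z) ∂(gaussianReal 0 v)) ^ 2 ≤
      ENNReal.ofReal (Real.exp (δ ^ 2 / v)) * ∫⁻ z, f z ^ 2 ∂(gaussianReal 0 v) := by
  rw [lintegral_const_add_gaussianReal hv Δ hf]
  refine (lintegral_mul_sq_le (measurable_shiftDensity v Δ).aemeasurable hf.aemeasurable).trans ?_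
  rw [lintegral_shiftDensity_sq hv]
  gcongr ENNReal.ofReal (Real.exp (?_ / v)) * _
  exact sq_le_sq.2 (hΔ.trans (le_abs_self δ))

end GaussianShift

namespace Policy

section Record

variable {α : Type} [MeasurableSpace α] {π : Policy α} {E : Environment α} {ag : Agent α} {t : ℕ}

theorem measurable_contract_apply (π : Policy α) (t : ℕ) (S : Fin (t + 1) → Set α) (a : α) :
    Measurable fun p : ℝ × (Fin t → α × ℝ) => π.contract t S p.1 p.2 a :=
  (π.measurable_contract t S).comp (measurable_id.prodMk measurable_const)

/-- What the principal knows when she posts the contract of round `t`: the seed and the history. -/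
def record (π : Policy α) (E : Environment α) (ag : Agent α) (t : ℕ) (ω : ℝ × (ℕ → ℝ)) :
    ℝ × (Fin t → α × ℝ) :=
  (ω.1, π.history E ag ω t)

/-- The agent's action in round `t` as a function of the principal's record. -/
def choice (π : Policy α) (E : Environment α) (ag : Agent α) (t : ℕ) (p : ℝ × (Fin t → α × ℝ)) :
    α :=
  ag t (π.contract t (fun s => E.actionSet s) p.1 p.2)

/-- The record `p` extended by a round in which the noise is `z`. -/
def extend (π : Policy α) (E : Environment α) (ag : Agent α) (t : ℕ) (p : ℝ × (Fin t → α × ℝ))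
    (z : ℝ) : ℝ × (Fin (t + 1) → α × ℝ) :=
  (p.1, Fin.snoc (α := fun _ => α × ℝ) p.2
    (π.choice E ag t p, E.reward (π.choice E ag t p) + z))

theorem record_succ (ω : ℝ × (ℕ → ℝ)) :
    π.record E ag (t + 1) ω = π.extend E ag t (π.record E ag t ω) (ω.2 t) := rfl

theorem record_resample (ω : ℝ × (ℕ → ℝ)) (z : ℝ) :
    π.record E ag t (resample t ω z) = π.record E ag t ω :=
  Prod.ext rfl (history_resample le_rfl ω z)

theorem measurable_extend (hE : Measurable E.reward) (h_choice : Measurable (π.choice E ag t)) :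
    Measurable fun q : (ℝ × (Fin t → α × ℝ)) × ℝ => π.extend E ag t q.1 q.2 := by
  refine measurable_fst.fst.prodMk (measurable_pi_lambda _ fun i => ?_)
  refine Fin.lastCases ?_ (fun i => ?_) i
  · simp only [Fin.snoc_last]
    fun_prop
  · simp only [Fin.snoc_castSucc]
    fun_prop

theorem measurable_record (hE : Measurable E.reward)
    (h_choice : ∀ t, Measurable (π.choice E ag t)) (t : ℕ) : Measurable (π.record E ag t) := by
  induction t with
  | zero => exact measurable_fst.prodMk (measurable_pi_lambda _ fun i => i.elim0)
  | succ t ih =>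
    exact (measurable_extend hE (h_choice t)).comp
      (ih.prodMk ((measurable_pi_apply t).comp measurable_snd))

theorem measurable_action (hE : Measurable E.reward)
    (h_choice : ∀ t, Measurable (π.choice E ag t)) (t : ℕ) : Measurable (π.action E ag t) :=
  (h_choice t).comp (measurable_record hE h_choice t)

theorem lintegral_record_succ [IsProbabilityMeasure E.noise] (hE : Measurable E.reward)
    (h_choice : ∀ t, Measurable (π.choice E ag t)) (t : ℕ)
    {f : ℝ × (Fin (t + 1) → α × ℝ) → ENNReal} (hf : Measurable f) :
    ∫⁻ ω, f (π.record E ag (t + 1) ω) ∂(π.law E) =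
      ∫⁻ ω, ∫⁻ z, f (π.extend E ag t (π.record E ag t ω) z) ∂E.noise ∂(π.law E) := by
  rw [π.lintegral_law_resample E t (G := fun ω => f (π.record E ag (t + 1) ω))
    (hf.comp (measurable_record hE h_choice (t + 1)))]
  simp only [record_succ, record_resample]
  simp only [resample, Function.update_self]

end Record

end Policy

section GaussianBandit

variable {α : Type}

/-- The bandit problem with actions `S` in each round and Gaussian noise of variance `v`. -/
noncomputable def gaussianBandit (S : Set α) (r c : α → ℝ) (v : ℝ≥0) : Environment α :=
  ⟨fun _ => S, r, c, gaussianReal 0 v⟩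

instance (S : Set α) (r c : α → ℝ) (v : ℝ≥0) :
    IsProbabilityMeasure (gaussianBandit S r c v).noise :=
  inferInstanceAs (IsProbabilityMeasure (gaussianReal 0 v))

variable [MeasurableSpace α] {π : Policy α} {S : Set α} {r₀ r₁ c : α → ℝ} {v : ℝ≥0} {ag : Agent α}
  {δ : ℝ}

theorem lintegral_extend_gaussianBandit_sq_le (hv : v ≠ 0) (hr₀ : Measurable r₀) {t : ℕ}
    (h_choice : Measurable (π.choice (gaussianBandit S r₀ c v) ag t))
    {p : ℝ × (Fin t → α × ℝ)}
    (hδ : |r₁ (π.choice (gaussianBandit S r₀ c v) ag t p) -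
      r₀ (π.choice (gaussianBandit S r₀ c v) ag t p)| ≤ δ)
    {f : ℝ × (Fin (t + 1) → α × ℝ) → ENNReal} (hf : Measurable f) :
    (∫⁻ z, f (π.extend (gaussianBandit S r₁ c v) ag t p z) ∂(gaussianReal 0 v)) ^ 2 ≤
      ENNReal.ofReal (Real.exp (δ ^ 2 / v)) *
        ∫⁻ z, f (π.extend (gaussianBandit S r₀ c v) ag t p z) ^ 2 ∂(gaussianReal 0 v) := by
  have extend_eq (z : ℝ) : π.extend (gaussianBandit S r₁ c v) ag t p z =
      π.extend (gaussianBandit S r₀ c v) ag t p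
        (r₁ (π.choice (gaussianBandit S r₀ c v) ag t p) -
          r₀ (π.choice (gaussianBandit S r₀ c v) ag t p) + z) := by
    simp only [Policy.extend, Policy.choice, gaussianBandit, ← add_assoc, add_sub_cancel]
  simp only [extend_eq]
  exact lintegral_const_add_gaussianReal_sq_le hv hδ
    (f := fun z => f (π.extend (gaussianBandit S r₀ c v) ag t p z))
    (hf.comp ((Policy.measurable_extend hr₀ h_choice).comp measurable_prodMk_left))

theorem lintegral_record_gaussianBandit_sq_le (hv : v ≠ 0) (hr₀ : Measurable r₀)
    (hr₁ : Measurable r₁) (h_choice : ∀ t, Measurable (π.choice (gaussianBandit S r₀ c v) ag t))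
    (h_mem : ∀ t p, π.choice (gaussianBandit S r₀ c v) ag t p ∈ S)
    (hδ : ∀ a ∈ S, |r₁ a - r₀ a| ≤ δ) (t : ℕ) {f : ℝ × (Fin t → α × ℝ) → ENNReal}
    (hf : Measurable f) :
    (∫⁻ ω, f (π.record (gaussianBandit S r₁ c v) ag t ω) ∂(π.law (gaussianBandit S r₁ c v))) ^ 2 ≤
      ENNReal.ofReal (Real.exp (δ ^ 2 / v)) ^ t *
        ∫⁻ ω, f (π.record (gaussianBandit S r₀ c v) ag t ω) ^ 2
          ∂(π.law (gaussianBandit S r₀ c v)) := by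
  set E₀ := gaussianBandit S r₀ c v
  set E₁ := gaussianBandit S r₁ c v
  have h_choice₁ (t : ℕ) : Measurable (π.choice E₁ ag t) := h_choice t
  induction t with
  | zero =>
    have cauchy_schwarz := lintegral_mul_sq_le (μ := π.law E₁) (f := fun _ => 1)
      aemeasurable_const (hf.comp (Policy.measurable_record hr₁ h_choice₁ 0)).aemeasurable
    simp only [one_mul, one_pow, lintegral_one, measure_univ] at cauchy_schwarz
    rw [pow_zero, one_mul]
    exact cauchy_schwarz
  | succ t ih =>
    have measurable_next : Measurable fun p =>
        ∫⁻ z, f (π.extend E₁ ag t p z) ∂(gaussianReal 0 v) :=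
      (hf.comp (Policy.measurable_extend hr₁ (h_choice₁ t))).lintegral_prod_right'
    rw [Policy.lintegral_record_succ hr₁ h_choice₁ t hf,
      Policy.lintegral_record_succ hr₀ h_choice t (hf.pow_const 2),
      pow_succ (ENNReal.ofReal _), mul_assoc,
      ← lintegral_const_mul' _ _ ENNReal.ofReal_ne_top]
    refine (ih measurable_next).trans ?_
    gcongr with ω
    exact lintegral_extend_gaussianBandit_sq_le hv hr₀ (h_choice t) (hδ _ (h_mem t _)) hf

end GaussianBandit

section LexAgent

variable {α : Type} {S : Finset α} {r r' c : α → ℝ}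

/-- An agent who, facing the actions `S`, breaks ties in favor of a principal with rewards `r`. -/
noncomputable def lexAgent [Nonempty α] (S : Finset α) (r c : α → ℝ) : Agent α := fun _ x =>
  chooseIn S fun a => IsMaxOn (lexUtility r c x) S a

variable [Nonempty α]

theorem lexAgent_spec (hS : S.Nonempty) (r c : α → ℝ) (t : ℕ) (x : α → ℝ≥0) :
    lexAgent S r c t x ∈ S ∧ IsMaxOn (lexUtility r c x) S (lexAgent S r c t x) :=
  chooseIn_spec (S.exists_max_image (lexUtility r c x) hS)

variable [MeasurableSpace α]

theorem measurable_lexAgent {Ω : Type*} [MeasurableSpace Ω] (S : Finset α) (r c : α → ℝ) (t : ℕ)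
    {x : Ω → α → ℝ≥0} (hx : ∀ a, Measurable fun ω => x ω a) :
    Measurable fun ω => lexAgent S r c t (x ω) := by
  refine measurable_chooseIn S fun a _ => ?_
  simp only [isMaxOn_iff, Set.ofPred_forall]
  have (a : α) : Measurable fun ω => (x ω a : ℝ) := (hx a).coe_nnreal_real
  exact Finset.measurableSet_biInter _ fun b _ => measurableSet_toLex_le_toLex
    (by fun_prop) (by fun_prop) (by fun_prop) (by fun_prop)

variable {π : Policy α} {v : ℝ≥0}

theorem measurable_choice_lexAgent (t : ℕ) :
    Measurable (π.choice (gaussianBandit S r c v) (lexAgent S r' c) t) :=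
  measurable_lexAgent S r' c t fun a => π.measurable_contract_apply t _ a

theorem measurable_action_lexAgent (hr : Measurable r) (t : ℕ) :
    Measurable (π.action (gaussianBandit S r c v) (lexAgent S r' c) t) :=
  Policy.measurable_action (E := gaussianBandit S r c v) hr measurable_choice_lexAgent t

theorem isBestResponding_lexAgent (hS : S.Nonempty) (hr : Measurable r) (r' : α → ℝ) :
    π.IsBestResponding (gaussianBandit S r c v) (lexAgent S r' c) where
  mem_bestResponses t _ :=
    mem_bestResponses_of_isMaxOn (lexAgent_spec hS r' c t _).1 (lexAgent_spec hS r' c t _).2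
  measurable_action := measurable_action_lexAgent hr

theorem exists_agent_gaussianBandit (hS : S.Nonempty) (hr : Measurable r) :
    ∃ ag, π.IsBestResponding (gaussianBandit S r c v) ag ∧
      π.TiesFavorPrincipal (gaussianBandit S r c v) ag :=
  ⟨lexAgent S r c, Policy.isBestResponding_and_tiesFavorPrincipal (measurable_action_lexAgent hr)
    (fun t _ => (lexAgent_spec hS r c t _).1) fun t _ => (lexAgent_spec hS r c t _).2⟩

end LexAgent

/-! ### Lower bounds -/

namespace Policy

variable {α : Type} [MeasurableSpace α] {π : Policy α} {E : Environment α} {ag ag' : Agent α}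

theorem ExpectedRegretGE.mono {T : ℕ} {B B' : ℝ} (h : π.ExpectedRegretGE E T B') (hB : B ≤ B') :
    π.ExpectedRegretGE E T B :=
  ⟨h.1, fun ag hag h_int => hB.trans (h.2 ag hag h_int)⟩

/- The agent can secure utility zero with the free action `a₀`, so the payment covers his cost. -/
theorem IsBestResponding.welfare_loss_le (h : π.IsBestResponding E ag) {t : ℕ} {a₀ b : α}
    (ha₀ : a₀ ∈ E.actionSet t) (h_free : E.cost a₀ ≤ 0) (hb : b ∈ E.actionSet t)
    (h_bdd : BddAbove (Set.range fun a : E.actionSet t => E.reward a - E.cost a))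
    (ω : ℝ × (ℕ → ℝ)) :
    (E.reward b - E.cost b) - (E.reward (π.action E ag t ω) - E.cost (π.action E ag t ω)) ≤
      (⨆ a : E.actionSet t, (E.reward a - E.cost a)) -
        (E.reward (π.action E ag t ω) - (π.posted E ag t ω (π.action E ag t ω) : ℝ)) := by
  have utility_nonneg := (h.mem_bestResponses t ω).2 a₀ ha₀
  have le_benchmark := le_ciSup h_bdd ⟨b, hb⟩
  have : (0 : ℝ) ≤ π.posted E ag t ω a₀ := NNReal.coe_nonneg _
  dsimp only at le_benchmark
  linarith

/-- The probability that the agent takes an action in `B` in round `t`. -/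
noncomputable def actionProb (π : Policy α) (E : Environment α) (ag : Agent α) (t : ℕ)
    (B : Set α) : ℝ :=
  (π.law E).real {ω | π.action E ag t ω ∈ B}

theorem actionProb_le_one [IsProbabilityMeasure E.noise] (t : ℕ) (B : Set α) :
    π.actionProb E ag t B ≤ 1 :=
  measureReal_le_one

theorem actionProb_compl [IsProbabilityMeasure E.noise] {t : ℕ}
    (h_action : Measurable (π.action E ag t)) {B : Set α} (hB : MeasurableSet B) :
    π.actionProb E ag t Bᶜ = 1 - π.actionProb E ag t B :=
  probReal_compl_eq_one_sub (h_action hB)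

theorem IsBestResponding.le_integral_regret [IsProbabilityMeasure E.noise]
    (h : π.IsBestResponding E ag) {a₀ b : α} (ha₀ : ∀ t, a₀ ∈ E.actionSet t)
    (h_free : E.cost a₀ ≤ 0) (hb : ∀ t, b ∈ E.actionSet t)
    (h_bdd : ∀ t, BddAbove (Set.range fun a : E.actionSet t => E.reward a - E.cost a))
    {B : Set α} (hB : MeasurableSet B) {ε : ℝ}
    (h_loss : ∀ t, ∀ a ∈ E.actionSet t, B.indicator (fun _ => ε) a ≤
      (E.reward b - E.cost b) - (E.reward a - E.cost a))
    {T : ℕ} (h_int : Integrable (π.regret E ag T) (π.law E)) :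
    ε * ∑ t ∈ Finset.range T, π.actionProb E ag t B ≤ ∫ ω, π.regret E ag T ω ∂(π.law E) := by
  have measurableSet_mem (t : ℕ) : MeasurableSet {ω | π.action E ag t ω ∈ B} :=
    h.measurable_action t hB
  have integrable_loss (t : ℕ) (_ : t ∈ Finset.range T) :
      Integrable ({ω | π.action E ag t ω ∈ B}.indicator fun _ => ε) (π.law E) :=
    (integrable_const ε).indicator (measurableSet_mem t)
  calc ε * ∑ t ∈ Finset.range T, π.actionProb E ag t B
      = ∫ ω, ∑ t ∈ Finset.range T, {ω | π.action E ag t ω ∈ B}.indicator (fun _ => ε) ω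
          ∂(π.law E) := by
        rw [integral_finsetSum _ integrable_loss, Finset.mul_sum]
        refine Finset.sum_congr rfl fun t _ => ?_
        rw [integral_indicator_const _ (measurableSet_mem t), smul_eq_mul, mul_comm, actionProb]
    _ ≤ ∫ ω, π.regret E ag T ω ∂(π.law E) :=
        integral_mono (integrable_finsetSum _ integrable_loss) h_int fun ω =>
          Finset.sum_le_sum fun t _ =>
            (h_loss t _ (h.mem_bestResponses t ω).1).trans
              (h.welfare_loss_le (ha₀ t) h_free (hb t) (h_bdd t) ω)

theorem actionProb_sq_le {S : Set α} {r₀ r₁ c : α → ℝ} {v : ℝ≥0} (hv : v ≠ 0)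
    (hr₀ : Measurable r₀) (hr₁ : Measurable r₁)
    (h_choice : ∀ t, Measurable (π.choice (gaussianBandit S r₀ c v) ag t))
    (h_mem : ∀ t p, π.choice (gaussianBandit S r₀ c v) ag t p ∈ S) {δ : ℝ}
    (hδ : ∀ a ∈ S, |r₁ a - r₀ a| ≤ δ) (t : ℕ) {B : Set α} (hB : MeasurableSet B) :
    π.actionProb (gaussianBandit S r₁ c v) ag t B ^ 2 ≤
      Real.exp (δ ^ 2 / v) ^ t * π.actionProb (gaussianBandit S r₀ c v) ag t B := by
  set choice := π.choice (gaussianBandit S r₀ c v) ag t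
  have lintegral_eq {r : α → ℝ} (hr : Measurable r) :
      ∫⁻ ω, B.indicator 1 (choice (π.record (gaussianBandit S r c v) ag t ω))
          ∂(π.law (gaussianBandit S r c v)) =
        π.law (gaussianBandit S r c v) {ω | π.action (gaussianBandit S r c v) ag t ω ∈ B} :=
    lintegral_indicator_one (measurable_action (E := gaussianBandit S r c v) hr h_choice t hB)
  have indicator_sq (a : α) : B.indicator (1 : α → ENNReal) a ^ 2 = B.indicator 1 a := by
    by_cases ha : a ∈ B <;> simp [ha]
  have sq_le := lintegral_record_gaussianBandit_sq_le hv hr₀ hr₁ h_choice h_mem hδ t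
    (f := fun p => B.indicator 1 (choice p)) ((measurable_one.indicator hB).comp (h_choice t))
  simp only [indicator_sq] at sq_le
  rw [lintegral_eq hr₀, lintegral_eq hr₁] at sq_le
  have real_sq_le := ENNReal.toReal_mono (ENNReal.mul_ne_top (by simp) (measure_ne_top _ _)) sq_le
  simpa only [actionProb, Measure.real, ENNReal.toReal_pow, ENNReal.toReal_mul,
    ENNReal.toReal_ofReal (Real.exp_pos _).le] using real_sq_le

end Policy

/-! ### Ties have probability zero -/

namespace Policy

section Ties

variable {α : Type} [MeasurableSpace α] {π : Policy α} {S : Finset α} {r q : α → ℝ} {v : ℝ≥0}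
  {ag ag' : Agent α}

theorem history_eq (π : Policy α) (E : Environment α) (ag : Agent α) (ω : ℝ × (ℕ → ℝ)) (t : ℕ) :
    π.history E ag ω t =
      fun i : Fin t => (π.action E ag i ω, E.reward (π.action E ag i ω) + ω.2 i) := by
  induction t with
  | zero => exact funext fun i => i.elim0
  | succ t ih =>
    rw [history_succ]
    funext i
    refine Fin.lastCases ?_ (fun i => ?_) i
    · simp only [Fin.snoc_last, Fin.val_last]
    · simp only [Fin.snoc_castSucc, ih, Fin.val_castSucc]

/-- The contract that follows the actions `y` when all of `S` is available in each round and the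
mean rewards are `r`. Unlike the posted contract, it does not involve an agent. -/
def contractAfter (π : Policy α) (S : Finset α) (r : α → ℝ) {t : ℕ} (y : Fin t → S)
    (ω : ℝ × (ℕ → ℝ)) : α → ℝ≥0 :=
  π.contract t (fun _ => S) ω.1 fun i => ((y i : α), r (y i) + ω.2 i)

theorem measurable_contractAfter (π : Policy α) (S : Finset α) (r : α → ℝ) {t : ℕ}
    (y : Fin t → S) (a : α) : Measurable fun ω => π.contractAfter S r y ω a := by
  refine (π.measurable_contract_apply t (fun _ => S) a).comp
    (measurable_fst.prodMk (measurable_pi_lambda _ fun i => ?_))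
  fun_prop

theorem posted_eq_contractAfter {c : α → ℝ} {t : ℕ} {ω : ℝ × (ℕ → ℝ)}
    (h_mem : ∀ s, π.action (gaussianBandit S r c v) ag s ω ∈ S) :
    π.posted (gaussianBandit S r c v) ag t ω =
      π.contractAfter S r (fun i : Fin t => ⟨_, h_mem i⟩) ω := by
  rw [posted, history_eq]
  rfl

/-- The scales `s` for which, with the costs `s • q`, some pair of actions is tied with positive
probability after some sequence of actions. -/
def tieScales (π : Policy α) (S : Finset α) (r q : α → ℝ) (v : ℝ≥0) : Set ℝ :=
  {s | ∃ (t : ℕ) (y : Fin t → S) (a b : S),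
    0 < π.law (gaussianBandit S r q v)
      {ω | ((π.contractAfter S r y ω a : ℝ) - π.contractAfter S r y ω b) / (q a - q b) = s}}

/- Distinct scales yield disjoint tie events, only countably many of which have positive
probability. -/
theorem countable_tieScales (π : Policy α) (S : Finset α) (r q : α → ℝ) (v : ℝ≥0) :
    (π.tieScales S r q v).Countable := by
  simp only [tieScales, Set.ofPred_exists]
  refine Set.countable_iUnion fun t => Set.countable_iUnion fun y => Set.countable_iUnion fun a =>
    Set.countable_iUnion fun b => Measure.countable_meas_level_set_pos ?_
  exact ((π.measurable_contractAfter S r y a).coe_nnreal_real.sub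
    (π.measurable_contractAfter S r y b).coe_nnreal_real).div_const _

theorem ae_ne_of_notMem_tieScales {s : ℝ} (hs : s ∉ π.tieScales S r q v) :
    ∀ᵐ ω ∂(π.law (gaussianBandit S r (s • q) v)), ∀ (t : ℕ) (y : Fin t → S) (a b : S),
      ((π.contractAfter S r y ω a : ℝ) - π.contractAfter S r y ω b) / (q a - q b) ≠ s := by
  simp only [ae_all_iff]
  intro t y a b
  refine ae_iff.2 (not_not.1 fun h_pos => hs ⟨t, y, a, b, pos_iff_ne_zero.2 ?_⟩)
  simp only [ne_eq, not_not] at h_pos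
  exact h_pos

theorem ae_action_eq (hq : Set.InjOn q S) {s : ℝ} (hs : s ∉ π.tieScales S r q v)
    (h : π.IsBestResponding (gaussianBandit S r (s • q) v) ag)
    (h' : π.IsBestResponding (gaussianBandit S r (s • q) v) ag') :
    ∀ᵐ ω ∂(π.law (gaussianBandit S r (s • q) v)), ∀ t,
      π.action (gaussianBandit S r (s • q) v) ag t ω =
        π.action (gaussianBandit S r (s • q) v) ag' t ω := by
  set E := gaussianBandit S r (s • q) v with hE
  filter_upwards [ae_ne_of_notMem_tieScales hs] with ω no_tie t
  induction t using Nat.strong_induction_on with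
  | _ t ih =>
    have posted_eq : π.posted E ag t ω = π.posted E ag' t ω := by
      simp only [posted, history_eq]
      congr 1
      funext i
      rw [ih i i.2]
    have mem_S (n : ℕ) : π.action E ag n ω ∈ S := (h.mem_bestResponses n ω).1
    obtain ⟨mem, max⟩ := h.mem_bestResponses t ω
    obtain ⟨mem', max'⟩ := h'.mem_bestResponses t ω
    rw [← posted_eq] at max'
    rw [posted_eq_contractAfter mem_S] at max max'
    by_contra h_ne
    refine no_tie t (fun i : Fin t => ⟨_, mem_S i⟩) ⟨_, mem⟩ ⟨_, mem'⟩
      ((div_eq_iff (sub_ne_zero.2 fun h_eq => h_ne (hq mem mem' h_eq))).2 ?_)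
    have utility_le := max _ mem'
    have utility_ge := max' _ mem
    simp only [hE, gaussianBandit, Pi.smul_apply, smul_eq_mul] at utility_le utility_ge ⊢
    linarith

theorem actionProb_eq (hq : Set.InjOn q S) {s : ℝ} (hs : s ∉ π.tieScales S r q v)
    (h : π.IsBestResponding (gaussianBandit S r (s • q) v) ag)
    (h' : π.IsBestResponding (gaussianBandit S r (s • q) v) ag') (t : ℕ) (B : Set α) :
    π.actionProb (gaussianBandit S r (s • q) v) ag t B =
      π.actionProb (gaussianBandit S r (s • q) v) ag' t B := by
  refine measureReal_congr ?_
  filter_upwards [ae_action_eq hq hs h h'] with ω action_eq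
  exact congrArg (· ∈ B) (action_eq t)

end Ties

end Policy

/-! ### The hard instances -/

theorem exists_gap {σ : ℝ≥0} (hσ : 0 < σ) {T : ℕ} (hT : 1 ≤ T) :
    ∃ δ : ℝ, 0 < δ ∧ δ ≤ 1 / 2 ∧ δ * T = min (σ : ℝ) (1 / 2) * √(T : ℝ) ∧ δ ^ 2 * T ≤ σ ^ 2 := by
  have one_le_sqrt : 1 ≤ √(T : ℝ) := Real.one_le_sqrt.2 (by exact_mod_cast hT)
  have sq_sqrt : √(T : ℝ) ^ 2 = T := Real.sq_sqrt (Nat.cast_nonneg T)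
  have : (0 : ℝ) < σ := hσ
  have min_pos : 0 < min (σ : ℝ) (1 / 2) := by positivity
  refine ⟨min (σ : ℝ) (1 / 2) / √T, by positivity,
    (div_le_self min_pos.le one_le_sqrt).trans (min_le_right _ _), ?_, ?_⟩
  · nth_rw 2 [← sq_sqrt]
    field_simp
  · rw [div_pow, sq_sqrt, div_mul_cancel₀ _ (by positivity)]
    exact pow_le_pow_left₀ min_pos.le (min_le_left _ _) 2

theorem quarter_mul_le_sum_add_sum {p p' : ℕ → ℝ} {T : ℕ} (hp : ∀ t < T, p t ≤ 1)
    (h_sq : ∀ t < T, p t ^ 2 ≤ 4 * p' t) :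
    (T : ℝ) / 4 ≤ ∑ t ∈ Finset.range T, (1 - p t) + ∑ t ∈ Finset.range T, p' t := by
  have quarter_le (t : ℕ) (ht : t ∈ Finset.range T) : (1 / 4 : ℝ) ≤ 1 - p t + p' t := by
    have := hp t (Finset.mem_range.1 ht)
    have := h_sq t (Finset.mem_range.1 ht)
    nlinarith
  calc (T : ℝ) / 4 = ∑ _t ∈ Finset.range T, (1 / 4 : ℝ) := by simp [div_eq_mul_inv]
    _ ≤ ∑ t ∈ Finset.range T, (1 - p t + p' t) := Finset.sum_le_sum quarter_le
    _ = _ := Finset.sum_add_distrib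

/-- The data of the hard instances, whose rewards are `u • w` and whose costs are `s • q`: the
principal gains from `a₁` alone, which is worth `u - s`, and the action `a₀` is free. Costs are
distinct, so that changing the scale `s` destroys ties. -/
structure IsHardFamily {α : Type} [MeasurableSpace α] (S : Finset α) (w q : α → ℝ) (a₀ a₁ : α) :
    Prop where
  measurable_reward : Measurable w
  injOn_cost : Set.InjOn q S
  cost_nonneg : ∀ a ∈ S, 0 ≤ q a
  mem_free : a₀ ∈ S
  mem_good : a₁ ∈ S
  cost_free : q a₀ = 0
  cost_good : q a₁ = 1
  reward_good : w a₁ = 1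
  reward_of_ne : ∀ a ∈ S, a ≠ a₁ → w a = 0

namespace IsHardFamily

variable {α : Type} [MeasurableSpace α] {π : Policy α} {S : Finset α} {w q : α → ℝ} {a₀ a₁ : α}
  {v : ℝ≥0}

theorem free_ne_good (H : IsHardFamily S w q a₀ a₁) : a₀ ≠ a₁ := by
  rintro rfl
  exact zero_ne_one (H.cost_free.symm.trans H.cost_good)

theorem welfare_le_zero (H : IsHardFamily S w q a₀ a₁) (u : ℝ) {s : ℝ} (hs : 0 ≤ s) {a : α}
    (ha : a ∈ S) (h_ne : a ≠ a₁) : u * w a - s * q a ≤ 0 := by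
  rw [H.reward_of_ne a ha h_ne, mul_zero, zero_sub, neg_nonpos]
  exact mul_nonneg hs (H.cost_nonneg a ha)

variable [Nonempty α]

theorem expectedRegretGE (H : IsHardFamily S w q a₀ a₁) {u s : ℝ}
    (h_tie : s ∉ π.tieScales S (u • w) q v) {b : α} (hb : b ∈ S) {B : Set α}
    (hB : MeasurableSet B) {ε : ℝ}
    (h_loss : ∀ a ∈ S, B.indicator (fun _ => ε) a ≤
      (u * w b - s * q b) - (u * w a - s * q a)) (T : ℕ) :
    π.ExpectedRegretGE (gaussianBandit S (u • w) (s • q) v) T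
      (ε * ∑ t ∈ Finset.range T,
        π.actionProb (gaussianBandit S (u • w) (s • q) v) (lexAgent S 0 (s • q)) t B) := by
  have hS : S.Nonempty := ⟨a₀, H.mem_free⟩
  have measurable_reward := H.measurable_reward.const_smul u
  refine ⟨exists_agent_gaussianBandit hS measurable_reward, fun ag hag h_int => ?_⟩
  simp only [Policy.actionProb_eq H.injOn_cost h_tie
    (isBestResponding_lexAgent hS measurable_reward 0) hag]
  refine hag.le_integral_regret (fun _ => H.mem_free) ?_ (fun _ => hb)
    (fun _ => (S.finite_toSet.image _).bddAbove.mono (Set.range_subset_iff.2 fun a =>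
      Set.mem_image_of_mem (fun a => u * w a - s * q a) a.2)) hB (fun _ => h_loss) h_int
  simp [gaussianBandit, H.cost_free]

variable [MeasurableSingletonClass α]

theorem expectedRegretGE_of_le_gain (H : IsHardFamily S w q a₀ a₁) {u s : ℝ} (hs : 0 ≤ s)
    (h_tie : s ∉ π.tieScales S (u • w) q v) {ε : ℝ} (hε : ε ≤ u - s) (T : ℕ) :
    π.ExpectedRegretGE (gaussianBandit S (u • w) (s • q) v) T
      (ε * ∑ t ∈ Finset.range T, (1 - π.actionProb (gaussianBandit S (u • w) (s • q) v)
        (lexAgent S 0 (s • q)) t {a₁})) := by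
  simp only [← Policy.actionProb_compl
    (measurable_action_lexAgent (H.measurable_reward.const_smul u) _) (measurableSet_singleton a₁)]
  refine H.expectedRegretGE h_tie H.mem_good (measurableSet_singleton a₁).compl (fun a ha => ?_) T
  rw [H.reward_good, H.cost_good]
  rcases eq_or_ne a a₁ with rfl | h_ne
  · simp [H.reward_good, H.cost_good]
  · rw [Set.indicator_of_mem h_ne]
    linarith [H.welfare_le_zero u hs ha h_ne]

theorem expectedRegretGE_of_le_loss (H : IsHardFamily S w q a₀ a₁) {u s : ℝ} (hs : 0 ≤ s)
    (h_tie : s ∉ π.tieScales S (u • w) q v) {ε : ℝ} (hε : ε ≤ s - u) (T : ℕ) :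
    π.ExpectedRegretGE (gaussianBandit S (u • w) (s • q) v) T
      (ε * ∑ t ∈ Finset.range T, π.actionProb (gaussianBandit S (u • w) (s • q) v)
        (lexAgent S 0 (s • q)) t {a₁}) := by
  refine H.expectedRegretGE h_tie H.mem_free (measurableSet_singleton a₁) (fun a ha => ?_) T
  rw [H.cost_free, H.reward_of_ne a₀ H.mem_free H.free_ne_good]
  rcases eq_or_ne a a₁ with rfl | h_ne
  · rw [Set.indicator_of_mem (Set.mem_singleton a), H.reward_good, H.cost_good]
    linarith
  · rw [Set.indicator_of_notMem (Set.mem_singleton_iff.not.2 h_ne)]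
    linarith [H.welfare_le_zero u hs ha h_ne]

/- The agent of the change of measure must choose by the same rule under both reward functions,
so he breaks ties by a fixed one. -/
theorem actionProb_sq_le (H : IsHardFamily S w q a₀ a₁) (hv : v ≠ 0) (u : ℝ) {δ : ℝ} (hδ : 0 ≤ δ)
    (c : α → ℝ) {T : ℕ} (h_gap : δ ^ 2 * T ≤ v) {t : ℕ} (ht : t < T) :
    π.actionProb (gaussianBandit S ((u + δ) • w) c v) (lexAgent S 0 c) t {a₁} ^ 2 ≤
      4 * π.actionProb (gaussianBandit S (u • w) c v) (lexAgent S 0 c) t {a₁} := by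
  have reward_close (a : α) (ha : a ∈ S) : |((u + δ) • w) a - (u • w) a| ≤ δ := by
    rw [← Pi.sub_apply, ← sub_smul, add_sub_cancel_left, Pi.smul_apply, smul_eq_mul, abs_mul,
      abs_of_nonneg hδ]
    rcases eq_or_ne a a₁ with rfl | h_ne
    · rw [H.reward_good, abs_one, mul_one]
    · rw [H.reward_of_ne a ha h_ne, abs_zero, mul_zero]
      exact hδ
  refine (Policy.actionProb_sq_le hv (H.measurable_reward.const_smul u)
    (H.measurable_reward.const_smul (u + δ)) measurable_choice_lexAgent
    (fun t _ => (lexAgent_spec ⟨a₀, H.mem_free⟩ 0 c t _).1) reward_close t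
    (measurableSet_singleton a₁)).trans (mul_le_mul_of_nonneg_right ?_ measureReal_nonneg)
  have exponent_le_one : t * (δ ^ 2 / v) ≤ 1 := by
    have : (0 : ℝ) < v := NNReal.coe_pos.2 (pos_iff_ne_zero.2 hv)
    rw [← mul_div_assoc, div_le_one this, mul_comm]
    refine le_trans ?_ h_gap
    gcongr
  calc Real.exp (δ ^ 2 / v) ^ t = Real.exp (t * (δ ^ 2 / v)) := (Real.exp_nat_mul _ _).symm
    _ ≤ Real.exp 1 := Real.exp_le_exp.2 exponent_le_one
    _ ≤ 4 := by linarith [Real.exp_one_lt_d9]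

theorem exists_expectedRegretGE (H : IsHardFamily S w q a₀ a₁) {σ : ℝ≥0} (hσ : 0 < σ)
    (π : Policy α) {T : ℕ} (hT : 1 ≤ T) :
    ∃ u ∈ Set.Icc (0 : ℝ) 1, ∃ s ∈ Set.Icc (0 : ℝ) 1,
      π.ExpectedRegretGE (gaussianBandit S (u • w) (s • q) (σ ^ 2)) T
        (min (σ : ℝ) (1 / 2) / 24 * √(T : ℝ)) := by
  obtain ⟨δ, δ_pos, δ_le, gap_mul, gap_sq⟩ := exists_gap hσ hT
  obtain ⟨s, h_tie, s_lower, s_upper⟩ :=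
    (((π.countable_tieScales S ((1 / 2 + δ) • w) q (σ ^ 2)).union
      (π.countable_tieScales S ((1 / 2 : ℝ) • w) q (σ ^ 2))).dense_compl ℝ).exists_between
        (show 1 / 2 + δ / 3 < 1 / 2 + 2 * δ / 3 by linarith)
  rw [Set.mem_compl_iff, Set.mem_union, not_or] at h_tie
  have s_mem : s ∈ Set.Icc (0 : ℝ) 1 := ⟨by linarith, by linarith⟩
  set p : ℝ → ℕ → ℝ := fun u t => π.actionProb (gaussianBandit S (u • w) (s • q) (σ ^ 2))
    (lexAgent S 0 (s • q)) t {a₁}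
  have sum_le : (T : ℝ) / 4 ≤
      ∑ t ∈ Finset.range T, (1 - p (1 / 2 + δ) t) + ∑ t ∈ Finset.range T, p (1 / 2) t :=
    quarter_mul_le_sum_add_sum (fun t _ => Policy.actionProb_le_one t _) fun t ht =>
      H.actionProb_sq_le (pow_ne_zero 2 hσ.ne') _ δ_pos.le _ (by exact_mod_cast gap_sq) ht
  have le_of_eighth_le {x : ℝ} (hx : T / 8 ≤ x) :
      min (σ : ℝ) (1 / 2) / 24 * √(T : ℝ) ≤ δ / 3 * x := by
    nlinarith
  rcases le_or_gt ((T : ℝ) / 8) (∑ t ∈ Finset.range T, (1 - p (1 / 2 + δ) t)) with h | h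
  · exact ⟨1 / 2 + δ, ⟨by linarith, by linarith⟩, s, s_mem,
      (H.expectedRegretGE_of_le_gain s_mem.1 h_tie.1 (by linarith) T).mono (le_of_eighth_le h)⟩
  · exact ⟨1 / 2, ⟨by norm_num, by norm_num⟩, s, s_mem,
      (H.expectedRegretGE_of_le_loss s_mem.1 h_tie.2 (by linarith) T).mono
        (le_of_eighth_le (by linarith))⟩

end IsHardFamily

theorem multiArmedBandit_lower (N : ℕ) (σ : ℝ≥0) (hN : 2 ≤ N) (hσ : 0 < σ) :
    ∃ c : ℝ, 0 < c ∧ ∀ T : ℕ, 1 ≤ T → ∀ π : Policy (Fin N),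
      ∃ E : Environment (Fin N), IsMultiArmedBandit N σ E ∧
        π.ExpectedRegretGE E T (c * √(T : ℝ)) := by
  have : (0 : ℝ) < σ := hσ
  have : Nonempty (Fin N) := ⟨⟨0, by lia⟩⟩
  refine ⟨min (σ : ℝ) (1 / 2) / 24, by positivity, fun T hT π => ?_⟩
  set w : Fin N → ℝ := fun i => if (i : ℕ) = 1 then 1 else 0 with hw
  set q : Fin N → ℝ := fun i => ((i : ℕ) : ℝ)⁻¹ with hq
  have reward_mem (i : Fin N) : w i ∈ Set.Icc (0 : ℝ) 1 := by
    simp only [hw]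
    split_ifs <;> norm_num
  have cost_mem (i : Fin N) : q i ∈ Set.Icc (0 : ℝ) 1 := ⟨by positivity, Nat.cast_inv_le_one _⟩
  have hard : IsHardFamily Finset.univ w q ⟨0, by lia⟩ ⟨1, by lia⟩ :=
    { measurable_reward := measurable_of_finite w
      injOn_cost := fun i _ j _ hij => Fin.ext (Nat.cast_injective (inv_injective hij))
      cost_nonneg := fun i _ => (cost_mem i).1
      mem_free := Finset.mem_univ _
      mem_good := Finset.mem_univ _
      cost_free := by simp [hq]
      cost_good := by simp [hq]
      reward_good := by simp [hw]
      reward_of_ne := fun i _ hi => if_neg fun h => hi (Fin.ext h) }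
  obtain ⟨u, hu, s, hs, h_regret⟩ := hard.exists_expectedRegretGE hσ π hT
  exact ⟨_, ⟨fun _ => Finset.coe_univ, fun i => unitInterval.mul_mem hu (reward_mem i),
    fun i => unitInterval.mul_mem hs (cost_mem i), isSubgaussianNoise_gaussianReal σ⟩, h_regret⟩

section LinearHardFamily

variable {d : ℕ} {e : EuclideanSpace ℝ (Fin d)}

theorem isHardFamily_inner (he : ‖e‖ = 1) :
    IsHardFamily {0, e} (fun a => inner ℝ a e) (fun a => inner ℝ a e) 0 e where
  measurable_reward := by fun_prop
  injOn_cost := by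
    simp [Set.injOn_pair, he]
  cost_nonneg := by simp
  mem_free := by simp
  mem_good := by simp
  cost_free := inner_zero_left e
  cost_good := by simp [he]
  reward_good := by simp [he]
  reward_of_ne := by simp +contextual

theorem isLinearBandit_gaussianBandit_inner (hd : 1 ≤ d) (he : ‖e‖ = 1) (σ : ℝ≥0) {u s : ℝ}
    (hu : u ∈ Set.Icc (0 : ℝ) 1) (hs : s ∈ Set.Icc (0 : ℝ) 1) :
    IsLinearBandit d σ (gaussianBandit (({0, e} : Finset _) : Set (EuclideanSpace ℝ (Fin d)))
      (u • fun a => inner ℝ a e) (s • fun a => inner ℝ a e) (σ ^ 2)) := by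
  have norm_smul_le {x : ℝ} (hx : x ∈ Set.Icc (0 : ℝ) 1) : ‖x • e‖ ≤ 1 := by
    rw [norm_smul, he, mul_one, Real.norm_of_nonneg hx.1]
    exact hx.2
  have smul_inner (x : ℝ) : (x • fun a => inner ℝ a e) = fun a => inner ℝ a (x • e) :=
    funext fun a => (inner_smul_right a e x).symm
  have smul_inner_mem {x : ℝ} (hx : x ∈ Set.Icc (0 : ℝ) 1) (_ : ℕ)
      (a : EuclideanSpace ℝ (Fin d)) (ha : a ∈ (({0, e} : Finset _) : Set _)) :
      (x • fun a => inner ℝ a e) a ∈ Set.Icc (0 : ℝ) 1 := by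
    rcases (by simpa using ha : a = 0 ∨ a = e) with rfl | rfl
    · simp
    · simpa [he] using hx
  exact
    { exists_parameters := ⟨u • e, s • e, norm_smul_le hu, norm_smul_le hs, smul_inner u,
        smul_inner s⟩
      nonempty := fun _ => ⟨0, by simp [gaussianBandit]⟩
      isCompact := fun _ => (Finset.finite_toSet _).isCompact
      norm_le := fun _ a ha => by
        rcases (by simpa [gaussianBandit] using ha : a = 0 ∨ a = e) with rfl | rfl
        · simp
        · rw [he]
          exact Real.one_le_sqrt.2 (by exact_mod_cast hd)
      reward_mem := smul_inner_mem hu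
      cost_mem := smul_inner_mem hs
      noise := isSubgaussianNoise_gaussianReal σ }

end LinearHardFamily

theorem linearBandit_lower (d : ℕ) (σ : ℝ≥0) (hd : 1 ≤ d) (hσ : 0 < σ) :
    ∃ c : ℝ, 0 < c ∧ ∀ T : ℕ, 1 ≤ T → ∀ π : Policy (EuclideanSpace ℝ (Fin d)),
      ∃ E : Environment (EuclideanSpace ℝ (Fin d)), IsLinearBandit d σ E ∧
        π.ExpectedRegretGE E T (c * √(T : ℝ)) := by
  have : (0 : ℝ) < σ := hσ
  have norm_single : ‖EuclideanSpace.single (⟨0, hd⟩ : Fin d) (1 : ℝ)‖ = 1 := by simp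
  refine ⟨min (σ : ℝ) (1 / 2) / 24, by positivity, fun T hT π => ?_⟩
  obtain ⟨u, hu, s, hs, h_regret⟩ :=
    (isHardFamily_inner norm_single).exists_expectedRegretGE hσ π hT
  exact ⟨_, isLinearBandit_gaussianBandit_inner hd norm_single σ hu hs, h_regret⟩

theorem mainTheorem3 :
    ∃ k : ℕ,
      -- multi-armed bandits: upper bound, lower bound
      ((∀ (N : ℕ) (σ : ℝ≥0), 1 ≤ N → 0 < σ →
          ∃ C : ℝ, ∀ T : ℕ, 1 ≤ T → ∃ π : Policy (Fin N),
            ∀ E : Environment (Fin N), IsMultiArmedBandit N σ E →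
              π.ExpectedRegretLE E T (C * √(T : ℝ) * (1 + Real.log T) ^ k)) ∧
        (∀ (N : ℕ) (σ : ℝ≥0), 2 ≤ N → 0 < σ →
          ∃ c : ℝ, 0 < c ∧ ∀ T : ℕ, 1 ≤ T → ∀ π : Policy (Fin N),
            ∃ E : Environment (Fin N), IsMultiArmedBandit N σ E ∧
              π.ExpectedRegretGE E T (c * √(T : ℝ)))) ∧
      -- linear bandits: upper bound, lower bound
      ((∀ (d : ℕ) (σ : ℝ≥0), 1 ≤ d → 0 < σ →
          ∃ C : ℝ, ∀ T : ℕ, 1 ≤ T → ∃ π : Policy (EuclideanSpace ℝ (Fin d)),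
            ∀ E : Environment (EuclideanSpace ℝ (Fin d)), IsLinearBandit d σ E →
              π.ExpectedRegretLE E T (C * √(T : ℝ) * (1 + Real.log T) ^ k)) ∧
        (∀ (d : ℕ) (σ : ℝ≥0), 1 ≤ d → 0 < σ →
          ∃ c : ℝ, 0 < c ∧ ∀ T : ℕ, 1 ≤ T → ∀ π : Policy (EuclideanSpace ℝ (Fin d)),
            ∃ E : Environment (EuclideanSpace ℝ (Fin d)), IsLinearBandit d σ E ∧
              π.ExpectedRegretGE E T (c * √(T : ℝ)))) :=
  ⟨1, ⟨multiArmedBandit_upper, multiArmedBandit_lower⟩, linearBandit_upper, linearBandit_lower⟩
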